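/- Let $M$ be an oriented smooth $6$-manifold and let $(E,\langle\cdot,\cdot\rangle,[\cdot,\cdot],\pi)$ be an exact Courant algebroid over $M$, where $[\cdot,\cdot]$ is the Dorfman bracket, $[\![a,b]\!]=\tfrac12([a,b]-[b,a])$, and $\pi^*:T^*M\to E$ is given by $\langle\pi^*\xi,a\rangle=\xi(\pi a)$. Let $G$ be an admissible generalized metric of signature $(1,5)$ on $E$: a smooth endomorphism of $E$ with $G^2=1$ and $\langle Ga,b\rangle=\langle a,Gb\rangle$, whose eigenbundles $V_\pm=\ker(G\mp 1)$ are such that $\langle\cdot,\cdot\rangle|_{V_+}$ has one positive and five negative directions and $V_+\cap\pi^*T^*M=0$. Put $\Pi_\pm=\frac12(1\pm G)$, $a_\pm=\Pi_\pm a$. Admissibility makes $\pi|_{V_\pm}:V_\pm\to TM$ isomorphisms; $V_+$ induces a metric $g(v,w)=\langle\pi|_{V_+}^{-1}v,\pi|_{V_+}^{-1}w\rangle$ on $M$, the isotropic splitting $s(v)=\pi|_{V_+}^{-1}v-\tfrac12\pi^*g(v)$ and the curvature three-form $H(X,Y,Z)=2\langle[\![sX,sY]\!],sZ\rangle$. *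 $G$ is *self-dual* if $\star H=H$, where $\star$ is the action of $-e_6e_5\cdots e_1$ on $\Lambda^*T^*M$ for a positively oriented orthonormal basis $e_1,\dots,e_6$ of $V_+\cong TM$, the Clifford action of $E$ on forms being $(s(v)+\frac12\pi^*\xi)\cdot\alpha=\iota_v\alpha+\xi\wedge\alpha$. (On three-forms $\star$ is the Hodge star of $g$.) * The *canonical Levi-Civita connection* is $D=D^B-\frac13T_{D^B}$, where $$D^B_ab=[a_-,b_+]_++[a_+,b_-]_-+[Ca_-,b_-]_-+[Ca_+,b_+]_+,\qquad C=\pi|_{V_-}^{-1}\pi\,\Pi_++\pi|_{V_+}^{-1}\pi\,\Pi_-,$$ $T_D(a,b,c)=\langle D_ab-D_ba-[\![a,b]\!],c\rangle+\frac12(\langle D_ca,b\rangle-\langle D_cb,a\rangle)$, and the last index of $T_{D^B}$ is raised with $\langle\cdot,\cdot\rangle$. * $\mathrm{GRic}(b_-,c_+)$ is the trace of the endomorphism $a_+\mapsto \bigl(D_{a_+}D_{b_-}-D_{b_-}D_{a_+}-D_{[\![a_+,b_-]\!]}\bigr)c_+$ of $V_+$. * $\mathrm{GS}$ is the smooth function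 on $M$ determined by $(D\!\!\!\!/_+)^2\epsilon=(D_-^S)^*D_-^S\epsilon+\mathrm{GS}\,\epsilon$ for all local positive spinors $\epsilon$ of $V_+$, where $D^S_\pm$ is the operator induced by $D$ on spinors of $V_+$ in the directions of $V_\pm$, $D\!\!\!\!/_+$ is the Dirac operator of $D^S_+$, and $(D_-^S)^*D_-^S$ is the rough Laplacian of $D_-^S$. (Conventions: $v\cdot v=-\langle v,v\rangle$; the rough Laplacian is minus the trace of the second covariant derivative along $V_-$, taken with $-\langle\cdot,\cdot\rangle|_{V_-}$.) If $G$ is self-dual and $\mathrm{GRic}=0$, then also $\mathrm{GS}=0$. Hence $G$ satisfies the generalized vacuum Einstein equations $\mathrm{GRic}=0$, $\mathrm{GS}=0$. -/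

import Mathlib

open Bundle Manifold Module
open scoped ContDiff

noncomputable section

/-! ### Courant algebroids -/

section Courant

variable {d : ℕ} {M : Type*} [TopologicalSpace M] [ChartedSpace (EuclideanSpace ℝ (Fin d)) M] [IsManifold (𝓡 d) ∞ M]

/-- Smooth vector fields on the `d`-dimensional manifold `M`. -/
def IsSmoothVF (X : ∀ x : M, TangentSpace (𝓡 d) x) : Prop :=
  ContMDiff (𝓡 d) (𝓡 d).tangent ∞ (fun x => (⟨x, X x⟩ : TangentBundle (𝓡 d) M))

/-- Smooth sections of the vector bundle `E → M` with model fibre `F`. -/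
def IsSmoothSection (d : ℕ) {M : Type*} [TopologicalSpace M]
    [ChartedSpace (EuclideanSpace ℝ (Fin d)) M] [IsManifold (𝓡 d) ∞ M]
    (F : Type*) [NormedAddCommGroup F] [NormedSpace ℝ F]
    {E : M → Type*} [TopologicalSpace (TotalSpace F E)]
    [∀ x, TopologicalSpace (E x)] [FiberBundle F E]
    (a : ∀ x, E x) : Prop :=
  ContMDiff (𝓡 d) ((𝓡 d).prod 𝓘(ℝ, F)) ∞ (fun x => TotalSpace.mk' F x (a x))

variable (d)
variable (F : Type*) [NormedAddCommGroup F] [NormedSpace ℝ F]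
  (E : M → Type*) [TopologicalSpace (TotalSpace F E)]
  [∀ x, AddCommGroup (E x)] [∀ x, Module ℝ (E x)] [∀ x, TopologicalSpace (E x)] [FiberBundle F E]

/-- A Courant algebroid structure on the vector bundle `E → M`. As for Mathlib's Lie bracket of
vector fields, the bracket is written as an operation on all set-theoretic sections, but it is
subject to the axioms, and only ever used, on smooth sections. -/
structure CourantAlgebroid where
  /-- the pairing `⟨·,·⟩` -/
  pairing : ∀ x, E x →ₗ[ℝ] E x →ₗ[ℝ] ℝ
  /-- the anchor `π : E → TM` -/
  anchor : ∀ x, E x →ₗ[ℝ] TangentSpace (𝓡 d) x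
  /-- the map `π^* : T^*M → E^* ≅ E`, dual to the anchor through the pairing -/
  coanchor : ∀ x, Dual ℝ (TangentSpace (𝓡 d) x) →ₗ[ℝ] E x
  /-- the Dorfman bracket -/
  bracket : (∀ x, E x) → (∀ x, E x) → ∀ x, E x
  pairing_symm : ∀ x (a b : E x), pairing x a b = pairing x b a
  pairing_nondegenerate : ∀ x (a : E x), (∀ b, pairing x a b = 0) → a = 0
  pairing_coanchor : ∀ x (ξ : Dual ℝ (TangentSpace (𝓡 d) x)) (a : E x),
    pairing x (coanchor x ξ) a = ξ (anchor x a)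
  pairing_smooth : ∀ a b : ∀ x, E x, IsSmoothSection d F a → IsSmoothSection d F b →
    ContMDiff (𝓡 d) 𝓘(ℝ, ℝ) ∞ (fun x => pairing x (a x) (b x))
  anchor_smooth : ∀ a : ∀ x, E x, IsSmoothSection d F a →
    IsSmoothVF (fun x => anchor x (a x))
  bracket_smooth : ∀ a b : ∀ x, E x, IsSmoothSection d F a → IsSmoothSection d F b →
    IsSmoothSection d F (bracket a b)
  bracket_add_left : ∀ a b c : ∀ x, E x, IsSmoothSection d F a → IsSmoothSection d F b →
    IsSmoothSection d F c → bracket (a + b) c = bracket a c + bracket b c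
  bracket_add_right : ∀ a b c : ∀ x, E x, IsSmoothSection d F a → IsSmoothSection d F b →
    IsSmoothSection d F c → bracket a (b + c) = bracket a b + bracket a c
  /-- (C1) -/
  jacobi : ∀ a b c : ∀ x, E x, IsSmoothSection d F a → IsSmoothSection d F b →
    IsSmoothSection d F c →
    bracket a (bracket b c) = bracket (bracket a b) c + bracket b (bracket a c)
  /-- (C2) -/
  anchor_bracket : ∀ a b : ∀ x, E x, IsSmoothSection d F a → IsSmoothSection d F b → ∀ x,
    anchor x (bracket a b x) =
      VectorField.mlieBracket (𝓡 d) (fun y => anchor y (a y)) (fun y => anchor y (b y)) x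
  /-- (C3) -/
  leibniz : ∀ (a b : ∀ x, E x) (φ : M → ℝ), IsSmoothSection d F a → IsSmoothSection d F b →
    ContMDiff (𝓡 d) 𝓘(ℝ, ℝ) ∞ φ → ∀ x,
    bracket a (fun y => φ y • b y) x =
      mvfderiv (𝓡 d) φ x (anchor x (a x)) • b x + φ x • bracket a b x
  /-- (C4) -/
  anchor_pairing : ∀ a b c : ∀ x, E x, IsSmoothSection d F a → IsSmoothSection d F b →
    IsSmoothSection d F c → ∀ x,
    mvfderiv (𝓡 d) (fun y => pairing y (b y) (c y)) x (anchor x (a x)) =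
      pairing x (bracket a b x) (c x) + pairing x (b x) (bracket a c x)
  /-- (C5) -/
  bracket_symm : ∀ a b : ∀ x, E x, IsSmoothSection d F a → IsSmoothSection d F b → ∀ x,
    bracket a b x + bracket b a x =
      coanchor x (mvfderiv (𝓡 d) (fun y => pairing y (a y) (b y)) x).toLinearMap

end Courant

/-- The inverse of a bijective linear map (and `0` if the map is not bijective). -/
def linearInverse {V W : Type*} [AddCommGroup V] [Module ℝ V] [AddCommGroup W] [Module ℝ W]
    (f : V →ₗ[ℝ] W) : W →ₗ[ℝ] V :=
  open Classical in
  if h : Function.Bijective f then (LinearEquiv.ofBijective f h).symm.toLinearMap else 0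

namespace CourantAlgebroid

variable {d : ℕ} {M : Type*} [TopologicalSpace M] [ChartedSpace (EuclideanSpace ℝ (Fin d)) M] [IsManifold (𝓡 d) ∞ M]
  {F : Type*} [NormedAddCommGroup F] [NormedSpace ℝ F]
  {E : M → Type*} [TopologicalSpace (TotalSpace F E)]
  [∀ x, AddCommGroup (E x)] [∀ x, Module ℝ (E x)] [∀ x, TopologicalSpace (E x)] [FiberBundle F E]
  (C : CourantAlgebroid d F E)

/-- Exactness of `0 → T^*M → E → TM → 0`. -/
def IsExact : Prop :=
  ∀ x, Function.Injective (C.coanchor x) ∧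
    LinearMap.range (C.coanchor x) = LinearMap.ker (C.anchor x) ∧
    Function.Surjective (C.anchor x)

/-- The (skew-symmetrized) Courant bracket. -/
def courantBracket (a b : ∀ x, E x) : ∀ x, E x :=
  fun x => (1 / 2 : ℝ) • (C.bracket a b x - C.bracket b a x)

/-- A generalized metric, given by the endomorphism `G` with `G² = 1`, `Gᵗ = G`. -/
structure GeneralizedMetric where
  /-- the endomorphism `G : E → E` -/
  G : ∀ x, E x →ₗ[ℝ] E x
  G_smooth : ∀ a : ∀ x, E x, IsSmoothSection d F a → IsSmoothSection d F (fun x => G x (a x))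
  G_sq : ∀ x (a : E x), G x (G x a) = a
  G_symm : ∀ x (a b : E x), C.pairing x (G x a) b = C.pairing x a (G x b)

namespace GeneralizedMetric

variable {C} (V : C.GeneralizedMetric)

/-- `V₊ = ker (G - 1)`. -/
def plus (x : M) : Submodule ℝ (E x) := LinearMap.ker (V.G x - LinearMap.id)

/-- `V₋ = ker (G + 1)`, the orthogonal complement of `V₊`. -/
def minus (x : M) : Submodule ℝ (E x) := LinearMap.ker (V.G x + LinearMap.id)

/-- The generalized metric has signature `(p, q)`: the pairing on `V₊` is non-degenerate with
`p` positive and `q` negative directions. -/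
def HasSignature (p q : ℕ) : Prop :=
  ∀ x, ∃ b : Basis (Fin p ⊕ Fin q) ℝ (V.plus x), ∀ i j,
    C.pairing x (b i) (b j) = if i = j then Sum.elim (fun _ => 1) (fun _ => -1) i else 0

/-- `V₊ ∩ π^*(T^*M) = 0`. -/
def IsAdmissible : Prop := ∀ x, V.plus x ⊓ LinearMap.range (C.coanchor x) = ⊥

/-- The projection `Π₊` on sections. -/
def projPlus (a : ∀ x, E x) : ∀ x, E x := fun x => (1 / 2 : ℝ) • (a x + V.G x (a x))

/-- The projection `Π₋` on sections. -/
def projMinus (a : ∀ x, E x) : ∀ x, E x := fun x => (1 / 2 : ℝ) • (a x - V.G x (a x))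

/-- The inverse `TM → V₊` of the restriction of the anchor to `V₊`. -/
def liftPlus (x : M) : TangentSpace (𝓡 d) x →ₗ[ℝ] E x :=
  (V.plus x).subtype ∘ₗ linearInverse ((C.anchor x).domRestrict (V.plus x))

/-- The inverse `TM → V₋` of the restriction of the anchor to `V₋`. -/
def liftMinus (x : M) : TangentSpace (𝓡 d) x →ₗ[ℝ] E x :=
  (V.minus x).subtype ∘ₗ linearInverse ((C.anchor x).domRestrict (V.minus x))

/-- The metric `g` on `M` induced by an admissible generalized metric. -/
def metric (x : M) : TangentSpace (𝓡 d) x →ₗ[ℝ] TangentSpace (𝓡 d) x →ₗ[ℝ] ℝ :=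
  (C.pairing x).compl₁₂ (V.liftPlus x) (V.liftPlus x)

/-- The isotropic splitting `s(v) = π₊⁻¹ v - ½ π^* g(v)`. -/
def splitting (x : M) : TangentSpace (𝓡 d) x →ₗ[ℝ] E x :=
  V.liftPlus x - (1 / 2 : ℝ) • (C.coanchor x ∘ₗ V.metric x)

/-- The three-form curvature `H` at `x`: in the identification
`s + ½ π^* : TM ⊕ T^*M ≅ E` the bracket is the standard Dorfman bracket plus `H(v₁, v₂, ·)`,
that is `H(X, Y, Z) = 2 ⟨[s X, s Y], s Z⟩` for all vector fields `X, Y, Z`; this expression is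
tensorial and alternating, and `Classical.epsilon` selects the unique form with this property. -/
def curvatureForm (x : M) : TangentSpace (𝓡 d) x [⋀^Fin 3]→ₗ[ℝ] ℝ :=
  Classical.epsilon fun η => ∀ X Y Z : ∀ y : M, TangentSpace (𝓡 d) y,
    IsSmoothVF X → IsSmoothVF Y → IsSmoothVF Z →
    η ![X x, Y x, Z x] = 2 * C.pairing x
      (C.courantBracket (fun y => V.splitting y (X y)) (fun y => V.splitting y (Y y)) x)
      (V.splitting x (Z x))

/-! ### The canonical Levi-Civita connection and its Ricci tensor -/

/-- `C = π|_{V₋}⁻¹ π Π₊ + π|_{V₊}⁻¹ π Π₋`, on sections. -/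
def swap (a : ∀ x, E x) : ∀ x, E x := fun x =>
  V.liftMinus x (C.anchor x (V.projPlus a x)) + V.liftPlus x (C.anchor x (V.projMinus a x))

/-- The Gualtieri–Bismut connection `D^B_a b`. -/
def bismut (a b : ∀ x, E x) : ∀ x, E x :=
  V.projPlus (C.bracket (V.projMinus a) (V.projPlus b))
    + V.projMinus (C.bracket (V.projPlus a) (V.projMinus b))
    + V.projMinus (C.bracket (V.swap (V.projMinus a)) (V.projMinus b))
    + V.projPlus (C.bracket (V.swap (V.projPlus a)) (V.projPlus b))

end GeneralizedMetric

/-- The generalized torsion `T_D(a, b, c)` of an operator `D_a b` on sections. -/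
def torsion (D : (∀ x, E x) → (∀ x, E x) → ∀ x, E x) (a b c : ∀ x, E x) (x : M) : ℝ :=
  C.pairing x (D a b x - D b a x - C.courantBracket a b x) (c x)
    + (1 / 2) * (C.pairing x (D c a x) (b x) - C.pairing x (D c b x) (a x))

/-- The torsion with its last index raised by the pairing: the section `T_D(a, b)` of `E` with
`⟨T_D(a, b), c⟩ = T_D(a, b, c)` for all sections `c`. -/
def torsionSharp (D : (∀ x, E x) → (∀ x, E x) → ∀ x, E x) (a b : ∀ x, E x) : ∀ x, E x :=
  fun x => Classical.epsilon fun t : E x => ∀ c : ∀ y, E y, IsSmoothSection d F c →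
    C.pairing x t (c x) = C.torsion D a b c x

/-- The generalized curvature `GR(a, b) c` of `D`. -/
def curvature (D : (∀ x, E x) → (∀ x, E x) → ∀ x, E x) (a b c : ∀ x, E x) : ∀ x, E x :=
  D a (D b c) - D b (D a c) - D (C.courantBracket a b) c

namespace GeneralizedMetric

variable {C} (V : C.GeneralizedMetric)

/-- The canonical Levi-Civita connection `D^{LC} = D^B - ⅓ T_{D^B}`. -/
def leviCivita (a b : ∀ x, E x) : ∀ x, E x :=
  V.bismut a b - (1 / 3 : ℝ) • C.torsionSharp V.bismut a b

/-- The generalized Ricci tensor at `x`, for sections `b` of `V₋` and `c` of `V₊`: the trace of the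
endomorphism `a ↦ GR(a, b) c` of `V₊`. For such `b`, `c` this operation is tensorial in the section
`a` of `V₊`, and `Classical.epsilon` selects the unique endomorphism of the fibre inducing it. -/
def ricci (b c : ∀ x, E x) (x : M) : ℝ :=
  LinearMap.trace ℝ (V.plus x) (Classical.epsilon fun T : Module.End ℝ (V.plus x) =>
    ∀ (a : ∀ y, E y) (ha : ∀ y, a y ∈ V.plus y), IsSmoothSection d F a →
      (T ⟨a x, ha x⟩ : E x) = C.curvature V.leviCivita a b c x)

/-- `GRic = 0`. -/
def IsRicciFlat : Prop :=
  ∀ b c : ∀ x, E x, IsSmoothSection d F b → IsSmoothSection d F c →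
    (∀ x, b x ∈ V.minus x) → (∀ x, c x ∈ V.plus x) → ∀ x, V.ricci b c x = 0

end GeneralizedMetric

end CourantAlgebroid

/-! ### Self-duality and generalized scalar curvature in dimension six -/

/-- An orientation of the manifold `M`: an orientation of every tangent space which, near every
point, is the one given by a smooth frame. -/
structure ManifoldOrientation (d : ℕ) (M : Type*) [TopologicalSpace M]
    [ChartedSpace (EuclideanSpace ℝ (Fin d)) M] [IsManifold (𝓡 d) ∞ M] where
  /-- the orientation of the tangent space at `x` -/
  at_ : ∀ x : M, Orientation ℝ (TangentSpace (𝓡 d) x) (Fin d)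
  locally_framed : ∀ x : M, ∃ X : Fin d → ∀ y : M, TangentSpace (𝓡 d) y,
    (∀ i, IsSmoothVF (X i)) ∧ ∀ᶠ y in nhds x,
      ∃ b : Basis (Fin d) ℝ (TangentSpace (𝓡 d) y), (∀ i, b i = X i y) ∧ b.orientation = at_ y

/-- The signs `(+, -, -, -, -, -)`. -/
def lorentzSign (i : Fin 6) : ℝ := if i = 0 then 1 else -1

/-- A three-form `η` as an element `∑_{i<j<k} η_{ijk} bⁱ ∧ bʲ ∧ bᵏ` of the exterior algebra of the
dual space (independent of the basis `b`). -/
def formSpinor {W : Type*} [AddCommGroup W] [Module ℝ W] (b : Basis (Fin 6) ℝ W)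
    (η : W [⋀^Fin 3]→ₗ[ℝ] ℝ) : ExteriorAlgebra ℝ (Dual ℝ W) :=
  (1 / 6 : ℝ) • ∑ i, ∑ j, ∑ k, η ![b i, b j, b k] •
    (ExteriorAlgebra.ι ℝ (b.coord i) * ExteriorAlgebra.ι ℝ (b.coord j) *
      ExteriorAlgebra.ι ℝ (b.coord k))

namespace CourantAlgebroid.GeneralizedMetric

variable {M : Type*} [TopologicalSpace M] [ChartedSpace (EuclideanSpace ℝ (Fin 6)) M] [IsManifold (𝓡 6) ∞ M]
  {F : Type*} [NormedAddCommGroup F] [NormedSpace ℝ F]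
  {E : M → Type*} [TopologicalSpace (TotalSpace F E)]
  [∀ x, AddCommGroup (E x)] [∀ x, Module ℝ (E x)] [∀ x, TopologicalSpace (E x)] [FiberBundle F E]
  {C : CourantAlgebroid 6 F E} (V : C.GeneralizedMetric)

/-- Clifford action of `e ∈ E x` on forms: if `e = s(v) + ½ π^* ξ`, then `e · α = ι_v α + ξ ∧ α`;
here `v = π e` and `ξ(w) = 2 ⟨e, s w⟩`. -/
def cliffordAct (x : M) (e : E x) (α : ExteriorAlgebra ℝ (Dual ℝ (TangentSpace (𝓡 6) x))) :
    ExteriorAlgebra ℝ (Dual ℝ (TangentSpace (𝓡 6) x)) :=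
  CliffordAlgebra.contractLeft (Dual.eval ℝ _ (C.anchor x e)) α
    + ExteriorAlgebra.ι ℝ ((2 : ℝ) • (C.pairing x e ∘ₗ V.splitting x)) * α

/-- The Clifford action of `- e₆ e₅ e₄ e₃ e₂ e₁` on forms (with indices starting from `0`). -/
def hodgeStar (x : M) (e : Fin 6 → E x)
    (α : ExteriorAlgebra ℝ (Dual ℝ (TangentSpace (𝓡 6) x))) :
    ExteriorAlgebra ℝ (Dual ℝ (TangentSpace (𝓡 6) x)) :=
  -V.cliffordAct x (e 5) (V.cliffordAct x (e 4) (V.cliffordAct x (e 3)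
    (V.cliffordAct x (e 2) (V.cliffordAct x (e 1) (V.cliffordAct x (e 0) α)))))

/-- `e` is an orthonormal basis of `V₊` at `x`. -/
def IsOrthonormalPlus (x : M) (e : Fin 6 → E x) : Prop :=
  (∀ i, e i ∈ V.plus x) ∧ ∀ i j, C.pairing x (e i) (e j) = if i = j then lorentzSign i else 0

/-- `f` is an orthonormal basis of `V₋` at `x`; the pairing on `V₋` has signature `(5, 1)`. -/
def IsOrthonormalMinus (x : M) (f : Fin 6 → E x) : Prop :=
  (∀ i, f i ∈ V.minus x) ∧ ∀ i j, C.pairing x (f i) (f j) = if i = j then -lorentzSign i else 0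

/-- Self-duality `⋆ H = H`, where `⋆` is the Clifford action of `- e₆ ⋯ e₁` for a positive
orthonormal basis of `V₊`, which is oriented by `π|_{V₊} : V₊ ≅ TM`. -/
def IsSelfDual (o : ManifoldOrientation 6 M) : Prop :=
  ∀ (x : M) (e : Fin 6 → E x) (b : Basis (Fin 6) ℝ (TangentSpace (𝓡 6) x)),
    V.IsOrthonormalPlus x e → (∀ i, b i = C.anchor x (e i)) → b.orientation = o.at_ x →
    V.hodgeStar x e (formSpinor b (V.curvatureForm x)) = formSpinor b (V.curvatureForm x)

section Spinors

variable {S : Type*} [NormedAddCommGroup S] [NormedSpace ℝ S]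
  (e f : Fin 6 → ∀ x, E x) (γ : Fin 6 → Module.End ℝ S)

/-- The spin connection induced by `D^{LC}` on spinors of `V₊`, in an orthonormal frame `e` of `V₊`
which acts on the spinor space `S` through the matrices `γ`:
`D^S_a ε = π(a)(ε) + ¼ ∑_{i,j} ⟨D_a eᵢ, eⱼ⟩ eⁱ eʲ · ε`. -/
def spinDeriv (a : ∀ x, E x) (ε : M → S) : M → S := fun x =>
  mvfderiv (𝓡 6) ε x (C.anchor x (a x)) + (1 / 4 : ℝ) • ∑ i, ∑ j,
    (lorentzSign i * lorentzSign j * C.pairing x (V.leviCivita a (e i) x) (e j x)) •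
      γ i (γ j (ε x))

/-- The Dirac operator `∑ᵢ eⁱ · D^S_{eᵢ} ε`. -/
def dirac (ε : M → S) : M → S := fun x =>
  ∑ i, lorentzSign i • γ i (V.spinDeriv e γ (e i) ε x)

/-- The rough Laplacian `(D^S_-)^* D^S_- ε = - tr (D_-^2 ε)`, where `D^S_- ε` is the restriction of
`D^S ε` to `V₋`, in an orthonormal frame `f` of `V₋`. The trace is taken with respect to the metric
`-⟨·,·⟩` on `V₋`, which is `g` under `π|_{V₋} : V₋ ≅ TM`. -/
def roughLaplacian (ε : M → S) : M → S := fun x =>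
  -∑ j, lorentzSign j • (V.spinDeriv e γ (f j) (V.spinDeriv e γ (f j) ε) x
    - V.spinDeriv e γ (V.leviCivita (f j) (f j)) ε x)

end Spinors

/-- `φ` is the generalized scalar curvature `GS`, i.e. the function with the Lichnerowicz-type
formula `(D_+)² ε = (D_-)^* D_- ε + φ ε`, where `D_+` is the Dirac operator on `S₊(V₊)`.

Spinors are written locally, which needs no global spin structure: on an open set `U` with a
positive orthonormal frame `e` of `V₊` and an orthonormal frame `f` of `V₋`, a spinor is a function
with values in a module `S` over the Clifford algebra of `V₊` (with `v · v = -⟨v, v⟩`), the action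
of `eᵢ` being `γ i`; the positive spinors are those fixed by the volume element `e₁ ⋯ e₆`. -/
def IsGeneralizedScalarCurvature (o : ManifoldOrientation 6 M) (φ : M → ℝ) : Prop :=
  ContMDiff (𝓡 6) 𝓘(ℝ, ℝ) ∞ φ ∧
  ∀ (S : Type) [NormedAddCommGroup S] [NormedSpace ℝ S] [FiniteDimensional ℝ S]
    (γ : Fin 6 → Module.End ℝ S),
    (∀ i j, γ i * γ j + γ j * γ i = if i = j then (-2 * lorentzSign i) • 1 else 0) →
  ∀ (U : Set M) (e f : Fin 6 → ∀ x, E x), IsOpen U →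
    (∀ i, IsSmoothSection 6 F (e i)) → (∀ i, IsSmoothSection 6 F (f i)) →
    (∀ x ∈ U, V.IsOrthonormalPlus x (fun i => e i x)) →
    (∀ x ∈ U, V.IsOrthonormalMinus x (fun i => f i x)) →
    (∀ x ∈ U, ∃ b : Basis (Fin 6) ℝ (TangentSpace (𝓡 6) x),
      (∀ i, b i = C.anchor x (e i x)) ∧ b.orientation = o.at_ x) →
  ∀ ε : M → S, ContMDiff (𝓡 6) 𝓘(ℝ, S) ∞ ε →
    (∀ x, (γ 0 * γ 1 * γ 2 * γ 3 * γ 4 * γ 5) (ε x) = ε x) →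
  ∀ x ∈ U, V.dirac e γ (V.dirac e γ ε) x = V.roughLaplacian e f γ ε x + φ x • ε x

/-- The generalized vacuum Einstein equations `GRic = 0`, `GS = 0`. -/
def SatisfiesVacuumEinstein (o : ManifoldOrientation 6 M) : Prop :=
  V.IsRicciFlat ∧ V.IsGeneralizedScalarCurvature o (fun _ => 0)

end CourantAlgebroid.GeneralizedMetric

end

/-! Near a point take an orthonormal frame `e` of V₊, and let `f` be the frame of V₋ with the same
anchors. With signs η = `lorentzSign`, everything becomes an expression in the structure functions
F_ijk = ⟨[eᵢ,eⱼ],eₖ⟩, B_ijk = ⟨[fᵢ,eⱼ],eₖ⟩, N_ijk = ⟨[eᵢ,fⱼ],fₖ⟩ and their first derivatives. The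
sections eᵢ − fᵢ lie in π^*T^*M, where the bracket vanishes; hence N is determined by F and B
(`N3_eq`). The torsion of D^B on V₊ is H_ijk = B_ijk + B_jki + B_kij − F_ijk (`H3_eq`), and it is
the curvature three-form (`curvatureForm_apply`).

In the difference of the squared Dirac operator and the rough Laplacian all derivatives of the
spinor cancel (`lichnerowicz`). A Clifford element of order zero remains. The Jacobi identity for
four vectors of `e` trades its derivatives of F for squares of two-forms, which cancel against the
square of the cubic Dirac term and the square of the spin connection (`q4_dF`, `q3_sq`). The
contracted Jacobi identity for one `f` and three `e` removes the two-form part (`contracted_jac3`).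
What survives is the scalar |F|²/24 − |B|²/8 − ½ Σ ηᵢ ∂ᵢdᵢ − ¼ Σ ηᵢ dᵢ², with dⱼ = Σ ηᵢ B_iji
(`zeroth_order`).

Comparison with the traced Ricci tensor shows that this scalar, which is GS, equals ¼ Σ ηₖ
GRic(fₖ,eₖ) + |H|²/24, where |H|² = Σ ηᵢηⱼηₖ H_ijk² over all indices (`scalar_identity` is the case
where both terms vanish). So GRic = 0 leaves only |H|².

Self-duality makes H an eigenform of the volume element, so the components of H on complementary
triples have equal squares (`sq_eq_sq_of_volume_eigen`). Exactly one of two complementary triples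
contains the index of the positive direction, so in signature (1,5) they enter |H|² with opposite
signs, and |H|² = 0 (`tr3_sq_eq_zero`).

The rough Laplacian is defined with an arbitrary orthonormal frame of V₋; `neg_roughLaplacian_eq`
rewrites it in the adapted frame `f`. -/

set_option linter.unusedSectionVars false

noncomputable section

/-! ### Smooth sections, derivatives along the anchor, and the bracket calculus -/

namespace CourantAlgebroid

section Sections

variable {d : ℕ} {M : Type*} [TopologicalSpace M] [ChartedSpace (EuclideanSpace ℝ (Fin d)) M] [IsManifold (𝓡 d) ∞ M]
  {F : Type*} [NormedAddCommGroup F] [NormedSpace ℝ F]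
  {E : M → Type*} [TopologicalSpace (TotalSpace F E)]
  [∀ x, AddCommGroup (E x)] [∀ x, Module ℝ (E x)] [∀ x, TopologicalSpace (E x)] [FiberBundle F E]
  (C : CourantAlgebroid d F E)

/-- The smooth sections of the bundle underlying a Courant algebroid. -/
abbrev Sec (_C : CourantAlgebroid d F E) := ContMDiffSection (𝓡 d) F ∞ E

variable {C} in
theorem Sec.smooth (a : C.Sec) : IsSmoothSection d F (a : ∀ x, E x) := a.contMDiff

/-- A smooth section as an element of `C.Sec`. -/
def mkSec (a : ∀ x, E x) (h : IsSmoothSection d F a) : C.Sec := ⟨a, h⟩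

@[simp] theorem coe_mkSec (a : ∀ x, E x) (h : IsSmoothSection d F a) :
    (C.mkSec a h : ∀ x, E x) = a := rfl

/-- The pairing of two sections. -/
def pair (a b : C.Sec) : M → ℝ := fun x => C.pairing x (a x) (b x)

/-- The derivative of a vector-valued function along the anchor of a section. -/
def der {S : Type*} [NormedAddCommGroup S] [NormedSpace ℝ S] (a : C.Sec) (φ : M → S) : M → S :=
  fun x => mvfderiv (𝓡 d) φ x (C.anchor x (a x))

theorem pair_smooth (a b : C.Sec) : ContMDiff (𝓡 d) 𝓘(ℝ, ℝ) ∞ (C.pair a b) :=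
  C.pairing_smooth a b a.smooth b.smooth

theorem pair_comm (a b : C.Sec) : C.pair a b = C.pair b a :=
  funext fun x => C.pairing_symm x _ _

/-- The derivative is the fibre component of the tangent map of `φ` composed with the smooth vector
field π(a). -/
theorem der_smooth {S : Type*} [NormedAddCommGroup S] [NormedSpace ℝ S] (a : C.Sec) {φ : M → S}
    (hφ : ContMDiff (𝓡 d) 𝓘(ℝ, S) ∞ φ) : ContMDiff (𝓡 d) 𝓘(ℝ, S) ∞ (C.der a φ) := by
  have h1 : ContMDiff (𝓡 d).tangent 𝓘(ℝ, S).tangent ∞ (tangentMap (𝓡 d) 𝓘(ℝ, S) φ) :=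
    hφ.contMDiff_tangentMap (by simp)
  exact (contMDiff_snd_tangentBundle_modelSpace S 𝓘(ℝ, S)).comp
    (h1.comp (C.anchor_smooth a a.smooth))

section der

variable {S : Type*} [NormedAddCommGroup S] [NormedSpace ℝ S] (a : C.Sec)

theorem der_const (c : S) : C.der a (fun _ => c) = 0 := by
  funext x; simp [der, mvfderiv_const]

theorem der_add_fun {φ ψ : M → S} (hφ : ContMDiff (𝓡 d) 𝓘(ℝ, S) ∞ φ)
    (hψ : ContMDiff (𝓡 d) 𝓘(ℝ, S) ∞ ψ) :
    C.der a (fun x => φ x + ψ x) = fun x => C.der a φ x + C.der a ψ x := by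
  funext x
  simp [der, mvfderiv_fun_add (hφ.mdifferentiableAt (by simp)) (hψ.mdifferentiableAt (by simp))]

theorem der_smul_fun {φ : M → ℝ} {ψ : M → S} (hφ : ContMDiff (𝓡 d) 𝓘(ℝ, ℝ) ∞ φ)
    (hψ : ContMDiff (𝓡 d) 𝓘(ℝ, S) ∞ ψ) :
    C.der a (fun x => φ x • ψ x) = fun x => φ x • C.der a ψ x + C.der a φ x • ψ x := by
  funext x
  simp [der, mvfderiv_fun_smul (hφ.mdifferentiableAt (by simp)) (hψ.mdifferentiableAt (by simp))]

theorem der_congr {φ ψ : M → S} {x : M} (h : φ =ᶠ[nhds x] ψ) : C.der a φ x = C.der a ψ x := by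
  simp only [der, mvfderiv, h.mfderiv_eq]
  rfl

end der

section
variable [VectorBundle ℝ F E]

theorem der_add_sec {S : Type*} [NormedAddCommGroup S] [NormedSpace ℝ S] (a b : C.Sec) (φ : M → S) :
    C.der (a + b) φ = C.der a φ + C.der b φ := by
  funext x; simp [der]

theorem bracket_const_smul_right (r : ℝ) (a b : C.Sec) :
    C.bracket a (r • (b : ∀ x, E x)) = r • C.bracket a b := by
  funext x
  have := C.leibniz a b (fun _ => r) a.smooth b.smooth contMDiff_const x
  rw [mvfderiv_const, zero_apply, zero_smul, zero_add] at this
  exact this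

theorem mvfderiv_const_mul (r : ℝ) {φ : M → ℝ} (hφ : ContMDiff (𝓡 d) 𝓘(ℝ, ℝ) ∞ φ) (x : M) :
    mvfderiv (𝓡 d) (fun y => r * φ y) x = r • mvfderiv (𝓡 d) φ x := by
  ext v
  have h := mvfderiv_fun_mul (I := 𝓡 d) (x := x) (mdifferentiableAt_const (c := r))
    (hφ.mdifferentiableAt (x := x) (by simp))
  rw [h]; simp [mvfderiv_const]

/-- The Leibniz axiom (C3) covers the second slot only; (C5) carries homogeneity over to the first.
-/
theorem bracket_const_smul_left (r : ℝ) (a b : C.Sec) :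
    C.bracket (r • (a : ∀ x, E x)) b = r • C.bracket a b := by
  funext x
  have h1 := C.bracket_symm (r • (a : ∀ x, E x)) b (r • a : C.Sec).smooth b.smooth x
  have h2 := C.bracket_symm a b a.smooth b.smooth x
  rw [bracket_const_smul_right] at h1
  have h3 := mvfderiv_const_mul r (C.pair_smooth a b) x
  simp only [Pi.smul_apply, map_smul, LinearMap.smul_apply, smul_eq_mul] at h1 ⊢
  erw [h3] at h1
  have h4 : C.coanchor x (r • mvfderiv (𝓡 d) (fun y => C.pairing y (a y) (b y)) x).toLinearMap
      = r • C.coanchor x (mvfderiv (𝓡 d) (C.pair a b) x).toLinearMap := by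
    rw [← map_smul]; rfl
  erw [h4, ← h2, smul_add] at h1
  exact add_right_cancel h1

/-- The Dorfman bracket on smooth sections. -/
def br : C.Sec →ₗ[ℝ] C.Sec →ₗ[ℝ] C.Sec :=
  LinearMap.mk₂ ℝ (fun a b => C.mkSec (C.bracket a b) (C.bracket_smooth a b a.smooth b.smooth))
    (fun a b c => ContMDiffSection.coe_inj (C.bracket_add_left a b c a.smooth b.smooth c.smooth))
    (fun r a b => ContMDiffSection.coe_inj (C.bracket_const_smul_left r a b))
    (fun a b c => ContMDiffSection.coe_inj (C.bracket_add_right a b c a.smooth b.smooth c.smooth))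
    (fun r a b => ContMDiffSection.coe_inj (C.bracket_const_smul_right r a b))

theorem br_apply (a b : C.Sec) (x : M) : C.br a b x = C.bracket a b x := rfl

@[simp] theorem coe_br (a b : C.Sec) : (C.br a b : ∀ x, E x) = C.bracket a b := rfl

theorem pair_add_left (a b c : C.Sec) : C.pair (a + b) c = C.pair a c + C.pair b c := by
  funext x; simp [pair]

theorem pair_add_right (a b c : C.Sec) : C.pair a (b + c) = C.pair a b + C.pair a c := by
  funext x; simp [pair]

theorem pair_sub_left (a b c : C.Sec) : C.pair (a - b) c = C.pair a c - C.pair b c := by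
  funext x; simp [pair]

theorem pair_sub_right (a b c : C.Sec) : C.pair a (b - c) = C.pair a b - C.pair a c := by
  funext x; simp [pair]

theorem pair_smul_left (r : ℝ) (a b : C.Sec) : C.pair (r • a) b = r • C.pair a b := by
  funext x; simp [pair]

theorem pair_smul_right (r : ℝ) (a b : C.Sec) : C.pair a (r • b) = r • C.pair a b := by
  funext x; simp [pair]

theorem pair_neg_left (a b : C.Sec) : C.pair (-a) b = - C.pair a b := by
  funext x; simp [pair]

/-- Invariance of the pairing. -/
theorem der_pair (a b c : C.Sec) (x : M) :
    C.der a (C.pair b c) x = C.pair (C.br a b) c x + C.pair b (C.br a c) x :=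
  C.anchor_pairing a b c a.smooth b.smooth c.smooth x

/-- The symmetric part of the bracket. -/
theorem pair_br_symm (a b c : C.Sec) (x : M) :
    C.pair (C.br a b) c x + C.pair (C.br b a) c x = C.der c (C.pair a b) x := by
  have h := C.bracket_symm a b a.smooth b.smooth x
  simp only [pair, br_apply]
  rw [← LinearMap.add_apply, ← map_add, h, C.pairing_coanchor]
  rfl

/-- (C5) followed by (C4) removes a nested bracket, so that the Jacobi identity involves only
derivatives of structure functions and pairings of two simple brackets. -/
theorem pair_br_br (a b c e : C.Sec) (x : M) :
    C.pair (C.br (C.br a b) c) e x = C.der e (C.pair (C.br a b) c) x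
      - C.der c (C.pair (C.br a b) e) x + C.pair (C.br a b) (C.br c e) x := by
  have h1 := C.pair_br_symm (C.br a b) c e x
  have h2 := C.der_pair c (C.br a b) e x
  linarith

/-- The Jacobi identity, paired with a fourth section. -/
theorem jacobi_pair (a b c e : C.Sec) (x : M) :
    C.der a (C.pair (C.br b c) e) x - C.der b (C.pair (C.br a c) e) x
      + C.der c (C.pair (C.br a b) e) x - C.der e (C.pair (C.br a b) c) x
    = C.pair (C.br b c) (C.br a e) x - C.pair (C.br a c) (C.br b e) x
      + C.pair (C.br a b) (C.br c e) x := by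
  have h : C.br a (C.br b c) = C.br (C.br a b) c + C.br b (C.br a c) :=
    ContMDiffSection.coe_inj (C.jacobi a b c a.smooth b.smooth c.smooth)
  have h0 : C.pair (C.br a (C.br b c)) e x = C.pair (C.br (C.br a b) c) e x
      + C.pair (C.br b (C.br a c)) e x := by
    rw [h, pair_add_left]; rfl
  have h1 := C.der_pair a (C.br b c) e x
  have h2 := C.der_pair b (C.br a c) e x
  have h3 := C.pair_br_br a b c e x
  linarith

/-- The product of a smooth function with a section. -/
def fsmul (φ : M → ℝ) (hφ : ContMDiff (𝓡 d) 𝓘(ℝ, ℝ) ∞ φ) (a : C.Sec) : C.Sec :=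
  C.mkSec (fun x => φ x • a x) (hφ.smul_section a.smooth)

@[simp] theorem fsmul_apply (φ : M → ℝ) (hφ : ContMDiff (𝓡 d) 𝓘(ℝ, ℝ) ∞ φ) (a : C.Sec) (x : M) :
    C.fsmul φ hφ a x = φ x • a x := rfl

theorem br_fsmul (a b : C.Sec) (φ : M → ℝ) (hφ : ContMDiff (𝓡 d) 𝓘(ℝ, ℝ) ∞ φ) :
    C.br a (C.fsmul φ hφ b) = C.fsmul (C.der a φ) (C.der_smooth a hφ) b
      + C.fsmul φ hφ (C.br a b) :=
  ContMDiffSection.ext fun x => C.leibniz a b φ a.smooth b.smooth hφ x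

/-- A local smooth extension of `v` is cut off by a bump function equal to 1 at `x`. Pointwise
identities can therefore be tested against global sections. -/
theorem exists_sec [T2Space M] [ContMDiffVectorBundle ∞ F E (𝓡 d)] (x : M) (v : E x) :
    ∃ s : C.Sec, s x = v := by
  obtain ⟨s, hs, hv⟩ := FiberBundle.exists_contMDiffOn_extend (k := ∞) (𝓡 d) F v
  obtain ⟨f, -, hf⟩ := (SmoothBumpFunction.nhds_basis_tsupport (I := 𝓡 d) x).mem_iff.1
    (interior_mem_nhds.2 hs)
  refine ⟨C.mkSec ((f : M → ℝ) • FiberBundle.extend F v) ?_, ?_⟩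
  · exact ContMDiffOn.smul_section_of_tsupport f.contMDiff.contMDiffOn isOpen_interior hf
      (hv.mono interior_subset)
  · change f x • FiberBundle.extend F v x = v
    rw [f.eq_one, one_smul, FiberBundle.extend_apply_self]

end

end Sections

end CourantAlgebroid

/-! ### Brackets act on functions as commutators -/

namespace CourantAlgebroid

section Commutator

variable {d : ℕ} {M : Type*} [TopologicalSpace M] [ChartedSpace (EuclideanSpace ℝ (Fin d)) M] [IsManifold (𝓡 d) ∞ M]
  {F : Type*} [NormedAddCommGroup F] [NormedSpace ℝ F]
  {E : M → Type*} [TopologicalSpace (TotalSpace F E)]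
  [∀ x, AddCommGroup (E x)] [∀ x, Module ℝ (E x)] [∀ x, TopologicalSpace (E x)] [FiberBundle F E]
  (C : CourantAlgebroid d F E) [VectorBundle ℝ F E]

/-- Expanding the Jacobi identity on `φ c` by the Leibniz rule leaves the commutator defect of `φ`
multiplied by `c`; a section with `c x ≠ 0` isolates it. If the fibre is zero, every anchor at `x`
vanishes. -/
theorem der_br_real [T2Space M] [ContMDiffVectorBundle ∞ F E (𝓡 d)] (a b : C.Sec) {φ : M → ℝ}
    (hφ : ContMDiff (𝓡 d) 𝓘(ℝ, ℝ) ∞ φ) (x : M) :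
    C.der (C.br a b) φ x = C.der a (C.der b φ) x - C.der b (C.der a φ) x := by
  by_cases hE : ∃ v : E x, v ≠ 0
  swap
  · push Not at hE
    simp [der, hE]
  obtain ⟨v, hv⟩ := hE
  obtain ⟨c, rfl⟩ := C.exists_sec x v
  have h : C.br a (C.br b (C.fsmul φ hφ c)) = C.br (C.br a b) (C.fsmul φ hφ c)
      + C.br b (C.br a (C.fsmul φ hφ c)) :=
    ContMDiffSection.coe_inj (C.jacobi a b _ a.smooth b.smooth (C.fsmul φ hφ c).smooth)
  have h' : C.br a (C.br b c) = C.br (C.br a b) c + C.br b (C.br a c) :=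
    ContMDiffSection.coe_inj (C.jacobi a b c a.smooth b.smooth c.smooth)
  simp only [br_fsmul, map_add, h'] at h
  have h2 := congrArg (fun s : C.Sec => s x) h
  simp only [ContMDiffSection.coe_add, Pi.add_apply, fsmul_apply] at h2
  have h3 : (C.der (C.br a b) φ x - (C.der a (C.der b φ) x - C.der b (C.der a φ) x)) • c x = 0 := by
    rw [sub_smul, sub_smul, sub_eq_zero]
    rw [← sub_eq_zero] at h2 ⊢
    rw [← neg_eq_zero, ← h2]
    module
  rcases smul_eq_zero.1 h3 with h4 | h4
  · linarith
  · exact absurd h4 hv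

theorem der_clm {S T : Type*} [NormedAddCommGroup S] [NormedSpace ℝ S] [NormedAddCommGroup T]
    [NormedSpace ℝ T] (a : C.Sec) (L : S →L[ℝ] T) {φ : M → S}
    (hφ : ContMDiff (𝓡 d) 𝓘(ℝ, S) ∞ φ) (x : M) :
    C.der a (fun y => L (φ y)) x = L (C.der a φ x) := by
  have h1 := L.hasMFDerivAt (x := φ x)
  have h2 := (hφ.mdifferentiableAt (x := x) (by simp)).hasMFDerivAt
  have h3 := (h1.comp x h2).mfderiv
  simp only [der, mvfderiv]
  change (mfderiv (𝓡 d) 𝓘(ℝ, T) (L ∘ φ) x) (C.anchor x (a x)) = _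
  rw [h3]
  rfl

/-- Continuous functionals separate the points of `S` and commute with `der`, which reduces the
claim to real-valued functions. -/
theorem der_br [T2Space M] [ContMDiffVectorBundle ∞ F E (𝓡 d)] {S : Type*} [NormedAddCommGroup S]
    [NormedSpace ℝ S] (a b : C.Sec) {φ : M → S} (hφ : ContMDiff (𝓡 d) 𝓘(ℝ, S) ∞ φ) (x : M) :
    C.der (C.br a b) φ x = C.der a (C.der b φ) x - C.der b (C.der a φ) x := by
  rw [SeparatingDual.eq_iff_forall_dual_eq (R := ℝ)]
  intro L
  have hL : ContMDiff (𝓡 d) 𝓘(ℝ, ℝ) ∞ (fun y => L (φ y)) := L.contMDiff.comp hφ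
  have e : ∀ c : C.Sec, (fun y => L (C.der c φ y)) = C.der c (fun y => L (φ y)) := fun c =>
    funext fun y => (der_clm C c L hφ y).symm
  rw [map_sub, ← der_clm C _ L hφ, ← der_clm C _ L (C.der_smooth _ hφ),
    ← der_clm C _ L (C.der_smooth _ hφ), der_br_real C a b hL, e, e]

end Commutator

/-! ### Smooth lifts of vector fields -/

section Lift

variable {d : ℕ} {M : Type*} [TopologicalSpace M] [ChartedSpace (EuclideanSpace ℝ (Fin d)) M] [IsManifold (𝓡 d) ∞ M]

theorem contMDiffAt_det {ι : Type*} [Fintype ι] [DecidableEq ι] {A : M → Matrix ι ι ℝ} {x : M}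
    (hA : ∀ i j, ContMDiffAt (𝓡 d) 𝓘(ℝ, ℝ) ∞ (fun y => A y i j) x) :
    ContMDiffAt (𝓡 d) 𝓘(ℝ, ℝ) ∞ (fun y => (A y).det) x := by
  simp only [Matrix.det_apply']
  refine ContMDiffAt.sum fun σ _ => ?_
  have : ContMDiffAt (𝓡 d) 𝓘(ℝ, ℝ) ∞ (fun y => ∏ i, A y (σ i) i) x :=
    contMDiffAt_finsetProd fun i _ => hA _ _
  exact contMDiffAt_const.mul this

/-- A smooth vector field is, near a point, a smooth combination of vector fields forming a basis
at that point. -/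
theorem exists_smooth_coeff (s : Fin d → ∀ x : M, TangentSpace (𝓡 d) x) (hs : ∀ i, IsSmoothVF (s i))
    {x : M} (hli : LinearIndependent ℝ fun i => s i x) (X : ∀ x : M, TangentSpace (𝓡 d) x)
    (hX : IsSmoothVF X) :
    ∃ c : Fin d → M → ℝ, (∀ i, ContMDiffAt (𝓡 d) 𝓘(ℝ, ℝ) ∞ (c i) x) ∧
      ∀ᶠ y in nhds x, X y = ∑ i, c i y • s i y := by
  let b : Basis (Fin d) ℝ (EuclideanSpace ℝ (Fin d)) := (EuclideanSpace.basisFun (Fin d) ℝ).toBasis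
  let t := trivializationAt (EuclideanSpace ℝ (Fin d)) (TangentSpace (𝓡 d) : M → Type _) x
  have hx : x ∈ t.baseSet := FiberBundle.mem_baseSet_trivializationAt' x
  let k : ∀ y : M, Fin d → TangentSpace (𝓡 d) y → ℝ := fun y i v => t.localFrameCoeff (𝓡 d) b i y v
  have hk : ∀ (Y : ∀ x : M, TangentSpace (𝓡 d) x), IsSmoothVF Y → ∀ i,
      ContMDiffAt (𝓡 d) 𝓘(ℝ, ℝ) ∞ (fun y => k y i (Y y)) x := fun Y hY i =>
    contMDiffAt_localFrameCoeff (k := ∞) b hx hY.contMDiffAt i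
  let A : M → Matrix (Fin d) (Fin d) ℝ := fun y => Matrix.of fun i j => k y i (s j y)
  have hA : ∀ i j, ContMDiffAt (𝓡 d) 𝓘(ℝ, ℝ) ∞ (fun y => A y i j) x := fun i j => hk _ (hs j) i
  have hdet : ContMDiffAt (𝓡 d) 𝓘(ℝ, ℝ) ∞ (fun y => (A y).det) x := contMDiffAt_det hA
  have hx0 : (A x).det ≠ 0 := by
    have hcard : Fintype.card (Fin d) = finrank ℝ (TangentSpace (𝓡 d) x) := by
      change _ = finrank ℝ (EuclideanSpace ℝ (Fin d)); simp
    have : Nonempty (Fin d) ∨ d = 0 := by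
      rcases Nat.eq_zero_or_pos d with h | h
      · exact Or.inr h
      · exact Or.inl ⟨⟨0, h⟩⟩
    have hA' : A x = (t.basisAt b hx).toMatrix (fun j => s j x) := by
      ext i j
      simp only [A, k, Matrix.of_apply, Basis.toMatrix_apply]
      rw [t.localFrameCoeff_apply_of_mem_baseSet b hx (s j)]
    have hu : IsUnit ((t.basisAt b hx).toMatrix (fun j => s j x)).det := by
      have : FiniteDimensional ℝ (TangentSpace (𝓡 d) x) :=
        inferInstanceAs (FiniteDimensional ℝ (EuclideanSpace ℝ (Fin d)))
      have h1 := (t.basisAt b hx).invertibleToMatrix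
        (basisOfLinearIndependentOfCardEqFinrank' (b := fun j => s j x) hli hcard)
      rw [coe_basisOfLinearIndependentOfCardEqFinrank'] at h1
      exact (Matrix.isUnit_iff_isUnit_det _).1 (isUnit_of_invertible _)
    rw [hA']; exact hu.ne_zero
  have hne : ∀ᶠ y in nhds x, (A y).det ≠ 0 := hdet.continuousAt.eventually_ne hx0
  have hbase : ∀ᶠ y in nhds x, y ∈ t.baseSet := t.open_baseSet.mem_nhds hx
  -- Cramer's rule: the coefficients are A⁻¹ applied to the coordinates of `X`. Written with the
  -- adjugate and the determinant, they are smooth wherever the determinant does not vanish.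
  refine ⟨fun i y => ((A y).det)⁻¹ * ∑ j, (A y).adjugate i j * k y j (X y), fun i => ?_, ?_⟩
  · refine (hdet.inv₀ hx0).mul (ContMDiffAt.sum fun j _ => ContMDiffAt.mul ?_ (hk X hX j))
    simp only [Matrix.adjugate_apply]
    refine contMDiffAt_det fun p q => ?_
    by_cases hp : p = j
    · subst hp; simp only [Matrix.updateRow_self]; exact contMDiffAt_const
    · simp only [Matrix.updateRow_ne hp]; exact hA p q
  · filter_upwards [hne, hbase] with y hy hyb
    have hlin : ∀ (c : Fin d → ℝ) i, k y i (∑ j, c j • s j y) = ((A y).mulVec c) i := by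
      intro c i
      simp [k, A, Matrix.mulVec, dotProduct, mul_comm]
    have hc : (fun i => ((A y).det)⁻¹ * ∑ j, (A y).adjugate i j * k y j (X y))
        = ((A y)⁻¹).mulVec (fun j => k y j (X y)) := by
      funext i
      simp [Matrix.inv_def, Matrix.mulVec, dotProduct, Ring.inverse_eq_inv', Finset.mul_sum, mul_assoc]
    have key : X y = ∑ i, ((A y)⁻¹.mulVec fun j => k y j (X y)) i • s i y := by
      have h2 : ∀ (v : TangentSpace (𝓡 d) y) i, k y i v = (t.basisAt b hyb).repr v i := by
        intro v i
        classical
        -- The coefficient formula concerns sections, so the single vector `v` is extended by zero;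
        -- no regularity is needed.
        have := t.localFrameCoeff_apply_of_mem_baseSet (I := 𝓡 d) b hyb
          (fun z => if h : z = y then h ▸ v else 0) i
        simpa [k] using this
      apply (t.basisAt b hyb).ext_elem
      intro i
      rw [← h2, ← h2, hlin, Matrix.mulVec_mulVec, Matrix.mul_nonsing_inv _ (isUnit_iff_ne_zero.2 hy),
        Matrix.one_mulVec]
    rw [key]
    exact Finset.sum_congr rfl fun i _ => by rw [← key, ← congrFun hc i]

variable {F : Type*} [NormedAddCommGroup F] [NormedSpace ℝ F]
  {E : M → Type*} [TopologicalSpace (TotalSpace F E)]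
  [∀ x, AddCommGroup (E x)] [∀ x, Module ℝ (E x)] [∀ x, TopologicalSpace (E x)] [FiberBundle F E]
  [VectorBundle ℝ F E] [ContMDiffVectorBundle ∞ F E (𝓡 d)]
  (C : CourantAlgebroid d F E)

/-- Near each point `X` is a smooth combination of anchors of sections fixed by `ℓ` after π; by
linearity `ℓ X` is the same combination of those sections. -/
theorem smooth_lift (ℓ : ∀ x, TangentSpace (𝓡 d) x →ₗ[ℝ] E x)
    (h : ∀ x v, ∃ a : C.Sec, C.anchor x (a x) = v ∧ ∀ y, ℓ y (C.anchor y (a y)) = a y)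
    (X : ∀ x : M, TangentSpace (𝓡 d) x) (hX : IsSmoothVF X) :
    IsSmoothSection d F (fun x => ℓ x (X x)) := by
  intro x
  let b : Basis (Fin d) ℝ (TangentSpace (𝓡 d) x) := (EuclideanSpace.basisFun (Fin d) ℝ).toBasis
  choose a ha hℓ using fun i => h x (b i)
  obtain ⟨c, hc, hXc⟩ := exists_smooth_coeff (fun i y => C.anchor y (a i y))
    (fun i => C.anchor_smooth _ (a i).smooth)
    (x := x) (by simp only [ha]; exact b.linearIndependent) X hX
  have hsum : ContMDiffAt (𝓡 d) ((𝓡 d).prod 𝓘(ℝ, F)) ∞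
      (fun y => TotalSpace.mk' F y (∑ i, c i y • a i y)) x :=
    ContMDiffAt.sum_section fun i _ => (hc i).smul_section (a i).smooth.contMDiffAt
  refine hsum.congr_of_eventuallyEq ?_
  filter_upwards [hXc] with y hy
  simp [hy, hℓ]

end Lift

end CourantAlgebroid

/-! ### The isomorphisms of V₊ and V₋ with TM -/

namespace CourantAlgebroid

theorem linearInverse_apply {V W : Type*} [AddCommGroup V] [Module ℝ V] [AddCommGroup W]
    [Module ℝ W] {f : V →ₗ[ℝ] W} (hf : Function.Bijective f) (v : V) :
    linearInverse f (f v) = v := by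
  rw [linearInverse, dif_pos hf]
  exact (LinearEquiv.ofBijective f hf).symm_apply_apply v

theorem apply_linearInverse {V W : Type*} [AddCommGroup V] [Module ℝ V] [AddCommGroup W]
    [Module ℝ W] {f : V →ₗ[ℝ] W} (hf : Function.Bijective f) (w : W) :
    f (linearInverse f w) = w := by
  rw [linearInverse, dif_pos hf]
  exact (LinearEquiv.ofBijective f hf).apply_symm_apply w

section Regular

variable {d : ℕ} {M : Type*} [TopologicalSpace M] [ChartedSpace (EuclideanSpace ℝ (Fin d)) M] [IsManifold (𝓡 d) ∞ M]
  {F : Type*} [NormedAddCommGroup F] [NormedSpace ℝ F]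
  {E : M → Type*} [TopologicalSpace (TotalSpace F E)]
  [∀ x, AddCommGroup (E x)] [∀ x, Module ℝ (E x)] [∀ x, TopologicalSpace (E x)] [FiberBundle F E]
  {C : CourantAlgebroid d F E}

namespace GeneralizedMetric

variable (V : C.GeneralizedMetric)

theorem mem_plus {x : M} {a : E x} : a ∈ V.plus x ↔ V.G x a = a := by
  simp [plus, sub_eq_zero]

theorem mem_minus {x : M} {a : E x} : a ∈ V.minus x ↔ V.G x a = -a := by
  simp [minus, add_eq_zero_iff_eq_neg]

/-- The anchor restricts to isomorphisms `V₊ ≅ TM` and `V₋ ≅ TM` of an exact Courant algebroid. -/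
structure Regular : Prop where
  exact : C.IsExact
  plus : ∀ x, Function.Bijective ((C.anchor x).domRestrict (V.plus x))
  minus : ∀ x, Function.Bijective ((C.anchor x).domRestrict (V.minus x))

variable {V}

theorem pairing_plus_minus {x : M} {a b : E x} (ha : a ∈ V.plus x) (hb : b ∈ V.minus x) :
    C.pairing x a b = 0 := by
  have h := V.G_symm x a b
  rw [V.mem_plus.1 ha, V.mem_minus.1 hb, map_neg] at h
  linarith

theorem half_add_mem_plus {x : M} (a : E x) : (1 / 2 : ℝ) • (a + V.G x a) ∈ V.plus x := by
  rw [mem_plus, map_smul, map_add, V.G_sq, add_comm]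

theorem half_sub_mem_minus {x : M} (a : E x) : (1 / 2 : ℝ) • (a - V.G x a) ∈ V.minus x := by
  rw [mem_minus, map_smul, map_sub, V.G_sq, ← smul_neg, neg_sub]

theorem half_add_add_half_sub {x : M} (a : E x) :
    (1 / 2 : ℝ) • (a + V.G x a) + (1 / 2 : ℝ) • (a - V.G x a) = a := by module

/-- The projection of `a` to V₋ is orthogonal to the whole fibre, hence zero by non-degeneracy. -/
theorem mem_plus_of_pairing_minus {x : M} {a : E x}
    (h : ∀ b ∈ V.minus x, C.pairing x a b = 0) : a ∈ V.plus x := by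
  have h0 : (1 / 2 : ℝ) • (a - V.G x a) = 0 := by
    apply C.pairing_nondegenerate
    intro b
    have h1 := h _ (half_sub_mem_minus (V := V) b)
    simp only [map_smul, map_sub, LinearMap.smul_apply, LinearMap.sub_apply, V.G_symm] at h1 ⊢
    exact h1
  rw [mem_plus]
  have := (smul_eq_zero.1 h0).resolve_left (by norm_num)
  exact (sub_eq_zero.1 this).symm

theorem mem_minus_of_pairing_plus {x : M} {a : E x}
    (h : ∀ b ∈ V.plus x, C.pairing x a b = 0) : a ∈ V.minus x := by
  have h0 : (1 / 2 : ℝ) • (a + V.G x a) = 0 := by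
    apply C.pairing_nondegenerate
    intro b
    have h1 := h _ (half_add_mem_plus (V := V) b)
    simp only [map_smul, map_add, LinearMap.smul_apply, LinearMap.add_apply, V.G_symm] at h1 ⊢
    exact h1
  rw [mem_minus]
  have := (smul_eq_zero.1 h0).resolve_left (by norm_num)
  exact eq_neg_of_add_eq_zero_right this

theorem exists_coanchor_eq (hE : C.IsExact) {x : M} {a : E x} (ha : C.anchor x a = 0) :
    ∃ ξ, C.coanchor x ξ = a := by
  have : a ∈ LinearMap.range (C.coanchor x) := by rw [(hE x).2.1]; exact ha
  exact this

/-- By exactness ker π is the image of π^*, and ⟨π^*ξ, b⟩ = ξ(πb) vanishes for b in ker π. -/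
theorem pairing_ker (hE : C.IsExact) {x : M} {a b : E x} (ha : C.anchor x a = 0)
    (hb : C.anchor x b = 0) : C.pairing x a b = 0 := by
  obtain ⟨ξ, rfl⟩ := exists_coanchor_eq hE ha
  rw [C.pairing_coanchor, hb, map_zero]

theorem surjective_of_annihilator {A B : Type*} [AddCommGroup A] [Module ℝ A] [AddCommGroup B]
    [Module ℝ B] (f : A →ₗ[ℝ] B) (h : ∀ ξ : Dual ℝ B, (∀ a, ξ (f a) = 0) → ξ = 0) :
    Function.Surjective f := by
  rw [← LinearMap.range_eq_top, ← Subspace.dualAnnihilator_inj, Submodule.dualAnnihilator_top,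
    eq_bot_iff]
  intro ξ hξ
  rw [Submodule.mem_dualAnnihilator] at hξ
  exact h ξ fun a => hξ _ ⟨a, rfl⟩

/-- On V₊ admissibility gives injectivity and the dimension gives surjectivity. On V₋, a kernel
element is some π^*ξ orthogonal to V₊, so ξ vanishes on π(V₊) = TM. A covector ξ annihilating π(V₋)
has π^*ξ orthogonal to V₋, hence in V₊, and admissibility makes it zero. -/
theorem Regular.of_admissible (hE : C.IsExact) (hadm : V.IsAdmissible)
    (hdim : ∀ x, finrank ℝ (V.plus x) = d) (hfin : ∀ x, FiniteDimensional ℝ (V.plus x)) :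
    V.Regular := by
  have hinj : ∀ x, Function.Injective ((C.anchor x).domRestrict (V.plus x)) := by
    intro x
    rw [injective_iff_map_eq_zero]
    rintro ⟨a, ha⟩ h
    have h1 : a ∈ V.plus x ⊓ LinearMap.range (C.coanchor x) := ⟨ha, exists_coanchor_eq hE h⟩
    rw [hadm x] at h1
    exact Subtype.ext h1
  have hp : ∀ x, Function.Bijective ((C.anchor x).domRestrict (V.plus x)) := by
    intro x
    have := hfin x
    have : FiniteDimensional ℝ (TangentSpace (𝓡 d) x) :=
      inferInstanceAs (FiniteDimensional ℝ (EuclideanSpace ℝ (Fin d)))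
    refine ⟨hinj x, (LinearMap.injective_iff_surjective_of_finrank_eq_finrank ?_).1 (hinj x)⟩
    rw [hdim x]
    change d = finrank ℝ (EuclideanSpace ℝ (Fin d))
    simp
  refine ⟨hE, hp, fun x => ⟨?_, ?_⟩⟩
  · rw [injective_iff_map_eq_zero]
    rintro ⟨a, ha⟩ h
    obtain ⟨ξ, rfl⟩ := exists_coanchor_eq hE h
    have h0 : ξ = 0 := by
      ext v
      obtain ⟨b, rfl⟩ := (hp x).2 v
      change ξ (C.anchor x b) = 0
      rw [← C.pairing_coanchor, C.pairing_symm]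
      exact pairing_plus_minus b.2 ha
    simp [h0]
  · refine surjective_of_annihilator _ fun ξ hξ => ?_
    have h1 : C.coanchor x ξ ∈ V.plus x := mem_plus_of_pairing_minus fun b hb => by
      rw [C.pairing_coanchor]
      exact hξ ⟨b, hb⟩
    have h2 : C.coanchor x ξ ∈ V.plus x ⊓ LinearMap.range (C.coanchor x) := ⟨h1, ξ, rfl⟩
    rw [hadm x] at h2
    exact (hE x).1 (h2.trans (map_zero _).symm)

namespace Regular

variable (h : V.Regular)
include h

theorem liftPlus_mem (x : M) (v) : V.liftPlus x v ∈ V.plus x := by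
  simp [liftPlus]

theorem liftMinus_mem (x : M) (v) : V.liftMinus x v ∈ V.minus x := by
  simp [liftMinus]

theorem anchor_liftPlus (x : M) (v) : C.anchor x (V.liftPlus x v) = v :=
  apply_linearInverse (h.plus x) v

theorem anchor_liftMinus (x : M) (v) : C.anchor x (V.liftMinus x v) = v :=
  apply_linearInverse (h.minus x) v

theorem liftPlus_anchor {x : M} {a : E x} (ha : a ∈ V.plus x) :
    V.liftPlus x (C.anchor x a) = a :=
  congrArg Subtype.val (linearInverse_apply (h.plus x) ⟨a, ha⟩)

theorem liftMinus_anchor {x : M} {a : E x} (ha : a ∈ V.minus x) :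
    V.liftMinus x (C.anchor x a) = a :=
  congrArg Subtype.val (linearInverse_apply (h.minus x) ⟨a, ha⟩)

end Regular

end GeneralizedMetric

end Regular

end CourantAlgebroid

/-! ### Sections of V₊ and V₋ and the operator exchanging them -/

namespace CourantAlgebroid.GeneralizedMetric

section SectionCalculus

variable {d : ℕ} {M : Type*} [TopologicalSpace M] [ChartedSpace (EuclideanSpace ℝ (Fin d)) M] [IsManifold (𝓡 d) ∞ M]
  {F : Type*} [NormedAddCommGroup F] [NormedSpace ℝ F]
  {E : M → Type*} [TopologicalSpace (TotalSpace F E)]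
  [∀ x, AddCommGroup (E x)] [∀ x, Module ℝ (E x)] [∀ x, TopologicalSpace (E x)] [FiberBundle F E]
  [VectorBundle ℝ F E]
  {C : CourantAlgebroid d F E} (V : C.GeneralizedMetric)

/-- `Π₊` as an operator on smooth sections. -/
def Pp : C.Sec →ₗ[ℝ] C.Sec where
  toFun a := (1 / 2 : ℝ) • (a + C.mkSec _ (V.G_smooth a a.smooth))
  map_add' a b := ContMDiffSection.ext fun x => by simp; module
  map_smul' r a := ContMDiffSection.ext fun x => by simp; module

/-- `Π₋` as an operator on smooth sections. -/
def Pm : C.Sec →ₗ[ℝ] C.Sec where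
  toFun a := (1 / 2 : ℝ) • (a - C.mkSec _ (V.G_smooth a a.smooth))
  map_add' a b := ContMDiffSection.ext fun x => by simp; module
  map_smul' r a := ContMDiffSection.ext fun x => by simp; module

theorem Pp_apply (a : C.Sec) (x : M) : V.Pp a x = (1 / 2 : ℝ) • (a x + V.G x (a x)) := rfl

theorem Pm_apply (a : C.Sec) (x : M) : V.Pm a x = (1 / 2 : ℝ) • (a x - V.G x (a x)) := rfl

/-- Sections of `V₊`. -/
def IsPlus (a : C.Sec) : Prop := ∀ x, a x ∈ V.plus x

/-- Sections of `V₋`. -/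
def IsMinus (a : C.Sec) : Prop := ∀ x, a x ∈ V.minus x

variable {V}

theorem isPlus_Pp (a : C.Sec) : V.IsPlus (V.Pp a) := fun _ => half_add_mem_plus _

theorem isMinus_Pm (a : C.Sec) : V.IsMinus (V.Pm a) := fun _ => half_sub_mem_minus _

theorem Pp_add_Pm (a : C.Sec) : V.Pp a + V.Pm a = a :=
  ContMDiffSection.ext fun _ => half_add_add_half_sub _

theorem Pp_apply_of_mem_plus {a : C.Sec} {x : M} (h : a x ∈ V.plus x) : V.Pp a x = a x := by
  rw [Pp_apply, V.mem_plus.1 h]; module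

theorem Pm_apply_of_mem_plus {a : C.Sec} {x : M} (h : a x ∈ V.plus x) : V.Pm a x = 0 := by
  rw [Pm_apply, V.mem_plus.1 h]; module

theorem Pp_apply_of_mem_minus {a : C.Sec} {x : M} (h : a x ∈ V.minus x) : V.Pp a x = 0 := by
  rw [Pp_apply, V.mem_minus.1 h]; module

theorem Pm_apply_of_mem_minus {a : C.Sec} {x : M} (h : a x ∈ V.minus x) : V.Pm a x = a x := by
  rw [Pm_apply, V.mem_minus.1 h]; module

theorem IsPlus.Pp_eq {a : C.Sec} (h : V.IsPlus a) : V.Pp a = a :=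
  ContMDiffSection.ext fun x => Pp_apply_of_mem_plus (h x)

theorem IsPlus.Pm_eq {a : C.Sec} (h : V.IsPlus a) : V.Pm a = 0 :=
  ContMDiffSection.ext fun x => Pm_apply_of_mem_plus (h x)

theorem IsMinus.Pp_eq {a : C.Sec} (h : V.IsMinus a) : V.Pp a = 0 :=
  ContMDiffSection.ext fun x => Pp_apply_of_mem_minus (h x)

theorem IsMinus.Pm_eq {a : C.Sec} (h : V.IsMinus a) : V.Pm a = a :=
  ContMDiffSection.ext fun x => Pm_apply_of_mem_minus (h x)

theorem pair_Pp (a b : C.Sec) : C.pair (V.Pp a) b = C.pair a (V.Pp b) := by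
  funext x; simp [pair, Pp_apply, V.G_symm]

theorem pair_Pm (a b : C.Sec) : C.pair (V.Pm a) b = C.pair a (V.Pm b) := by
  funext x; simp [pair, Pm_apply, V.G_symm]

theorem pair_plus_minus {a b : C.Sec} (ha : V.IsPlus a) (hb : V.IsMinus b) : C.pair a b = 0 :=
  funext fun x => pairing_plus_minus (ha x) (hb x)

theorem pair_minus_plus {a b : C.Sec} (ha : V.IsMinus a) (hb : V.IsPlus b) : C.pair a b = 0 := by
  rw [pair_comm, pair_plus_minus hb ha]

theorem pair_eq_add (a b : C.Sec) :
    C.pair a b = C.pair (V.Pp a) (V.Pp b) + C.pair (V.Pm a) (V.Pm b) := by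
  conv_lhs => rw [← Pp_add_Pm (V := V) a, ← Pp_add_Pm (V := V) b]
  rw [pair_add_left, pair_add_right, pair_add_right, pair_plus_minus (isPlus_Pp a) (isMinus_Pm b),
    pair_minus_plus (isMinus_Pm a) (isPlus_Pp b)]
  simp

/-- The symmetric part of the bracket in (C5) is the differential of ⟨a,b⟩, here identically zero.
-/
theorem pair_br_anti {a b : C.Sec} (h : C.pair a b = 0) (c : C.Sec) :
    C.pair (C.br a b) c = - C.pair (C.br b a) c := by
  funext x
  have h1 := C.pair_br_symm a b c x
  have h2 : C.der c (0 : M → ℝ) = 0 := C.der_const c 0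
  rw [h, h2] at h1
  simp only [Pi.zero_apply, Pi.neg_apply] at h1 ⊢
  linarith

/-- Antisymmetry and (C4), both without derivative terms by orthogonality. The section `p` then
enters algebraically, which is why mixed brackets define connections. -/
theorem pair_br_left {p u w : C.Sec} (hu : C.pair p u = 0) (hw : C.pair p w = 0) :
    C.pair (C.br p u) w = C.pair p (C.br u w) := by
  rw [pair_br_anti hu]
  funext x
  have h1 := C.der_pair u p w x
  have h2 : C.der u (0 : M → ℝ) = 0 := C.der_const u 0
  rw [hw, h2] at h1
  simp only [Pi.zero_apply, Pi.neg_apply] at h1 ⊢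
  linarith

variable [T2Space M] [ContMDiffVectorBundle ∞ F E (𝓡 d)]

theorem sec_ext {a b : C.Sec} {x : M} (h : ∀ c : C.Sec, C.pair a c x = C.pair b c x) :
    a x = b x := by
  rw [← sub_eq_zero]
  apply C.pairing_nondegenerate
  intro v
  obtain ⟨c, rfl⟩ := C.exists_sec x v
  have := h c
  simp only [pair] at this
  simp [this]

theorem br_anti {a b : C.Sec} (h : C.pair a b = 0) : C.br a b = - C.br b a :=
  ContMDiffSection.ext fun x => by
    rw [show -C.br b a = - C.br b a from rfl]
    exact sec_ext fun c => by rw [pair_br_anti h, pair_neg_left]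

namespace Regular

variable (h : V.Regular)
include h

theorem exists_plus (x : M) (v : TangentSpace (𝓡 d) x) :
    ∃ a : C.Sec, V.IsPlus a ∧ C.anchor x (a x) = v := by
  obtain ⟨s, hs⟩ := C.exists_sec x (V.liftPlus x v)
  refine ⟨V.Pp s, isPlus_Pp s, ?_⟩
  rw [Pp_apply_of_mem_plus (hs ▸ h.liftPlus_mem x v), hs, h.anchor_liftPlus]

theorem exists_minus (x : M) (v : TangentSpace (𝓡 d) x) :
    ∃ a : C.Sec, V.IsMinus a ∧ C.anchor x (a x) = v := by
  obtain ⟨s, hs⟩ := C.exists_sec x (V.liftMinus x v)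
  refine ⟨V.Pm s, isMinus_Pm s, ?_⟩
  rw [Pm_apply_of_mem_minus (hs ▸ h.liftMinus_mem x v), hs, h.anchor_liftMinus]

theorem liftPlus_smooth (X : ∀ x : M, TangentSpace (𝓡 d) x) (hX : IsSmoothVF X) :
    IsSmoothSection d F (fun x => V.liftPlus x (X x)) :=
  C.smooth_lift V.liftPlus (fun x v => (h.exists_plus x v).imp fun _ ha =>
    ⟨ha.2, fun y => h.liftPlus_anchor (ha.1 y)⟩) X hX

theorem liftMinus_smooth (X : ∀ x : M, TangentSpace (𝓡 d) x) (hX : IsSmoothVF X) :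
    IsSmoothSection d F (fun x => V.liftMinus x (X x)) :=
  C.smooth_lift V.liftMinus (fun x v => (h.exists_minus x v).imp fun _ ha =>
    ⟨ha.2, fun y => h.liftMinus_anchor (ha.1 y)⟩) X hX

/-- The isometry exchanging `V₊` and `V₋` over `TM`, as an operator on smooth sections. -/
def sw : C.Sec →ₗ[ℝ] C.Sec where
  toFun a := C.mkSec _ (h.liftMinus_smooth _ (C.anchor_smooth _ (V.Pp a).smooth))
    + C.mkSec _ (h.liftPlus_smooth _ (C.anchor_smooth _ (V.Pm a).smooth))
  map_add' a b := ContMDiffSection.ext fun x => by simp; abel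
  map_smul' r a := ContMDiffSection.ext fun x => by simp

theorem sw_apply (a : C.Sec) (x : M) : h.sw a x = V.liftMinus x (C.anchor x (V.Pp a x))
    + V.liftPlus x (C.anchor x (V.Pm a x)) := rfl

theorem anchor_sw (a : C.Sec) (x : M) : C.anchor x (h.sw a x) = C.anchor x (a x) := by
  rw [sw_apply, map_add, h.anchor_liftMinus, h.anchor_liftPlus, ← map_add, Pp_apply, Pm_apply,
    half_add_add_half_sub]

theorem der_sw {S : Type*} [NormedAddCommGroup S] [NormedSpace ℝ S] (a : C.Sec) (φ : M → S) :
    C.der (h.sw a) φ = C.der a φ := by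
  funext x; rw [der, der, anchor_sw]

theorem isMinus_sw {a : C.Sec} (ha : V.IsPlus a) : V.IsMinus (h.sw a) := fun x => by
  rw [sw_apply, ha.Pm_eq]
  simpa using h.liftMinus_mem x _

theorem isPlus_sw {a : C.Sec} (ha : V.IsMinus a) : V.IsPlus (h.sw a) := fun x => by
  rw [sw_apply, ha.Pp_eq]
  simpa using h.liftPlus_mem x _

theorem sw_sw (a : C.Sec) : h.sw (h.sw a) = a := by
  have hp : ∀ b, V.IsPlus b → h.sw (h.sw b) = b := fun b hb => ContMDiffSection.ext fun x => by
    rw [sw_apply, (h.isMinus_sw hb).Pp_eq, (h.isMinus_sw hb).Pm_eq, anchor_sw,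
      h.liftPlus_anchor (hb x)]
    simp
  have hm : ∀ b, V.IsMinus b → h.sw (h.sw b) = b := fun b hb => ContMDiffSection.ext fun x => by
    rw [sw_apply, (h.isPlus_sw hb).Pp_eq, (h.isPlus_sw hb).Pm_eq, anchor_sw,
      h.liftMinus_anchor (hb x)]
    simp
  conv_lhs => rw [← Pp_add_Pm (V := V) a]
  rw [map_add, map_add, hp _ (isPlus_Pp a), hm _ (isMinus_Pm a), Pp_add_Pm]

theorem Pm_sw (a : C.Sec) : V.Pm (h.sw a) = h.sw (V.Pp a) := by
  conv_lhs => rw [← Pp_add_Pm (V := V) a]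
  rw [map_add, map_add, (h.isMinus_sw (isPlus_Pp a)).Pm_eq, (h.isPlus_sw (isMinus_Pm a)).Pm_eq,
    add_zero]

theorem Pp_sw (a : C.Sec) : V.Pp (h.sw a) = h.sw (V.Pm a) := by
  conv_lhs => rw [← Pp_add_Pm (V := V) a]
  rw [map_add, map_add, (h.isMinus_sw (isPlus_Pp a)).Pp_eq, (h.isPlus_sw (isMinus_Pm a)).Pp_eq,
    zero_add]

/-- `sw` preserves anchors, so both differences lie in ker π, which is isotropic. -/
theorem pair_sub_sw (a b : C.Sec) : C.pair (a - h.sw a) (b - h.sw b) = 0 :=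
  funext fun x => pairing_ker h.exact (by simp [anchor_sw]) (by simp [anchor_sw])

theorem pair_sw_sw_plus {a b : C.Sec} (ha : V.IsPlus a) (hb : V.IsPlus b) :
    C.pair (h.sw a) (h.sw b) = - C.pair a b := by
  have h1 := h.pair_sub_sw a b
  rw [pair_sub_left, pair_sub_right, pair_sub_right, pair_plus_minus ha (h.isMinus_sw hb),
    pair_minus_plus (h.isMinus_sw ha) hb] at h1
  rw [← sub_eq_zero, ← h1]; abel

/-- The pairing is g on V₊ and −g on V₋ over TM; `sw` is thus an involutive anti-isometry between
them, that is, skew-adjoint. -/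
theorem pair_sw (a b : C.Sec) : C.pair (h.sw a) b = - C.pair a (h.sw b) := by
  rw [pair_eq_add (V := V) (h.sw a) b, pair_eq_add (V := V) a (h.sw b), Pm_sw, Pp_sw, Pm_sw, Pp_sw]
  have h1 := h.pair_sw_sw_plus (isPlus_Pp a) (h.isPlus_sw (isMinus_Pm b))
  have h2 := h.pair_sw_sw_plus (h.isPlus_sw (isMinus_Pm a)) (isPlus_Pp b)
  rw [sw_sw] at h1 h2
  rw [h1, ← neg_neg (C.pair (h.sw (V.Pm a)) (V.Pp b)), ← h2]
  abel

/-- Test against `c` with (C4): the derivative along `a` is zero because πa = 0, and [a,c] is again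
in ker π, hence orthogonal to `b`. -/
theorem br_ker {a b : C.Sec} (ha : ∀ x, C.anchor x (a x) = 0) (hb : ∀ x, C.anchor x (b x) = 0) :
    C.br a b = 0 := by
  refine ContMDiffSection.ext fun x => sec_ext fun c => ?_
  have h1 := C.der_pair a b c x
  have h2 : C.der a (C.pair b c) x = 0 := by simp [der, ha]
  have h3 : C.pair b (C.br a c) x = 0 := by
    refine pairing_ker h.exact (hb x) ?_
    rw [br_apply, C.anchor_bracket a c a.smooth c.smooth]
    have : (fun y => C.anchor y (a y)) = 0 := funext ha
    rw [this, VectorField.mlieBracket_zero_left]; rfl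
  have h4 : C.pair 0 c x = 0 := by simp [pair]
  linarith

/-- This relation ties the three kinds of structure functions together and is the source of `N3_eq`.
-/
theorem br_sub_sw (a b : C.Sec) : C.br (a - h.sw a) (b - h.sw b) = 0 :=
  h.br_ker (by simp [anchor_sw]) (by simp [anchor_sw])

end Regular

end SectionCalculus

end CourantAlgebroid.GeneralizedMetric

/-! ### The Gualtieri–Bismut and Levi-Civita connections, torsion and curvature -/

namespace CourantAlgebroid.GeneralizedMetric.Regular

section Connection

variable {d : ℕ} {M : Type*} [TopologicalSpace M] [ChartedSpace (EuclideanSpace ℝ (Fin d)) M] [IsManifold (𝓡 d) ∞ M]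
  {F : Type*} [NormedAddCommGroup F] [NormedSpace ℝ F]
  {E : M → Type*} [TopologicalSpace (TotalSpace F E)]
  [∀ x, AddCommGroup (E x)] [∀ x, Module ℝ (E x)] [∀ x, TopologicalSpace (E x)] [FiberBundle F E]
  [VectorBundle ℝ F E] [T2Space M] [ContMDiffVectorBundle ∞ F E (𝓡 d)]
  {C : CourantAlgebroid d F E} {V : C.GeneralizedMetric} (h : V.Regular)

/-- The Courant bracket of smooth sections. -/
def _root_.CourantAlgebroid.cb (C : CourantAlgebroid d F E) (a b : C.Sec) : C.Sec :=
  (1 / 2 : ℝ) • (C.br a b - C.br b a)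

theorem _root_.CourantAlgebroid.pair_cb (a b c : C.Sec) (x : M) :
    C.pair (C.cb a b) c x = C.pair (C.br a b) c x - (1 / 2) * C.der c (C.pair a b) x := by
  rw [← C.pair_br_symm a b c x, cb, pair_smul_left, pair_sub_left]
  simp only [Pi.smul_apply, Pi.sub_apply, smul_eq_mul]
  ring

/-- The Gualtieri–Bismut connection on smooth sections. -/
def bis (a b : C.Sec) : C.Sec :=
  V.Pp (C.br (V.Pm a) (V.Pp b)) + V.Pm (C.br (V.Pp a) (V.Pm b))
    + V.Pm (C.br (h.sw (V.Pm a)) (V.Pm b)) + V.Pp (C.br (h.sw (V.Pp a)) (V.Pp b))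

theorem coe_bis (a b : C.Sec) : (h.bis a b : ∀ x, E x) = V.bismut a b := rfl

/-- The connection form of the Gualtieri–Bismut connection: `⟨D^B_c a, b⟩ = ⟨c, bisForm a b⟩`. -/
def bisForm (a b : C.Sec) : C.Sec :=
  let k := V.Pm (C.br (V.Pp a) (V.Pp b)) + V.Pp (C.br (V.Pm a) (V.Pm b))
  k - h.sw k

/-- In each of the four terms of D^B the direction is orthogonal to the sections differentiated, so
`pair_br_left` strips it from the bracket; `sw` is then moved across by skew-adjointness. -/
theorem pair_bis (c a b : C.Sec) : C.pair (h.bis c a) b = C.pair c (h.bisForm a b) := by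
  have e1 : C.pair (C.br (V.Pm c) (V.Pp a)) (V.Pp b) = C.pair (V.Pm c) (C.br (V.Pp a) (V.Pp b)) :=
    pair_br_left (pair_minus_plus (isMinus_Pm c) (isPlus_Pp a))
      (pair_minus_plus (isMinus_Pm c) (isPlus_Pp b))
  have e2 : C.pair (C.br (V.Pp c) (V.Pm a)) (V.Pm b) = C.pair (V.Pp c) (C.br (V.Pm a) (V.Pm b)) :=
    pair_br_left (pair_plus_minus (isPlus_Pp c) (isMinus_Pm a))
      (pair_plus_minus (isPlus_Pp c) (isMinus_Pm b))
  have e3 : C.pair (C.br (h.sw (V.Pm c)) (V.Pm a)) (V.Pm b)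
      = C.pair (h.sw (V.Pm c)) (C.br (V.Pm a) (V.Pm b)) :=
    pair_br_left (pair_plus_minus (h.isPlus_sw (isMinus_Pm c)) (isMinus_Pm a))
      (pair_plus_minus (h.isPlus_sw (isMinus_Pm c)) (isMinus_Pm b))
  have e4 : C.pair (C.br (h.sw (V.Pp c)) (V.Pp a)) (V.Pp b)
      = C.pair (h.sw (V.Pp c)) (C.br (V.Pp a) (V.Pp b)) :=
    pair_br_left (pair_minus_plus (h.isMinus_sw (isPlus_Pp c)) (isPlus_Pp a))
      (pair_minus_plus (h.isMinus_sw (isPlus_Pp c)) (isPlus_Pp b))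
  simp only [bis, bisForm, pair_add_left, pair_add_right, pair_sub_right, pair_Pp, pair_Pm, e1, e2,
    e3, e4, map_add]
  simp only [h.pair_sw, ← h.Pp_sw, ← h.Pm_sw, pair_Pp, pair_Pm]
  abel

/-- The torsion of the Gualtieri–Bismut connection with its last index raised. -/
def tor (a b : C.Sec) : C.Sec :=
  h.bis a b - h.bis b a - C.cb a b + (1 / 2 : ℝ) • (h.bisForm a b - h.bisForm b a)

theorem pair_tor (a b c : C.Sec) (x : M) :
    C.pair (h.tor a b) c x = C.pair (h.bis a b) c x - C.pair (h.bis b a) c x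
      - C.pair (C.cb a b) c x
      + (1 / 2) * (C.pair (h.bis c a) b x - C.pair (h.bis c b) a x) := by
  rw [pair_bis h c a b, pair_bis h c b a, C.pair_comm c, C.pair_comm c, tor, pair_add_left,
    pair_sub_left, pair_sub_left, pair_smul_left, pair_sub_left]
  rfl

theorem torsion_bismut (a b c : C.Sec) (x : M) :
    C.torsion V.bismut a b c x = C.pair (h.tor a b) c x := by
  rw [pair_tor]
  simp only [torsion, pair, ← coe_bis h, cb, courantBracket]
  simp only [map_sub, map_smul, LinearMap.sub_apply, LinearMap.smul_apply,
    ContMDiffSection.coe_smul, ContMDiffSection.coe_sub, Pi.smul_apply, Pi.sub_apply, coe_br]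

/-- The section `tor` shows that the choice has a solution, and non-degeneracy makes it unique. -/
theorem torsionSharp_bismut (a b : C.Sec) : C.torsionSharp V.bismut a b = h.tor a b := by
  funext x
  have hspec : ∀ c : ∀ y, E y, IsSmoothSection d F c →
      C.pairing x (C.torsionSharp V.bismut a b x) (c x) = C.torsion V.bismut a b c x :=
    Classical.epsilon_spec (p := fun t : E x => ∀ c : ∀ y, E y, IsSmoothSection d F c →
      C.pairing x t (c x) = C.torsion V.bismut a b c x)
      ⟨h.tor a b x, fun c hc => (h.torsion_bismut a b (C.mkSec c hc) x).symm⟩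
  rw [← sub_eq_zero]
  apply C.pairing_nondegenerate
  intro v
  obtain ⟨c, rfl⟩ := C.exists_sec x v
  rw [map_sub, LinearMap.sub_apply, hspec c c.smooth, h.torsion_bismut a b c]
  exact sub_self _

/-- (C4) is applied separately on V₊ and V₋. In each case the component of `a` of the same sign is
replaced by its image under `sw`, which has the same anchor. -/
theorem der_pair_bis (a b c : C.Sec) (x : M) :
    C.der a (C.pair b c) x = C.pair (h.bis a b) c x + C.pair b (h.bis a c) x := by
  have e : ∀ u v w : C.Sec, C.der u (C.pair v w) = C.pair (C.br u v) w + C.pair v (C.br u w) :=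
    fun u v w => funext fun y => C.der_pair u v w y
  have s1 : C.der a (C.pair (V.Pp b) (V.Pp c)) = C.der (V.Pm a) (C.pair (V.Pp b) (V.Pp c))
      + C.der (h.sw (V.Pp a)) (C.pair (V.Pp b) (V.Pp c)) := by
    rw [h.der_sw, ← der_add_sec, add_comm, Pp_add_Pm]
  have s2 : C.der a (C.pair (V.Pm b) (V.Pm c)) = C.der (V.Pp a) (C.pair (V.Pm b) (V.Pm c))
      + C.der (h.sw (V.Pm a)) (C.pair (V.Pm b) (V.Pm c)) := by
    rw [h.der_sw, ← der_add_sec, Pp_add_Pm]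
  have s3 : C.der a (C.pair b c) = C.der a (C.pair (V.Pp b) (V.Pp c))
      + C.der a (C.pair (V.Pm b) (V.Pm c)) := by
    rw [pair_eq_add (V := V) b c]
    exact C.der_add_fun a (C.pair_smooth _ _) (C.pair_smooth _ _)
  rw [s3, s1, s2]
  simp only [e]
  simp only [bis, pair_add_left, pair_add_right, pair_Pp, pair_Pm, Pi.add_apply]
  ring

theorem tor_swap (a b : C.Sec) : h.tor a b = - h.tor b a := by
  simp only [tor, cb]; module

/-- Metric compatibility of D^B gives this second antisymmetry; with `tor_swap` the torsion is
totally antisymmetric. -/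
theorem pair_tor_swap_right (a b c : C.Sec) (x : M) :
    C.pair (h.tor a b) c x = - C.pair (h.tor a c) b x := by
  rw [pair_tor, pair_tor, C.pair_cb, C.pair_cb]
  have h1 := h.der_pair_bis a b c x
  have h2 := h.der_pair_bis b a c x
  have h3 := h.der_pair_bis c a b x
  have h4 := C.der_pair a b c x
  simp only [C.pair_comm a, C.pair_comm b (h.bis _ _), C.pair_comm b (C.br _ _)] at *
  rw [C.pair_comm b c] at *
  simp only [C.pair_comm c a, C.pair_comm b a] at *
  linarith

theorem pair_tor_cycle (a b c : C.Sec) (x : M) :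
    C.pair (h.tor a b) c x = C.pair (h.tor b c) a x := by
  rw [tor_swap, pair_neg_left, Pi.neg_apply, h.pair_tor_swap_right, neg_neg]

/-- The canonical Levi-Civita connection on smooth sections. -/
def lc (a b : C.Sec) : C.Sec := h.bis a b - (1 / 3 : ℝ) • h.tor a b

theorem coe_lc (a b : C.Sec) : (h.lc a b : ∀ x, E x) = V.leviCivita a b := by
  rw [leviCivita, h.torsionSharp_bismut]; rfl

/-- The connection form of the canonical Levi-Civita connection: `⟨D_a b, c⟩ = ⟨a, lcForm b c⟩`. -/
def lcForm (b c : C.Sec) : C.Sec := h.bisForm b c - (1 / 3 : ℝ) • h.tor b c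

theorem pair_lc (a b c : C.Sec) : C.pair (h.lc a b) c = C.pair a (h.lcForm b c) := by
  have e : C.pair (h.tor a b) c = C.pair a (h.tor b c) := by
    rw [C.pair_comm a]; exact funext fun x => h.pair_tor_cycle a b c x
  rw [lc, lcForm, pair_sub_left, pair_sub_right, pair_smul_left, pair_smul_right, h.pair_bis, e]

/-- Subtracting a totally antisymmetric tensor preserves metric compatibility. -/
theorem der_pair_lc (a b c : C.Sec) (x : M) :
    C.der a (C.pair b c) x = C.pair (h.lc a b) c x + C.pair b (h.lc a c) x := by
  have h1 := h.der_pair_bis a b c x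
  have h2 := h.pair_tor_swap_right a b c x
  rw [C.pair_comm b (h.bis a c)] at h1
  rw [C.pair_comm b (h.lc a c), lc, lc, pair_sub_left, pair_sub_left, pair_smul_left,
    pair_smul_left]
  simp only [Pi.sub_apply, Pi.smul_apply, smul_eq_mul]
  linarith

/-- D^B preserves V₊ and V₋, and its torsion on mixed arguments vanishes: D^B_b c and −D^B_c b are
the V₋ and V₊ parts of [b,c], and add up to it. -/
theorem lcForm_plus_minus {b c : C.Sec} (hb : V.IsPlus b) (hc : V.IsMinus c) :
    h.lcForm b c = 0 := by
  have e := br_anti (pair_plus_minus hb hc)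
  have e2 : C.br b c = V.Pp (C.br b c) + V.Pm (C.br b c) := (Pp_add_Pm _).symm
  have h1 : h.bisForm b c = 0 := by simp [bisForm, hb.Pm_eq, hc.Pp_eq]
  have h2 : h.bisForm c b = 0 := by simp [bisForm, hb.Pm_eq, hc.Pp_eq]
  rw [lcForm, tor, h1, h2, cb, bis, bis, hb.Pm_eq, hb.Pp_eq, hc.Pm_eq, hc.Pp_eq]
  have e3 : C.br c b = - C.br b c := by rw [e, neg_neg]
  rw [e3]
  simp only [map_zero, LinearMap.zero_apply, map_neg]
  conv_lhs => rw [e2]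
  simp only [map_add]
  rw [(isPlus_Pp _).Pp_eq, (isPlus_Pp _).Pm_eq, (isMinus_Pm _).Pp_eq, (isMinus_Pm _).Pm_eq]
  module

theorem lcForm_minus_plus {b c : C.Sec} (hb : V.IsMinus b) (hc : V.IsPlus c) :
    h.lcForm b c = 0 := by
  have h1 : h.bisForm b c = 0 := by simp [bisForm, hb.Pp_eq, hc.Pm_eq]
  have h2 : h.bisForm c b = 0 := by simp [bisForm, hb.Pp_eq, hc.Pm_eq]
  have h3 := h.lcForm_plus_minus hc hb
  rw [lcForm, h2] at h3
  rw [zero_sub, neg_eq_zero] at h3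
  rw [lcForm, h1, tor_swap, smul_neg, h3, neg_zero, sub_zero]

theorem isPlus_lc (a : C.Sec) {b : C.Sec} (hb : V.IsPlus b) : V.IsPlus (h.lc a b) := fun x =>
  mem_plus_of_pairing_minus fun v hv => by
    obtain ⟨c, rfl⟩ := C.exists_sec x v
    have h1 := congrFun (h.pair_lc a b (V.Pm c)) x
    rw [h.lcForm_plus_minus hb (isMinus_Pm c)] at h1
    simpa [pair, Pm_apply_of_mem_minus hv] using h1

theorem isMinus_lc (a : C.Sec) {b : C.Sec} (hb : V.IsMinus b) : V.IsMinus (h.lc a b) := fun x =>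
  mem_minus_of_pairing_plus fun v hv => by
    obtain ⟨c, rfl⟩ := C.exists_sec x v
    have h1 := congrFun (h.pair_lc a b (V.Pp c)) x
    rw [h.lcForm_minus_plus hb (isPlus_Pp c)] at h1
    simpa [pair, Pp_apply_of_mem_plus hv] using h1

theorem lc_self_minus {f : C.Sec} (hf : V.IsMinus f) (c : C.Sec) :
    C.pair (h.lc f f) c = C.pair (C.br (h.sw f) f) (V.Pm c) := by
  have ht : h.tor f f = 0 := by simp [tor, cb]
  rw [lc, ht, smul_zero, sub_zero, bis, hf.Pm_eq, hf.Pp_eq]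
  simp [pair_Pm]

/-- The curvature of the canonical Levi-Civita connection on smooth sections. -/
def curv (a b c : C.Sec) : C.Sec := h.lc a (h.lc b c) - h.lc b (h.lc a c) - h.lc (C.cb a b) c

theorem coe_curv (a b c : C.Sec) : (h.curv a b c : ∀ x, E x) = C.curvature V.leviCivita a b c := by
  have e : (C.cb a b : ∀ x, E x) = C.courantBracket a b := rfl
  simp only [curv, curvature, ContMDiffSection.coe_sub, h.coe_lc, ← e]

theorem isPlus_curv {a b c : C.Sec} (hc : V.IsPlus c) : V.IsPlus (h.curv a b c) := fun x =>
  sub_mem (sub_mem (h.isPlus_lc a (h.isPlus_lc b hc) x) (h.isPlus_lc b (h.isPlus_lc a hc) x))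
    (h.isPlus_lc _ hc x)

/-- Compatibility and invariance move every derivative off `a`, which then appears only in a pairing
with a fixed section. This is the tensoriality required for the trace defining GRic. -/
theorem pair_curv {a b : C.Sec} (ha : V.IsPlus a) (hb : V.IsMinus b) (c e : C.Sec) (x : M) :
    C.pair (h.curv a b c) e x = C.pair a
      (h.lcForm (h.lc b c) e + h.lcForm c (h.lc b e) - C.br b (h.lcForm c e)) x := by
  have h1 := h.der_pair_lc b (h.lc a c) e x
  have h2 := C.der_pair b a (h.lcForm c e) x
  have h3 : C.cb a b = - C.br b a := by
    rw [cb, br_anti (pair_plus_minus ha hb)]; module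
  rw [curv, pair_sub_left, pair_sub_left, h3]
  simp only [pair_lc, pair_add_right, pair_sub_right, pair_neg_left, Pi.add_apply, Pi.sub_apply,
    Pi.neg_apply] at h1 ⊢
  linarith

end Connection

end CourantAlgebroid.GeneralizedMetric.Regular

/-! ### Adapted orthonormal frames, structure functions and Jacobi identities -/

theorem lorentzSign_mul_self (i : Fin 6) : lorentzSign i * lorentzSign i = 1 := by
  unfold lorentzSign; split_ifs <;> norm_num

theorem lorentzSign_ne_zero (i : Fin 6) : lorentzSign i ≠ 0 := by
  intro h; have := lorentzSign_mul_self i; simp [h] at this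

namespace CourantAlgebroid.GeneralizedMetric

section Frames

variable {M : Type*} [TopologicalSpace M] [ChartedSpace (EuclideanSpace ℝ (Fin 6)) M] [IsManifold (𝓡 6) ∞ M]
  {F : Type*} [NormedAddCommGroup F] [NormedSpace ℝ F]
  {E : M → Type*} [TopologicalSpace (TotalSpace F E)]
  [∀ x, AddCommGroup (E x)] [∀ x, Module ℝ (E x)] [∀ x, TopologicalSpace (E x)] [FiberBundle F E]
  [VectorBundle ℝ F E] [T2Space M] [ContMDiffVectorBundle ∞ F E (𝓡 6)]
  {C : CourantAlgebroid 6 F E} {V : C.GeneralizedMetric}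

/-- Global smooth sections of `V₊` which form an orthonormal frame over the open set `U`. -/
structure PlusFrame (V : C.GeneralizedMetric) (U : Set M) where
  /-- the sections -/
  e : Fin 6 → C.Sec
  isOpen : IsOpen U
  regular : V.Regular
  isPlus : ∀ i, V.IsPlus (e i)
  pair_e : ∀ x ∈ U, ∀ i j, C.pair (e i) (e j) x = if i = j then lorentzSign i else 0
  finrank_eq : ∀ x, finrank ℝ (V.plus x) = 6

namespace PlusFrame

variable {U : Set M} (P : V.PlusFrame U)

/-- The orthonormal frame of `V₋` with the same anchors. -/
def f (i : Fin 6) : C.Sec := P.regular.sw (P.e i)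

theorem isMinus (i : Fin 6) : V.IsMinus (P.f i) := P.regular.isMinus_sw (P.isPlus i)

theorem anchor_f (i : Fin 6) (x : M) : C.anchor x (P.f i x) = C.anchor x (P.e i x) :=
  P.regular.anchor_sw _ _

theorem der_f {S : Type*} [NormedAddCommGroup S] [NormedSpace ℝ S] (i : Fin 6) (φ : M → S) :
    C.der (P.f i) φ = C.der (P.e i) φ := P.regular.der_sw _ _

theorem pair_e_f (i j : Fin 6) : C.pair (P.e i) (P.f j) = 0 :=
  pair_plus_minus (P.isPlus i) (P.isMinus j)

theorem pair_f_e (i j : Fin 6) : C.pair (P.f i) (P.e j) = 0 :=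
  pair_minus_plus (P.isMinus i) (P.isPlus j)

theorem pair_f (i j : Fin 6) : C.pair (P.f i) (P.f j) = - C.pair (P.e i) (P.e j) :=
  P.regular.pair_sw_sw_plus (P.isPlus i) (P.isPlus j)

variable {P} {x : M} (hx : x ∈ U)
include hx

theorem der_pair_e (a : C.Sec) (i j : Fin 6) : C.der a (C.pair (P.e i) (P.e j)) x = 0 := by
  have h1 : C.pair (P.e i) (P.e j) =ᶠ[nhds x] fun _ => if i = j then lorentzSign i else 0 := by
    filter_upwards [P.isOpen.mem_nhds hx] with y hy using P.pair_e y hy i j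
  rw [C.der_congr a h1, C.der_const]; rfl

theorem der_pair_f (a : C.Sec) (i j : Fin 6) : C.der a (C.pair (P.f i) (P.f j)) x = 0 := by
  have h1 : C.pair (P.f i) (P.f j) =ᶠ[nhds x] fun _ => -(if i = j then lorentzSign i else 0) := by
    filter_upwards [P.isOpen.mem_nhds hx] with y hy
    rw [P.pair_f, Pi.neg_apply, P.pair_e y hy i j]
  rw [C.der_congr a h1, C.der_const]; rfl

theorem linearIndependent :
    LinearIndependent ℝ (fun i => (⟨P.e i x, P.isPlus i x⟩ : V.plus x)) := by
  rw [Fintype.linearIndependent_iff]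
  intro c hc j
  have h1 := congrArg (fun v : V.plus x => C.pairing x v (P.e j x)) hc
  simp only [AddSubmonoidClass.coe_finsetSum, SetLike.val_smul, map_sum, map_smul,
    LinearMap.sum_apply, LinearMap.smul_apply, ZeroMemClass.coe_zero, map_zero,
    LinearMap.zero_apply, smul_eq_mul] at h1
  have h2 : ∀ i, C.pairing x (P.e i x) (P.e j x) = if i = j then lorentzSign i else 0 :=
    fun i => P.pair_e x hx i j
  simp only [h2, mul_ite, mul_zero, Finset.sum_ite_eq', Finset.mem_univ, if_true] at h1
  exact (mul_eq_zero.1 h1).resolve_right (lorentzSign_ne_zero j)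

variable (P) in
/-- The frame as a basis of the fibre of `V₊`. -/
def basis : Basis (Fin 6) ℝ (V.plus x) :=
  basisOfLinearIndependentOfCardEqFinrank (linearIndependent (P := P) hx) (by simp [P.finrank_eq])

theorem basis_apply (i : Fin 6) : (P.basis hx i : E x) = P.e i x := by simp [basis]

theorem basis_repr (v : V.plus x) (i : Fin 6) :
    (P.basis hx).repr v i = lorentzSign i * C.pairing x v (P.e i x) := by
  have h2 : ∀ j, C.pairing x (P.e j x) (P.e i x) = if j = i then lorentzSign j else 0 :=
    fun j => P.pair_e x hx j i
  conv_rhs => rw [← (P.basis hx).sum_repr v]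
  simp only [AddSubmonoidClass.coe_finsetSum, SetLike.val_smul, map_sum, map_smul,
    LinearMap.sum_apply, LinearMap.smul_apply, basis_apply, h2, smul_eq_mul, mul_ite, mul_zero,
    Finset.sum_ite_eq', Finset.mem_univ, if_true]
  linear_combination - (P.basis hx).repr v i * lorentzSign_mul_self i

theorem plus_expand {v : E x} (hv : v ∈ V.plus x) :
    v = ∑ n, (lorentzSign n * C.pairing x v (P.e n x)) • P.e n x := by
  have h1 := congrArg Subtype.val ((P.basis hx).sum_repr ⟨v, hv⟩)
  simp only [AddSubmonoidClass.coe_finsetSum, SetLike.val_smul, basis_apply, basis_repr] at h1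
  exact h1.symm

/-- Transport of `plus_expand` through `sw`; the overall sign reflects ⟨fᵢ,fᵢ⟩ = −ηᵢ. -/
theorem minus_expand {v : E x} (hv : v ∈ V.minus x) :
    v = -∑ n, (lorentzSign n * C.pairing x v (P.f n x)) • P.f n x := by
  obtain ⟨t, rfl⟩ := C.exists_sec x v
  have h0 : V.Pm t x = t x := Pm_apply_of_mem_minus hv
  set u := P.regular.sw (V.Pm t) with hu
  have huP : V.IsPlus u := P.regular.isPlus_sw (isMinus_Pm t)
  have h1 := plus_expand (P := P) hx (huP x)
  have h2 := congrArg (fun w => V.liftMinus x (C.anchor x w)) h1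
  simp only [map_sum, map_smul] at h2
  have h3 : C.anchor x (u x) = C.anchor x (t x) := by rw [hu, Regular.anchor_sw, h0]
  rw [h3, P.regular.liftMinus_anchor hv] at h2
  rw [h2, ← Finset.sum_neg_distrib]
  refine Finset.sum_congr rfl fun n _ => ?_
  have h4 : V.liftMinus x (C.anchor x (P.e n x)) = P.f n x := by
    rw [← P.anchor_f, P.regular.liftMinus_anchor (P.isMinus n x)]
  have h5 := congrFun (P.regular.pair_sw (V.Pm t) (P.e n)) x
  have h6 : C.pairing x (t x) (P.f n x) = C.pair (V.Pm t) (P.f n) x := by rw [pair, h0]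
  rw [← h2, h4, h6]
  change (lorentzSign n * C.pair (P.regular.sw (V.Pm t)) (P.e n) x) • _ = _
  rw [h5, Pi.neg_apply, mul_neg, neg_smul]
  rfl

theorem sec_expand (t : C.Sec) :
    t x = ∑ n, ((lorentzSign n * C.pair t (P.e n) x) • P.e n x
      - (lorentzSign n * C.pair t (P.f n) x) • P.f n x) := by
  have h1 := plus_expand (P := P) hx (isPlus_Pp (V := V) t x)
  have h2 := minus_expand (P := P) hx (isMinus_Pm (V := V) t x)
  have h3 : V.Pp t x + V.Pm t x = t x := half_add_add_half_sub _
  have h4 : ∀ n, C.pairing x (V.Pp t x) (P.e n x) = C.pair t (P.e n) x := fun n => by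
    change C.pair (V.Pp t) _ x = _; rw [pair_Pp, (P.isPlus n).Pp_eq]
  have h5 : ∀ n, C.pairing x (V.Pm t x) (P.f n x) = C.pair t (P.f n) x := fun n => by
    change C.pair (V.Pm t) _ x = _; rw [pair_Pm, (P.isMinus n).Pm_eq]
  simp only [h4, h5] at h1 h2
  rw [← h3, h1, h2, Finset.sum_sub_distrib, sub_eq_add_neg]

theorem pair_expand (s t : C.Sec) :
    C.pair s t x = ∑ n, lorentzSign n * (C.pair s (P.e n) x * C.pair t (P.e n) x
      - C.pair s (P.f n) x * C.pair t (P.f n) x) := by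
  conv_lhs => rw [pair, sec_expand (P := P) hx t]
  simp only [map_sum, map_sub, map_smul, smul_eq_mul, pair]
  exact Finset.sum_congr rfl fun n _ => by ring

theorem der_expand {S : Type*} [NormedAddCommGroup S] [NormedSpace ℝ S] (t : C.Sec) (φ : M → S) :
    C.der t φ x = ∑ n, (lorentzSign n * (C.pair t (P.e n) x - C.pair t (P.f n) x)) •
      C.der (P.e n) φ x := by
  rw [der, sec_expand (P := P) hx t]
  simp only [map_sum, map_sub, map_smul, P.anchor_f]
  refine Finset.sum_congr rfl fun n _ => ?_
  rw [← sub_smul, ← mul_sub]; rfl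

omit hx

variable (P)

/-- The structure functions `⟨[eᵢ, eⱼ], eₖ⟩`. -/
def F3 (i j k : Fin 6) : M → ℝ := C.pair (C.br (P.e i) (P.e j)) (P.e k)

/-- The structure functions `⟨[fᵢ, eⱼ], eₖ⟩`. -/
def B3 (i j k : Fin 6) : M → ℝ := C.pair (C.br (P.f i) (P.e j)) (P.e k)

/-- The structure functions `⟨[eᵢ, fⱼ], fₖ⟩`. -/
def N3 (i j k : Fin 6) : M → ℝ := C.pair (C.br (P.e i) (P.f j)) (P.f k)

/-- The components of the torsion of the Gualtieri–Bismut connection. -/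
def H3 (i j k : Fin 6) : M → ℝ := C.pair (P.regular.tor (P.e i) (P.e j)) (P.e k)

variable {P}

theorem H3_swap_left (i j k : Fin 6) : P.H3 i j k x = - P.H3 j i k x := by
  rw [H3, Regular.tor_swap, pair_neg_left]; rfl

theorem H3_swap_right (i j k : Fin 6) : P.H3 i j k x = - P.H3 i k j x :=
  P.regular.pair_tor_swap_right _ _ _ _

theorem pair_br_ee_f (i j n : Fin 6) :
    C.pair (C.br (P.e i) (P.e j)) (P.f n) = P.B3 n i j := by
  rw [B3, pair_br_left (P.pair_f_e n i) (P.pair_f_e n j), pair_comm]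

theorem pair_br_fe_f (m k n : Fin 6) :
    C.pair (C.br (P.f m) (P.e k)) (P.f n) = - P.N3 k m n :=
  pair_br_anti (P.pair_f_e m k) _

include hx

theorem F3_swap_left (i j k : Fin 6) : P.F3 i j k x = - P.F3 j i k x := by
  have h1 := C.pair_br_symm (P.e i) (P.e j) (P.e k) x
  rw [der_pair_e hx] at h1
  exact eq_neg_of_add_eq_zero_left h1

theorem F3_swap_right (i j k : Fin 6) : P.F3 i j k x = - P.F3 i k j x := by
  have h1 := C.der_pair (P.e i) (P.e j) (P.e k) x
  rw [der_pair_e hx, C.pair_comm (P.e j)] at h1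
  exact eq_neg_of_add_eq_zero_left h1.symm

theorem B3_swap (i j k : Fin 6) : P.B3 i j k x = - P.B3 i k j x := by
  have h1 := C.der_pair (P.f i) (P.e j) (P.e k) x
  rw [der_pair_e hx, C.pair_comm (P.e j)] at h1
  exact eq_neg_of_add_eq_zero_left h1.symm

/-- ⟨D^B_{eᵢ} eⱼ, eₖ⟩ = B_ijk because D^B differentiates V₊ along eᵢ by bracketing with fᵢ; ⟨eᵢ,eⱼ⟩
is locally constant, so the Courant bracket contributes just F_ijk. -/
theorem H3_eq (i j k : Fin 6) :
    P.H3 i j k x = P.B3 i j k x + P.B3 j k i x + P.B3 k i j x - P.F3 i j k x := by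
  have hb : ∀ i j k, C.pair (P.regular.bis (P.e i) (P.e j)) (P.e k) = P.B3 i j k := by
    intro i j k
    simp [Regular.bis, (P.isPlus _).Pp_eq, (P.isPlus _).Pm_eq, pair_Pp, B3, f]
  rw [H3, Regular.pair_tor, hb, hb, hb, hb, C.pair_cb, der_pair_e hx]
  have h1 := B3_swap (P := P) hx k j i
  have h2 := B3_swap (P := P) hx j i k
  have h3 : C.pair (C.br (P.e i) (P.e j)) (P.e k) x = P.F3 i j k x := rfl
  rw [h3, h1, h2]
  ring

/-- Pair the vanishing bracket [eᵢ − fᵢ, eⱼ − fⱼ] with eₖ: the four resulting terms are structure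
functions, so N is not independent data. -/
theorem N3_eq (k i j : Fin 6) : P.N3 k i j x = P.H3 k i j x - P.B3 k i j x := by
  have h1 : C.pair (C.br (P.e i - P.f i) (P.e j - P.f j)) (P.e k) x = 0 := by
    rw [f, f, Regular.br_sub_sw]; simp [pair]
  simp only [map_sub, LinearMap.sub_apply, pair_sub_left] at h1
  have h2 : C.pair (C.br (P.e i) (P.f j)) (P.e k) = - P.B3 j i k := pair_br_anti (P.pair_e_f i j) _
  have h3 : C.pair (C.br (P.f i) (P.f j)) (P.e k) = P.N3 k i j := by
    rw [N3, pair_br_left (P.pair_e_f k i) (P.pair_e_f k j), pair_comm]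
  rw [h2, h3] at h1
  simp only [Pi.sub_apply, Pi.neg_apply] at h1
  have h4 := H3_eq (P := P) hx k i j
  have h5 := B3_swap (P := P) hx j i k
  have h6 := F3_swap_left (P := P) hx k i j
  have h7 := F3_swap_right (P := P) hx i k j
  change P.F3 i j k x - P.B3 i j k x - _ = 0 at h1
  linarith

theorem pair_br_ee_br_ee (i j k l : Fin 6) :
    C.pair (C.br (P.e i) (P.e j)) (C.br (P.e k) (P.e l)) x =
      ∑ n, lorentzSign n * (P.F3 i j n x * P.F3 k l n x - P.B3 n i j x * P.B3 n k l x) := by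
  rw [pair_expand (P := P) hx]
  simp only [pair_br_ee_f]
  rfl

theorem pair_br_ee_br_fe (i j m l : Fin 6) :
    C.pair (C.br (P.e i) (P.e j)) (C.br (P.f m) (P.e l)) x =
      ∑ n, lorentzSign n * (P.F3 i j n x * P.B3 m l n x + P.B3 n i j x * P.N3 l m n x) := by
  rw [pair_expand (P := P) hx]
  simp only [pair_br_ee_f, pair_br_fe_f, Pi.neg_apply, mul_neg, sub_neg_eq_add]
  rfl

theorem jacobi_eeee (i j k l : Fin 6) :
    C.der (P.e i) (P.F3 j k l) x - C.der (P.e j) (P.F3 i k l) x + C.der (P.e k) (P.F3 i j l) x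
      - C.der (P.e l) (P.F3 i j k) x =
    ∑ n, lorentzSign n * ((P.F3 j k n x * P.F3 i l n x - P.B3 n j k x * P.B3 n i l x)
      - (P.F3 i k n x * P.F3 j l n x - P.B3 n i k x * P.B3 n j l x)
      + (P.F3 i j n x * P.F3 k l n x - P.B3 n i j x * P.B3 n k l x)) := by
  have h1 := C.jacobi_pair (P.e i) (P.e j) (P.e k) (P.e l) x
  rw [pair_br_ee_br_ee hx, pair_br_ee_br_ee hx, pair_br_ee_br_ee hx] at h1
  simp only [mul_add, mul_sub, Finset.sum_add_distrib, Finset.sum_sub_distrib] at h1 ⊢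
  exact h1

theorem jacobi_feee (m i j k : Fin 6) :
    C.der (P.e m) (P.F3 i j k) x - C.der (P.e i) (P.B3 m j k) x + C.der (P.e j) (P.B3 m i k) x
      - C.der (P.e k) (P.B3 m i j) x =
    ∑ n, lorentzSign n * ((P.F3 i j n x * P.B3 m k n x + P.B3 n i j x * P.N3 k m n x)
      - (P.F3 i k n x * P.B3 m j n x + P.B3 n i k x * P.N3 j m n x)
      + (P.F3 j k n x * P.B3 m i n x + P.B3 n j k x * P.N3 i m n x)) := by
  have h1 := C.jacobi_pair (P.f m) (P.e i) (P.e j) (P.e k) x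
  rw [C.pair_comm (C.br (P.f m) (P.e j)) (C.br (P.e i) (P.e k)),
    C.pair_comm (C.br (P.f m) (P.e i)) (C.br (P.e j) (P.e k)),
    pair_br_ee_br_fe hx, pair_br_ee_br_fe hx, pair_br_ee_br_fe hx, P.der_f] at h1
  simp only [mul_add, mul_sub, Finset.sum_add_distrib, Finset.sum_sub_distrib] at h1 ⊢
  exact h1

end PlusFrame

end Frames

end CourantAlgebroid.GeneralizedMetric

/-! ### The generalized Ricci tensor in a frame -/

namespace CourantAlgebroid.GeneralizedMetric

section Ricci

variable {M : Type*} [TopologicalSpace M] [ChartedSpace (EuclideanSpace ℝ (Fin 6)) M] [IsManifold (𝓡 6) ∞ M]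
  {F : Type*} [NormedAddCommGroup F] [NormedSpace ℝ F]
  {E : M → Type*} [TopologicalSpace (TotalSpace F E)]
  [∀ x, AddCommGroup (E x)] [∀ x, Module ℝ (E x)] [∀ x, TopologicalSpace (E x)] [FiberBundle F E]
  [VectorBundle ℝ F E] [T2Space M] [ContMDiffVectorBundle ∞ F E (𝓡 6)]
  {C : CourantAlgebroid 6 F E} {V : C.GeneralizedMetric}

theorem Regular.tor_plus_minus (h : V.Regular) {a b : C.Sec} (ha : V.IsPlus a) (hb : V.IsMinus b) :
    h.tor a b = 0 := by
  have h1 := h.lcForm_plus_minus ha hb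
  have h2 : h.bisForm a b = 0 := by simp [bisForm, ha.Pm_eq, hb.Pp_eq]
  rw [lcForm, h2, zero_sub, neg_eq_zero] at h1
  exact (smul_eq_zero.1 h1).resolve_left (by norm_num)

theorem Regular.lc_minus_plus (h : V.Regular) {a b : C.Sec} (ha : V.IsMinus a) (hb : V.IsPlus b) :
    h.lc a b = V.Pp (C.br a b) := by
  rw [lc, tor_swap, h.tor_plus_minus hb ha, bis, ha.Pm_eq, ha.Pp_eq, hb.Pp_eq, hb.Pm_eq]
  simp

theorem Regular.lc_plus_plus (h : V.Regular) {a b : C.Sec} (ha : V.IsPlus a) (hb : V.IsPlus b) :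
    h.lc a b = V.Pp (C.br (h.sw a) b) - (1 / 3 : ℝ) • h.tor a b := by
  rw [lc, bis, ha.Pm_eq, ha.Pp_eq, hb.Pp_eq, hb.Pm_eq]
  simp

namespace PlusFrame

variable {U : Set M} {P : V.PlusFrame U} {x : M}

theorem pair_lc_f (i j k : Fin 6) :
    C.pair (P.regular.lc (P.f i) (P.e j)) (P.e k) = P.B3 i j k := by
  rw [P.regular.lc_minus_plus (P.isMinus i) (P.isPlus j), pair_Pp, (P.isPlus k).Pp_eq, B3]

theorem pair_lc_e (i j k : Fin 6) :
    C.pair (P.regular.lc (P.e i) (P.e j)) (P.e k) = P.B3 i j k - (1 / 3 : ℝ) • P.H3 i j k := by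
  rw [P.regular.lc_plus_plus (P.isPlus i) (P.isPlus j), pair_sub_left, pair_smul_left, pair_Pp,
    (P.isPlus k).Pp_eq, B3, H3, f]

theorem H3_outer_self (i j : Fin 6) : P.H3 i j i = 0 := by
  funext x
  have h1 := H3_swap_right (P := P) (x := x) i j i
  have h2 := H3_swap_left (P := P) (x := x) i i j
  have h3 : P.H3 i j i x = 0 := by linarith
  exact h3

theorem H3_left_self (i j : Fin 6) : P.H3 i i j = 0 := by
  funext x
  have h2 := H3_swap_left (P := P) (x := x) i i j
  have h3 : P.H3 i i j x = 0 := by linarith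
  exact h3

variable (hx : x ∈ U)
include hx

/-- The torsion T(fⱼ,fⱼ) is zero, so the coefficient is N_jjn = H_jjn − B_jjn, whose H-term vanishes
by antisymmetry. -/
theorem pair_lc_f_f (j n : Fin 6) :
    C.pair (P.regular.lc (P.f j) (P.f j)) (P.f n) x = - P.B3 j j n x := by
  have h1 : P.regular.sw (P.f j) = P.e j := P.regular.sw_sw _
  rw [P.regular.lc_self_minus (P.isMinus j), h1, (P.isMinus n).Pm_eq]
  change P.N3 j j n x = _
  rw [N3_eq hx, H3_left_self]; simp

/-- Metric compatibility turns the iterated derivatives into derivatives of B plus products of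
connection coefficients. The bracket [eᵢ,fₖ] has components along both frames; those along `f` bring
in N. -/
theorem pair_curv (i k : Fin 6) :
    C.pair (P.regular.curv (P.e i) (P.f k) (P.e k)) (P.e i) x =
      C.der (P.e i) (P.B3 k k i) x - C.der (P.e k) (P.B3 i k i) x
      + ∑ n, lorentzSign n * (- P.B3 k k n x * P.B3 i i n x
        + (P.B3 i k n x - (1 / 3) * P.H3 i k n x) * P.B3 k i n x
        + P.B3 k i n x * (P.B3 n k i x - (1 / 3) * P.H3 n k i x)
        + P.N3 i k n x * P.B3 n k i x) := by
  have hR := P.regular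
  have h1 := P.regular.der_pair_lc (P.e i) (P.regular.lc (P.f k) (P.e k)) (P.e i) x
  have h2 := P.regular.der_pair_lc (P.f k) (P.regular.lc (P.e i) (P.e k)) (P.e i) x
  have hcb : C.cb (P.e i) (P.f k) = - C.br (P.f k) (P.e i) := by
    rw [cb, br_anti (P.pair_e_f i k)]; module
  have hpm : ∀ (a b : C.Sec) n, V.IsPlus a → C.pair a (P.f n) x = 0 := fun a _ n ha => by
    rw [pair_plus_minus ha (P.isMinus n)]; rfl
  have h3 := C.pair_comm (P.regular.lc (P.f k) (P.e k)) (P.regular.lc (P.e i) (P.e i))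
  have h4 : C.pair (P.regular.lc (P.f k) (P.e k)) (P.regular.lc (P.e i) (P.e i)) x
      = ∑ n, lorentzSign n * (P.B3 k k n x * P.B3 i i n x) := by
    rw [pair_expand (P := P) hx]
    simp only [pair_lc_f, pair_lc_e, H3_left_self, smul_zero, sub_zero,
      hpm _ (P.e i) _ (P.regular.isPlus_lc _ (P.isPlus _)), mul_zero]
  have h5 : C.pair (P.regular.lc (P.e i) (P.e k)) (P.regular.lc (P.f k) (P.e i)) x
      = ∑ n, lorentzSign n * ((P.B3 i k n x - (1 / 3) * P.H3 i k n x) * P.B3 k i n x) := by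
    rw [pair_expand (P := P) hx]
    simp only [pair_lc_f, pair_lc_e,
      hpm _ (P.e i) _ (P.regular.isPlus_lc _ (P.isPlus _)), mul_zero, sub_zero]
    rfl
  have h6 : C.pair (P.regular.lc (C.cb (P.e i) (P.f k)) (P.e k)) (P.e i) x
      = ∑ n, lorentzSign n * (- (P.B3 k i n x * (P.B3 n k i x - (1 / 3) * P.H3 n k i x))
        - P.N3 i k n x * P.B3 n k i x) := by
    rw [Regular.pair_lc, pair_expand (P := P) hx, hcb]
    simp only [C.pair_comm (P.regular.lcForm _ _), ← Regular.pair_lc, pair_lc_e, pair_lc_f,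
      pair_neg_left, Pi.neg_apply, pair_br_fe_f, neg_neg]
    refine Finset.sum_congr rfl fun n _ => ?_
    have e1 : C.pair (C.br (P.f k) (P.e i)) (P.e n) x = P.B3 k i n x := rfl
    rw [e1]
    simp only [Pi.sub_apply, Pi.smul_apply, smul_eq_mul]
    ring
  rw [pair_lc_f] at h1
  -- H_iki = 0, so no derivative of the torsion occurs.
  rw [pair_lc_e, H3_outer_self, smul_zero, sub_zero, P.der_f] at h2
  rw [Regular.curv, pair_sub_left, pair_sub_left]
  simp only [Pi.sub_apply]
  rw [h6]
  rw [h4] at h1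
  rw [h5] at h2
  simp only [mul_add, mul_sub, Finset.sum_add_distrib, Finset.sum_sub_distrib, mul_neg, neg_mul,
    Finset.sum_neg_distrib] at h1 h2 ⊢
  linarith

/-- An explicit endomorphism built from `pair_curv` shows that the choice in `ricci` has a solution;
the trace of any solution is determined by its values on the frame sections. -/
theorem ricci_eq {b c : C.Sec} (hb : V.IsMinus b) (hc : V.IsPlus c) :
    V.ricci b c x = ∑ i, lorentzSign i * C.pair (P.regular.curv (P.e i) b c) (P.e i) x := by
  set W : Fin 6 → C.Sec := fun i => P.regular.lcForm (P.regular.lc b c) (P.e i)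
    + P.regular.lcForm c (P.regular.lc b (P.e i)) - C.br b (P.regular.lcForm c (P.e i))
  have hW : ∀ (a : C.Sec), V.IsPlus a → ∀ i,
      C.pair (P.regular.curv a b c) (P.e i) x = C.pair a (W i) x := fun a ha i =>
    P.regular.pair_curv ha hb c (P.e i) x
  have hex : ∃ T : Module.End ℝ (V.plus x),
      ∀ (a : ∀ y, E y) (ha : ∀ y, a y ∈ V.plus y), IsSmoothSection 6 F a →
        (T ⟨a x, ha x⟩ : E x) = C.curvature V.leviCivita a b c x := by
    refine ⟨∑ i, LinearMap.smulRight (lorentzSign i •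
      ((C.pairing x).flip (W i x) ∘ₗ (V.plus x).subtype)) ⟨P.e i x, P.isPlus i x⟩, ?_⟩
    intro a ha hs
    have h1 := P.regular.coe_curv (C.mkSec a hs) b c
    rw [coe_mkSec] at h1
    rw [← h1, plus_expand (P := P) hx (P.regular.isPlus_curv (a := C.mkSec a hs) (b := b) hc x)]
    simp only [LinearMap.sum_apply, AddSubmonoidClass.coe_finsetSum]
    refine Finset.sum_congr rfl fun i _ => ?_
    have h2 := hW (C.mkSec a hs) ha i
    simp only [pair] at h2
    rw [h2]
    rfl
  have hspec := Classical.epsilon_spec hex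
  rw [ricci]
  set T := Classical.epsilon fun T : Module.End ℝ (V.plus x) =>
    ∀ (a : ∀ y, E y) (ha : ∀ y, a y ∈ V.plus y), IsSmoothSection 6 F a →
      (T ⟨a x, ha x⟩ : E x) = C.curvature V.leviCivita a b c x
  rw [LinearMap.trace_eq_matrix_trace ℝ (P.basis hx), Matrix.trace]
  refine Finset.sum_congr rfl fun i _ => ?_
  rw [Matrix.diag_apply, LinearMap.toMatrix_apply, basis_repr]
  have h3 : P.basis hx i = ⟨P.e i x, P.isPlus i x⟩ := Subtype.ext (basis_apply hx i)
  rw [h3, hspec (P.e i) (P.isPlus i) (P.e i).smooth, ← P.regular.coe_curv]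
  rfl

/-- Only the trace of GRic over the pairs (fₖ,eₖ), which share an anchor, enters the scalar
computation. -/
theorem ricci_trace (hric : V.IsRicciFlat) :
    ∑ k, ∑ i, lorentzSign k * (lorentzSign i * (C.der (P.e i) (P.B3 k k i) x
      - C.der (P.e k) (P.B3 i k i) x + ∑ n, lorentzSign n * (- P.B3 k k n x * P.B3 i i n x
        + (P.B3 i k n x - (1 / 3) * P.H3 i k n x) * P.B3 k i n x
        + P.B3 k i n x * (P.B3 n k i x - (1 / 3) * P.H3 n k i x)
        + P.N3 i k n x * P.B3 n k i x))) = 0 := by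
  refine Finset.sum_eq_zero fun k _ => ?_
  rw [← Finset.mul_sum]
  have h1 := hric (P.f k) (P.e k) (P.f k).smooth (P.e k).smooth (P.isMinus k) (P.isPlus k) x
  rw [ricci_eq hx (P.isMinus k) (P.isPlus k)] at h1
  refine mul_eq_zero_of_right _ (Eq.trans (Finset.sum_congr rfl fun i _ => ?_) h1)
  rw [pair_curv (P := P) hx i k]

end PlusFrame

end Ricci

end CourantAlgebroid.GeneralizedMetric

/-! ### Contraction of tensors with Clifford generators -/

namespace CliffordFrame

variable {ι : Type*} [Fintype ι] [DecidableEq ι] {A : Type*} [Ring A] [Algebra ℝ A] (g : ι → A)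

/-- Contraction of a covector with Clifford generators. -/
def q1 : (ι → ℝ) →ₗ[ℝ] A where
  toFun T := ∑ i, T i • g i
  map_add' S T := by simp [add_smul, Finset.sum_add_distrib]
  map_smul' r T := by simp [mul_smul, Finset.smul_sum]

/-- Contraction of a two-tensor with Clifford generators. -/
def q2 : (ι → ι → ℝ) →ₗ[ℝ] A where
  toFun T := ∑ i, ∑ j, T i j • (g i * g j)
  map_add' S T := by simp [add_smul, Finset.sum_add_distrib]
  map_smul' r T := by simp [mul_smul, Finset.smul_sum]

/-- Contraction of a three-tensor with Clifford generators. -/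
def q3 : (ι → ι → ι → ℝ) →ₗ[ℝ] A where
  toFun T := ∑ i, ∑ j, ∑ k, T i j k • (g i * g j * g k)
  map_add' S T := by simp [add_smul, Finset.sum_add_distrib]
  map_smul' r T := by simp [mul_smul, Finset.smul_sum]

/-- Contraction of a four-tensor with Clifford generators. -/
def q4 : (ι → ι → ι → ι → ℝ) →ₗ[ℝ] A where
  toFun T := ∑ i, ∑ j, ∑ k, ∑ l, T i j k l • (g i * g j * g k * g l)
  map_add' S T := by simp [add_smul, Finset.sum_add_distrib]
  map_smul' r T := by simp [mul_smul, Finset.smul_sum]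

theorem q1_apply (T : ι → ℝ) : q1 g T = ∑ i, T i • g i := rfl

theorem q2_apply (T : ι → ι → ℝ) : q2 g T = ∑ i, ∑ j, T i j • (g i * g j) := rfl

theorem q3_apply (T : ι → ι → ι → ℝ) :
    q3 g T = ∑ i, ∑ j, ∑ k, T i j k • (g i * g j * g k) := rfl

theorem q4_apply (T : ι → ι → ι → ι → ℝ) :
    q4 g T = ∑ i, ∑ j, ∑ k, ∑ l, T i j k l • (g i * g j * g k * g l) := rfl

theorem q1_mul_q1 (S T : ι → ℝ) : q1 g S * q1 g T = q2 g (fun i j => S i * T j) := by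
  simp only [q1_apply, q2_apply, Finset.sum_mul_sum, smul_mul_smul_comm]

/-- Isolating two neighbouring factors as a `q2` reduces exchanges inside a quartic product to
`q2_swap`; the next two lemmas do this for the other neighbouring pairs. -/
theorem q4_eq_12 (T : ι → ι → ι → ι → ℝ) :
    q4 g T = ∑ k, ∑ l, q2 g (fun i j => T i j k l) * (g k * g l) := by
  simp only [q4_apply, q2_apply, Finset.sum_mul, smul_mul_assoc, ← mul_assoc]
  calc _ = ∑ i, ∑ k, ∑ j, ∑ l, T i j k l • (g i * g j * g k * g l) :=
        Finset.sum_congr rfl fun i _ => Finset.sum_comm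
    _ = ∑ k, ∑ i, ∑ j, ∑ l, T i j k l • (g i * g j * g k * g l) := Finset.sum_comm
    _ = ∑ k, ∑ i, ∑ l, ∑ j, T i j k l • (g i * g j * g k * g l) :=
        Finset.sum_congr rfl fun k _ => Finset.sum_congr rfl fun i _ => Finset.sum_comm
    _ = _ := Finset.sum_congr rfl fun k _ => Finset.sum_comm

theorem q4_eq_23 (T : ι → ι → ι → ι → ℝ) :
    q4 g T = ∑ i, ∑ l, g i * q2 g (fun j k => T i j k l) * g l := by
  simp only [q4_apply, q2_apply, Finset.mul_sum, Finset.sum_mul, smul_mul_assoc, mul_smul_comm,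
    ← mul_assoc]
  calc _ = ∑ i, ∑ j, ∑ l, ∑ k, T i j k l • (g i * g j * g k * g l) :=
        Finset.sum_congr rfl fun i _ => Finset.sum_congr rfl fun j _ => Finset.sum_comm
    _ = _ := Finset.sum_congr rfl fun i _ => Finset.sum_comm

theorem q4_eq_34 (T : ι → ι → ι → ι → ℝ) :
    q4 g T = ∑ i, ∑ j, g i * g j * q2 g (T i j) := by
  simp only [q4_apply, q2_apply, Finset.mul_sum, mul_smul_comm, ← mul_assoc]

theorem q2_mul_q2 (S T : ι → ι → ℝ) :
    q2 g S * q2 g T = q4 g (fun i j k l => S i j * T k l) := by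
  rw [q4_eq_34]
  simp only [q2_apply g S, Finset.sum_mul, smul_mul_assoc]
  refine Finset.sum_congr rfl fun i _ => Finset.sum_congr rfl fun j _ => ?_
  rw [← mul_smul_comm, ← map_smul]
  rfl

theorem sum_mul_q1 (T : ι → ι → ℝ) : ∑ l, g l * q1 g (T l) = q2 g T := by
  simp only [q1_apply, q2_apply, Finset.mul_sum, mul_smul_comm]

theorem sum_mul_q3 (T : ι → ι → ι → ι → ℝ) : ∑ l, g l * q3 g (T l) = q4 g T := by
  simp only [q3_apply, q4_apply, Finset.mul_sum, mul_smul_comm, mul_assoc]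

variable {g} {η : ι → ℝ}
  (hg : ∀ i j, g i * g j + g j * g i = (if i = j then -2 * η i else 0) • (1 : A))
include hg

theorem mul_swap (i j : ι) :
    g i * g j = -(g j * g i) + (if i = j then -2 * η i else 0) • (1 : A) := by
  rw [← hg]; abel

theorem q2_swap (T : ι → ι → ℝ) :
    q2 g T = - q2 g (fun i j => T j i) - (2 * ∑ i, η i * T i i) • (1 : A) := by
  have h1 : ∀ i j, T i j • (g i * g j) = -(T i j • (g j * g i))
      + (if i = j then -2 * (η i * T i i) else 0) • (1 : A) := by
    intro i j
    rw [mul_swap hg i j, smul_add, smul_neg, smul_smul]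
    congr 2
    split_ifs with h
    · subst h; ring
    · ring
  rw [q2_apply]
  simp only [h1, Finset.sum_add_distrib, ← Finset.sum_smul, Finset.sum_ite_eq, Finset.mem_univ,
    if_true, Finset.sum_neg_distrib]
  rw [Finset.sum_comm, sub_eq_add_neg, ← neg_smul, Finset.mul_sum, ← Finset.sum_neg_distrib,
    ← Finset.sum_neg_distrib]
  simp only [neg_mul, Finset.sum_neg_distrib]
  rfl

theorem q4_swap12 (T : ι → ι → ι → ι → ℝ) :
    q4 g T = - q4 g (fun i j k l => T j i k l)
      - (2 : ℝ) • q2 g (fun k l => ∑ i, η i * T i i k l) := by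
  rw [q4_eq_12, q4_eq_12, q2_apply g (fun k l => ∑ i, η i * T i i k l)]
  simp only [q2_swap hg (fun i j => T i j _ _), sub_mul, neg_mul, Finset.sum_sub_distrib,
    Finset.sum_neg_distrib, smul_mul_assoc, one_mul, mul_smul, Finset.smul_sum]

theorem q4_swap23 (T : ι → ι → ι → ι → ℝ) :
    q4 g T = - q4 g (fun i j k l => T i k j l)
      - (2 : ℝ) • q2 g (fun i l => ∑ j, η j * T i j j l) := by
  rw [q4_eq_23, q4_eq_23, q2_apply g (fun i l => ∑ j, η j * T i j j l)]
  simp only [q2_swap hg (fun j k => T _ j k _), sub_mul, mul_sub, neg_mul, mul_neg,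
    Finset.sum_sub_distrib, Finset.sum_neg_distrib, smul_mul_assoc, mul_smul_comm, mul_one,
    mul_smul, Finset.smul_sum]

theorem q4_swap34 (T : ι → ι → ι → ι → ℝ) :
    q4 g T = - q4 g (fun i j k l => T i j l k)
      - (2 : ℝ) • q2 g (fun i j => ∑ k, η k * T i j k k) := by
  rw [q4_eq_34, q4_eq_34, q2_apply g (fun i j => ∑ k, η k * T i j k k)]
  simp only [q2_swap hg (T _ _), mul_sub, mul_neg, Finset.sum_sub_distrib, Finset.sum_neg_distrib,
    mul_smul_comm, mul_one, mul_smul, Finset.smul_sum]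

/-- The off-diagonal terms cancel by anticommutation and gᵢ² = −ηᵢ. -/
theorem q2_symm {T : ι → ι → ℝ} (hT : ∀ i j, T i j = T j i) :
    q2 g T = - (∑ i, η i * T i i) • (1 : A) := by
  have h1 := q2_swap hg T
  have h2 : (fun i j => T j i) = T := funext fun i => funext fun j => hT j i
  rw [h2] at h1
  have h3 : (2 : ℝ) • q2 g T = (2 : ℝ) • (-(∑ i, η i * T i i) • (1 : A)) := by
    rw [smul_smul, two_smul]
    nth_rw 1 [h1]
    module
  exact smul_right_injective A (two_ne_zero : (2 : ℝ) ≠ 0) h3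

/-- The Clifford square of a family of two-forms, in three orders. -/
theorem q4_sym_square {n : Type*} [Fintype n] (η' : n → ℝ) {K : n → ι → ι → ℝ}
    (hK : ∀ m i j, K m i j = - K m j i) :
    q4 g (fun i j k l => ∑ m, η' m * (K m j k * K m i l - K m i k * K m j l + K m i j * K m k l))
      = (3 : ℝ) • ∑ m, η' m • (q2 g (K m) * q2 g (K m))
        + (6 * ∑ m, ∑ i, ∑ j, η' m * η i * η j * (K m i j * K m i j)) • (1 : A) := by
  have key : ∀ m, q4 g (fun i j k l => K m j k * K m i l - K m i k * K m j l + K m i j * K m k l)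
      = (3 : ℝ) • (q2 g (K m) * q2 g (K m))
        + (6 * ∑ i, ∑ j, η i * η j * (K m i j * K m i j)) • (1 : A) := by
    intro m
    have e0 : (fun i j k l => K m j k * K m i l - K m i k * K m j l + K m i j * K m k l)
      = (fun i j k l => K m j k * K m i l) - (fun i j k l => K m i k * K m j l)
        + (fun i j k l => K m i j * K m k l) := rfl
    -- Exchanging slots 1 and 2 turns the first product into the second, and exchanging slots 2 and
    -- 3 turns the second into the third, which is `q2 · q2`. Each contraction is a symmetric
    -- two-tensor, hence a scalar.
    have e1 := q4_swap12 hg (fun i j k l => K m j k * K m i l)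
    have e2 := q4_swap23 hg (fun i j k l => K m i k * K m j l)
    rw [q2_symm hg (fun k l => by simp only [mul_comm])] at e1
    rw [q2_symm hg (fun i l => by
      simp only [mul_comm, hK m l, hK m i]; simp [mul_comm])] at e2
    have s1 : ∑ i, η i * ∑ j, η j * (K m j i * K m j i)
        = ∑ i, ∑ j, η i * η j * (K m i j * K m i j) := by
      simp only [Finset.mul_sum]
      rw [Finset.sum_comm]
      exact Finset.sum_congr rfl fun i _ => Finset.sum_congr rfl fun j _ => by ring
    have s2 : ∑ i, η i * ∑ j, η j * (K m i j * K m j i)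
        = - ∑ i, ∑ j, η i * η j * (K m i j * K m i j) := by
      simp only [Finset.mul_sum, ← Finset.sum_neg_distrib]
      exact Finset.sum_congr rfl fun i _ => Finset.sum_congr rfl fun j _ => by
        rw [hK m j i]; ring
    rw [s1] at e1
    rw [s2, ← q2_mul_q2] at e2
    rw [e0, map_add, map_sub, e1, e2, ← q2_mul_q2]
    module
  have e : (fun i j k l => ∑ m, η' m * (K m j k * K m i l - K m i k * K m j l + K m i j * K m k l))
      = ∑ m, η' m • (fun i j k l => K m j k * K m i l - K m i k * K m j l + K m i j * K m k l) := by
    funext i j k l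
    simp [Finset.sum_apply]
  rw [e, map_sum]
  simp only [map_smul, key, smul_add, Finset.sum_add_distrib, Finset.smul_sum, Finset.mul_sum,
    Finset.sum_smul, smul_smul]
  congr 1
  · exact Finset.sum_congr rfl fun m _ => by rw [mul_comm]
  · exact Finset.sum_congr rfl fun m _ => Finset.sum_congr rfl fun i _ =>
      Finset.sum_congr rfl fun j _ => by congr 1; ring

end CliffordFrame

/-! ### Commutation rules and the square of a Clifford three-form -/

namespace CliffordFrame

variable {ι : Type*} [Fintype ι] [DecidableEq ι] {A : Type*} [Ring A] [Algebra ℝ A] {g : ι → A}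
  {η : ι → ℝ}

/-- The square norm of a three-tensor. -/
def normSq3 (η : ι → ℝ) (T : ι → ι → ι → ℝ) : ℝ :=
  ∑ i, ∑ j, ∑ k, η i * η j * η k * (T i j k * T i j k)

theorem q3_eq_sum (T : ι → ι → ι → ℝ) : q3 g T = ∑ i, g i * q2 g (T i) := by
  simp only [q3_apply, q2_apply, Finset.mul_sum, mul_smul_comm, mul_assoc]

variable (hg : ∀ i j, g i * g j + g j * g i = (if i = j then -2 * η i else 0) • (1 : A))
include hg

theorem q1_anticomm (T : ι → ℝ) (m : ι) :
    g m * q1 g T + q1 g T * g m = (-2 * η m * T m) • (1 : A) := by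
  simp only [q1_apply, Finset.mul_sum, Finset.sum_mul, mul_smul_comm, smul_mul_assoc,
    ← Finset.sum_add_distrib, ← smul_add, hg, smul_smul]
  rw [← Finset.sum_smul]
  congr 1
  simp [mul_comm]

/-- A two-form acts by commutator as an infinitesimal rotation: each of its two factors meets `g m`
once, and antisymmetry makes the two contributions equal. -/
theorem q2_mul_gen {K : ι → ι → ℝ} (hK : ∀ i j, K i j = - K j i) (m : ι) :
    q2 g K * g m = g m * q2 g K + (4 * η m) • q1 g (K m) := by
  have h1 : ∀ i j, K i j • (g i * g j * g m) = K i j • (g m * g i * g j)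
      - (if i = m then (-2 * η m * K i j) • g j else 0)
      + (if j = m then (-2 * η m * K i j) • g i else 0) := by
    intro i j
    rw [mul_assoc, mul_swap hg j m, mul_add, mul_neg, ← mul_assoc, mul_swap hg i m]
    by_cases h : i = m <;> by_cases h' : j = m <;> simp [h, h', add_mul, smul_smul, mul_comm] <;>
      module
  simp only [q2_apply, Finset.sum_mul, Finset.mul_sum, smul_mul_assoc, mul_smul_comm, ← mul_assoc,
    h1, Finset.sum_add_distrib, Finset.sum_sub_distrib, Finset.sum_ite_eq', Finset.mem_univ,
    if_true]
  have h2 : (∑ i, ∑ j, if i = m then (-2 * η m * K i j) • g j else 0)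
      = ∑ j, (-2 * η m * K m j) • g j := by
    rw [Finset.sum_comm]; simp
  rw [h2, q1_apply, Finset.smul_sum]
  simp only [hK _ m]
  rw [sub_add, ← Finset.sum_sub_distrib, sub_eq_add_neg, ← Finset.sum_neg_distrib]
  congr 1
  exact Finset.sum_congr rfl fun i _ => by module

theorem q3_anticomm {T : ι → ι → ι → ℝ} (h1 : ∀ i j k, T i j k = - T j i k)
    (h2 : ∀ i j k, T i j k = - T i k j) (m : ι) :
    q3 g T * g m = - (g m * q3 g T) - (6 * η m) • q2 g (T m) := by
  have e : ∀ i, g i * (g m * q2 g (T i)) = -(g m * (g i * q2 g (T i)))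
      + (if i = m then (-2 * η m) • q2 g (T m) else 0) := by
    intro i
    rw [← mul_assoc, mul_swap hg i m, add_mul, neg_mul, mul_assoc]
    split_ifs with h
    · subst h; simp
    · simp
  have e2 : ∑ i, g i * q1 g (T i m) = - q2 g (T m) := by
    rw [sum_mul_q1 g (fun i => T i m), ← map_neg]
    congr 1
    funext i j
    simp [h1 i m j]
  rw [q3_eq_sum, Finset.sum_mul]
  simp only [mul_assoc, q2_mul_gen hg (h2 _), mul_add, e, Finset.sum_add_distrib, mul_smul_comm,
    ← Finset.smul_sum, e2, Finset.sum_ite_eq', Finset.mem_univ, if_true, Finset.sum_neg_distrib,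
    ← Finset.mul_sum]
  module

/-- Write the left factor as a sum of triple products and carry `R = q3 g T` leftwards through their
three generators. Each passage changes the sign and leaves a quadratic correction, so three passages
give R² = −R² + corrections. -/
theorem q3_sq {T : ι → ι → ι → ℝ} (h1 : ∀ i j k, T i j k = - T j i k)
    (h2 : ∀ i j k, T i j k = - T i k j) :
    q3 g T * q3 g T = (-9 : ℝ) • ∑ m, η m • (q2 g (T m) * q2 g (T m))
      - (12 * normSq3 η T) • (1 : A) := by
  have hc : ∀ i j k, T i j k = T k i j := fun i j k => by rw [h2, h1, neg_neg]
  have hl : ∀ m, g m * q3 g T = - (q3 g T * g m) - (6 * η m) • q2 g (T m) := fun m => by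
    rw [q3_anticomm hg h1 h2 m]; abel
  set R := q3 g T with hR
  set Q := ∑ m, η m • (q2 g (T m) * q2 g (T m)) with hQ
  have s0 : R * R = -(∑ i, ∑ j, ∑ k, T i j k • (g i * g j * R * g k)) - (6 : ℝ) • Q := by
    rw [show R * R = (∑ i, ∑ j, ∑ k, T i j k • (g i * g j * g k)) * R from
      congrArg (· * R) (q3_apply g T)]
    have e : ∀ i j k, T i j k • (g i * g j * g k * R) = -(T i j k • (g i * g j * R * g k))
        - T i j k • (g i * (g j * (6 * η k) • q2 g (T k))) := fun i j k => by
      rw [mul_assoc _ (g k), hl, mul_sub, mul_neg, smul_sub, smul_neg, ← mul_assoc, ← mul_assoc]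
    simp only [Finset.sum_mul, smul_mul_assoc, e, Finset.sum_sub_distrib, Finset.sum_neg_distrib]
    congr 1
    rw [hQ, Finset.smul_sum]
    calc _ = ∑ i, ∑ k, ∑ j, T i j k • (g i * (g j * (6 * η k) • q2 g (T k))) :=
          Finset.sum_congr rfl fun i _ => Finset.sum_comm
      _ = ∑ k, ∑ i, ∑ j, T i j k • (g i * (g j * (6 * η k) • q2 g (T k))) := Finset.sum_comm
      _ = _ := by
        refine Finset.sum_congr rfl fun k _ => ?_
        rw [show q2 g (T k) * q2 g (T k) = (∑ i, ∑ j, T k i j • (g i * g j)) * q2 g (T k) from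
          congrArg (· * q2 g (T k)) (q2_apply g (T k))]
        simp only [Finset.sum_mul, Finset.smul_sum, smul_mul_assoc, mul_smul_comm, mul_assoc,
          hc _ _ k, smul_smul]
        exact Finset.sum_congr rfl fun i _ => Finset.sum_congr rfl fun j _ => by congr 1; ring
  have s1 : ∑ i, ∑ j, ∑ k, T i j k • (g i * g j * R * g k)
      = -(∑ i, ∑ j, ∑ k, T i j k • (g i * R * g j * g k))
        - (6 : ℝ) • ∑ i, ∑ j, ∑ k, (η j * T i j k) • (g i * q2 g (T j) * g k) := by
    simp only [mul_assoc (g _) (g _) R, hl, mul_sub, sub_mul, smul_sub, mul_neg, neg_mul, smul_neg,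
      Finset.sum_sub_distrib, Finset.sum_neg_distrib, Finset.smul_sum, mul_smul_comm,
      smul_mul_assoc, smul_smul, ← mul_assoc]
    congr 1
    exact Finset.sum_congr rfl fun i _ => Finset.sum_congr rfl fun j _ =>
      Finset.sum_congr rfl fun k _ => by congr 1; ring
  have s2 : ∑ i, ∑ j, ∑ k, T i j k • (g i * R * g j * g k) = -(R * R) - (6 : ℝ) • Q := by
    simp only [hl, sub_mul, smul_sub, neg_mul, smul_neg, Finset.sum_sub_distrib,
      Finset.sum_neg_distrib]
    congr 1
    · congr 1
      rw [show R * R = R * (∑ i, ∑ j, ∑ k, T i j k • (g i * g j * g k)) from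
        congrArg (R * ·) (q3_apply g T)]
      simp only [Finset.mul_sum, mul_smul_comm, mul_assoc]
    · rw [hQ, Finset.smul_sum]
      refine Finset.sum_congr rfl fun i _ => ?_
      conv_rhs => rw [q2_apply g (T i), ← q2_apply g (T i)]
      rw [smul_smul]
      conv_rhs => rw [q2_apply g (T i)]
      rw [← q2_apply g (T i)]
      nth_rw 3 [q2_apply g (T i)]
      simp only [Finset.mul_sum, Finset.smul_sum, mul_smul_comm, smul_mul_assoc, mul_assoc,
        smul_smul]
      exact Finset.sum_congr rfl fun j _ => Finset.sum_congr rfl fun k _ => by congr 1; ring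
  -- The correction of the middle passage has a two-form between two generators; commuting it out
  -- yields one more square and a symmetric two-tensor, the source of the norm term.
  have s3 : ∑ i, ∑ j, ∑ k, (η j * T i j k) • (g i * q2 g (T j) * g k)
      = -Q - (4 * normSq3 η T) • (1 : A) := by
    simp only [mul_assoc, q2_mul_gen hg (h2 _), mul_add, smul_add, Finset.sum_add_distrib]
    rw [sub_eq_add_neg]
    congr 1
    · rw [Finset.sum_comm, hQ, ← Finset.sum_neg_distrib]
      refine Finset.sum_congr rfl fun j _ => ?_
      nth_rw 2 [q2_apply g (T j)]
      simp only [Finset.sum_mul, Finset.smul_sum, smul_mul_assoc, mul_assoc, smul_smul,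
        ← Finset.sum_neg_distrib]
      exact Finset.sum_congr rfl fun i _ => Finset.sum_congr rfl fun k _ => by
        rw [h1 i j k]; module
    · have e1 : ∑ i, ∑ j, ∑ k, (η j * T i j k) • (g i * (4 * η k) • q1 g (T j k))
          = (4 : ℝ) • q2 g (fun i l => ∑ j, ∑ k, η j * η k * (T i j k * T l j k)) := by
        rw [← sum_mul_q1, Finset.smul_sum]
        refine Finset.sum_congr rfl fun i _ => ?_
        have e2 : (fun l => ∑ j, ∑ k, η j * η k * (T i j k * T l j k))
            = ∑ j, ∑ k, (η j * η k * T i j k) • T j k := by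
          funext l
          simp only [Finset.sum_apply, Pi.smul_apply, smul_eq_mul, hc _ _ l, mul_assoc]
        rw [e2]
        simp only [map_sum, map_smul, Finset.mul_sum, Finset.smul_sum, mul_smul_comm, smul_smul]
        exact Finset.sum_congr rfl fun j _ => Finset.sum_congr rfl fun k _ => by congr 1; ring
      rw [e1, q2_symm hg (fun i l => by simp only [mul_comm (T i _ _)]), smul_smul, ← neg_smul]
      congr 1
      rw [normSq3]
      simp only [Finset.mul_sum, mul_neg, ← Finset.sum_neg_distrib]
      exact Finset.sum_congr rfl fun i _ => Finset.sum_congr rfl fun j _ =>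
        Finset.sum_congr rfl fun k _ => by ring
  have h3 : (2 : ℝ) • (R * R) = (2 : ℝ) • ((-9 : ℝ) • Q - (12 * normSq3 η T) • (1 : A)) := by
    rw [s3] at s1
    rw [s1, s2] at s0
    rw [two_smul]
    nth_rw 1 [s0]
    module
  exact smul_right_injective A (two_ne_zero : (2 : ℝ) ≠ 0) h3

end CliffordFrame

/-! ### First-order jets of frames: the scalar identity and the zeroth-order term -/

namespace CliffordFrame

variable {ι : Type*} [Fintype ι] [DecidableEq ι] (η : ι → ℝ)

/-- Full contraction of a three-tensor with the weights `η`. -/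
def tr3 (T : ι → ι → ι → ℝ) : ℝ := ∑ i, ∑ j, ∑ k, η i * η j * η k * T i j k

theorem tr3_swap (T : ι → ι → ι → ℝ) : tr3 η (fun i j k => T j i k) = tr3 η T := by
  unfold tr3
  rw [Finset.sum_comm]
  exact Finset.sum_congr rfl fun i _ => Finset.sum_congr rfl fun j _ =>
    Finset.sum_congr rfl fun k _ => by ring

theorem tr3_swap' (T : ι → ι → ι → ℝ) : tr3 η (fun i j k => T i k j) = tr3 η T := by
  unfold tr3
  refine Finset.sum_congr rfl fun i _ => ?_
  rw [Finset.sum_comm]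
  exact Finset.sum_congr rfl fun j _ => Finset.sum_congr rfl fun k _ => by ring

theorem tr3_rot (T : ι → ι → ι → ℝ) : tr3 η (fun i j k => T j k i) = tr3 η T :=
  (tr3_swap η (fun i j k => T i k j)).trans (tr3_swap' η T)

theorem tr3_rot' (T : ι → ι → ι → ℝ) : tr3 η (fun i j k => T k i j) = tr3 η T := by
  rw [← tr3_rot η T, ← tr3_rot η (fun i j k => T j k i)]

theorem tr3_add (S T : ι → ι → ι → ℝ) :
    tr3 η (fun i j k => S i j k + T i j k) = tr3 η S + tr3 η T := by
  simp only [tr3, mul_add, Finset.sum_add_distrib]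

theorem tr3_smul (r : ℝ) (T : ι → ι → ι → ℝ) :
    tr3 η (fun i j k => r * T i j k) = r * tr3 η T := by
  simp only [tr3, Finset.mul_sum]
  exact Finset.sum_congr rfl fun i _ => Finset.sum_congr rfl fun j _ =>
    Finset.sum_congr rfl fun k _ => by ring

theorem tr3_congr {S T : ι → ι → ι → ℝ} (h : ∀ i j k, S i j k = T i j k) : tr3 η S = tr3 η T := by
  rw [show S = T from funext fun i => funext fun j => funext fun k => h i j k]

/-- The structure functions and their first derivatives at a point, in an orthonormal frame. -/
structure FrameJet (η : ι → ℝ) where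
  /-- `⟨[eᵢ, eⱼ], eₖ⟩` -/
  F : ι → ι → ι → ℝ
  /-- `⟨[fᵢ, eⱼ], eₖ⟩` -/
  B : ι → ι → ι → ℝ
  /-- derivatives of `F` -/
  dF : ι → ι → ι → ι → ℝ
  /-- derivatives of `B` -/
  dB : ι → ι → ι → ι → ℝ
  F_left : ∀ i j k, F i j k = - F j i k
  F_right : ∀ i j k, F i j k = - F i k j
  B_right : ∀ i j k, B i j k = - B i k j
  dF_left : ∀ m i j k, dF m i j k = - dF m j i k
  dF_right : ∀ m i j k, dF m i j k = - dF m i k j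
  dB_right : ∀ m i j k, dB m i j k = - dB m i k j
  jac4 : ∀ i j k l, dF i j k l - dF j i k l + dF k i j l - dF l i j k =
    ∑ n, η n * ((F j k n * F i l n - B n j k * B n i l) - (F i k n * F j l n - B n i k * B n j l)
      + (F i j n * F k l n - B n i j * B n k l))
  jac3 : ∀ m i j k, dF m i j k - dB i m j k + dB j m i k - dB k m i j =
    ∑ n, η n * ((F i j n * B m k n + B n i j * (B m n k + B n k m - F k m n))
      - (F i k n * B m j n + B n i k * (B m n j + B n j m - F j m n))
      + (F j k n * B m i n + B n j k * (B m n i + B n i m - F i m n)))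

namespace FrameJet

variable {η} (J : FrameJet η)

/-- The trace of `B`. -/
def d (j : ι) : ℝ := ∑ i, η i * J.B i j i

/-- The derivative of the trace of `B`. -/
def dd (l j : ι) : ℝ := ∑ i, η i * J.dB l i j i

/-- The components of the torsion. -/
def H (i j k : ι) : ℝ := J.B i j k + J.B j k i + J.B k i j - J.F i j k

theorem F_cyc (i j k : ι) : J.F i j k = J.F j k i := by
  rw [J.F_left, J.F_right, neg_neg]

/-- F is totally antisymmetric, hence cyclic, so relabelling the summation indices collects the
expanded square into four contractions. -/
theorem tr3_H_sq : tr3 η (fun i j k => J.H i j k * J.H i j k)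
    = 3 * tr3 η (fun i j k => J.B i j k * J.B i j k)
      + 6 * tr3 η (fun i j k => J.B i j k * J.B j k i)
      - 6 * tr3 η (fun i j k => J.B i j k * J.F i j k)
      + tr3 η (fun i j k => J.F i j k * J.F i j k) := by
  have e1 := tr3_rot η (fun i j k => J.B i j k * J.B i j k)
  have e2 := tr3_rot' η (fun i j k => J.B i j k * J.B i j k)
  have e3 := tr3_rot η (fun i j k => J.B i j k * J.B j k i)
  have e4 := tr3_rot' η (fun i j k => J.B i j k * J.B j k i)
  have e5 := tr3_rot η (fun i j k => J.B i j k * J.F i j k)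
  have e6 := tr3_rot' η (fun i j k => J.B i j k * J.F i j k)
  have h : tr3 η (fun i j k => J.H i j k * J.H i j k)
      = tr3 η (fun i j k => J.B i j k * J.B i j k + (J.B j k i * J.B j k i + (J.B k i j * J.B k i j
        + (2 * (J.B i j k * J.B j k i) + (2 * (J.B j k i * J.B k i j) + (2 * (J.B k i j * J.B i j k)
        + ((-2) * (J.B i j k * J.F i j k) + ((-2) * (J.B j k i * J.F j k i)
        + ((-2) * (J.B k i j * J.F k i j) + J.F i j k * J.F i j k))))))))) :=
    tr3_congr η fun i j k => by
      rw [H, J.F_cyc k i j, ← J.F_cyc i j k]; ring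
  simp only [tr3_add, tr3_smul] at h
  linarith

theorem sum_B_self (n : ι) : ∑ i, η i * J.B i i n = - J.d n := by
  simp only [d, J.B_right _ _ n, mul_neg, Finset.sum_neg_distrib]

/-- The Ricci trace and |H|² contain the same mixed contraction of B_ijk B_jki − B_ijk F_ijk.
Eliminating it expresses the left side as a quarter of the Ricci trace plus |H|²/24; this fixes the
coefficients 1/24 and 1/8. -/
theorem scalar_identity (hH : tr3 η (fun i j k => J.H i j k * J.H i j k) = 0)
    (hR : ∑ k, ∑ i, η k * (η i * (J.dB i k k i - J.dB k i k i + ∑ n, η n *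
      (- J.B k k n * J.B i i n + (J.B i k n - (1 / 3) * J.H i k n) * J.B k i n
        + J.B k i n * (J.B n k i - (1 / 3) * J.H n k i)
        + (J.B k n i + J.B n i k - J.F i k n) * J.B n k i))) = 0) :
    normSq3 η J.F / 24 - normSq3 η J.B / 8 - (1 / 2) * ∑ i, η i * J.dd i i
      - (1 / 4) * ∑ i, η i * (J.d i * J.d i) = 0 := by
  have h1 : ∑ k, ∑ i, η k * (η i * J.dB i k k i) = - ∑ i, η i * J.dd i i := by
    rw [Finset.sum_comm, ← Finset.sum_neg_distrib]
    simp only [dd, Finset.mul_sum, ← Finset.sum_neg_distrib]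
    exact Finset.sum_congr rfl fun i _ => Finset.sum_congr rfl fun k _ => by
      rw [J.dB_right i k k i]; ring
  have h2 : ∑ k, ∑ i, η k * (η i * J.dB k i k i) = ∑ i, η i * J.dd i i := by
    simp only [dd, Finset.mul_sum]
  have h3 : ∑ k, ∑ i, ∑ n, η k * (η i * (η n * (J.B k k n * J.B i i n)))
      = ∑ n, η n * (J.d n * J.d n) := by
    have e : ∀ n, J.d n * J.d n = ∑ k, ∑ i, (η k * J.B k k n) * (η i * J.B i i n) := fun n => by
      rw [← Finset.sum_mul_sum, sum_B_self]; ring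
    simp only [e, Finset.mul_sum]
    calc _ = ∑ k, ∑ n, ∑ i, η k * (η i * (η n * (J.B k k n * J.B i i n))) :=
          Finset.sum_congr rfl fun k _ => Finset.sum_comm
      _ = ∑ n, ∑ k, ∑ i, η k * (η i * (η n * (J.B k k n * J.B i i n))) := Finset.sum_comm
      _ = _ := Finset.sum_congr rfl fun n _ => Finset.sum_congr rfl fun k _ =>
          Finset.sum_congr rfl fun i _ => by ring
  have e3 := tr3_rot η (fun i j k => J.B i j k * J.B j k i)
  have e4 := tr3_rot' η (fun i j k => J.B i j k * J.B j k i)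
  have e5 := tr3_rot η (fun i j k => J.B i j k * J.F i j k)
  have e6 := tr3_rot' η (fun i j k => J.B i j k * J.F i j k)
  have e7 := tr3_rot η (fun i j k => J.B i j k * J.B i j k)
  have e8 := tr3_rot' η (fun i j k => J.B i j k * J.B i j k)
  have h4 : ∑ k, ∑ i, ∑ n, η k * (η i * (η n *
      ((J.B i k n - (1 / 3) * J.H i k n) * J.B k i n
        + J.B k i n * (J.B n k i - (1 / 3) * J.H n k i)
        + (J.B k n i + J.B n i k - J.F i k n) * J.B n k i)))
      = - tr3 η (fun i j k => J.B i j k * J.B i j k) - tr3 η (fun i j k => J.B i j k * J.B j k i)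
        + tr3 η (fun i j k => J.B i j k * J.F i j k) := by
    have h : tr3 η (fun k i n => (J.B i k n - (1 / 3) * J.H i k n) * J.B k i n
        + J.B k i n * (J.B n k i - (1 / 3) * J.H n k i)
        + (J.B k n i + J.B n i k - J.F i k n) * J.B n k i)
        = tr3 η (fun k i n => (-1) * (J.B k i n * J.B i n k) + ((-1) * (J.B n k i * J.B n k i)
          + J.B n k i * J.F n k i)) :=
      tr3_congr η fun k i n => by
        simp only [H]
        rw [J.B_right i k n, J.B_right n i k, J.B_right k n i, J.F_left i k n, J.F_cyc n k i]; ring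
    have h0 : ∀ T : ι → ι → ι → ℝ, ∑ k, ∑ i, ∑ n, η k * (η i * (η n * T k i n)) = tr3 η T :=
      fun T => by simp only [tr3, mul_assoc]
    rw [h0 fun k i n => _, h]
    simp only [tr3_add, tr3_smul]
    rw [e8, e6]
    ring
  have h5 := J.tr3_H_sq
  rw [hH] at h5
  have h6 : - ∑ i, η i * J.dd i i - ∑ i, η i * J.dd i i - ∑ n, η n * (J.d n * J.d n)
      + (- tr3 η (fun i j k => J.B i j k * J.B i j k) - tr3 η (fun i j k => J.B i j k * J.B j k i)
        + tr3 η (fun i j k => J.B i j k * J.F i j k)) = 0 := by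
    rw [← h4, ← h3]
    nth_rw 1 [← h1]
    rw [← h2, ← hR]
    simp only [← Finset.sum_sub_distrib, ← Finset.sum_add_distrib, ← Finset.mul_sum]
    refine Finset.sum_congr rfl fun k _ => ?_
    rw [← mul_sub, ← mul_sub, ← mul_add, ← Finset.sum_sub_distrib, ← Finset.sum_sub_distrib,
      ← Finset.sum_add_distrib]
    congr 1
    refine Finset.sum_congr rfl fun i _ => ?_
    rw [← mul_sub, ← mul_sub, ← mul_add]
    congr 1
    rw [sub_add, ← Finset.sum_sub_distrib, sub_eq_add_neg, ← Finset.sum_neg_distrib]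
    congr 1
    exact Finset.sum_congr rfl fun n _ => by ring
  have h7 : normSq3 η J.F = tr3 η (fun i j k => J.F i j k * J.F i j k) := rfl
  have h8 : normSq3 η J.B = tr3 η (fun i j k => J.B i j k * J.B i j k) := rfl
  rw [h7, h8]
  linarith

/-- The contraction of the mixed Jacobi identity. -/
theorem contracted_jac3 (j k : ι) :
    ∑ i, η i * J.dF i i j k = ∑ i, η i * J.dB i i j k + J.dd j k - J.dd k j
      - ∑ n, η n * (J.d n * J.F n j k) + ∑ n, η n * (J.d n * J.B n j k) := by
  have h1 : ∑ i, η i * (J.dF i i j k - J.dB i i j k + J.dB j i i k - J.dB k i i j)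
      = ∑ i, η i * J.dF i i j k - ∑ i, η i * J.dB i i j k - J.dd j k + J.dd k j := by
    simp only [dd, ← Finset.sum_sub_distrib, ← Finset.sum_add_distrib]
    exact Finset.sum_congr rfl fun i _ => by
      rw [J.dB_right j i i k, J.dB_right k i i j]; ring
  have hF : ∀ i n, J.F i i n = 0 := fun i n => by linarith [J.F_left i i n]
  have hB : ∀ i n, J.B n i i = 0 := fun i n => by linarith [J.B_right n i i]
  -- Apart from the terms contracting to `d`, the quadratic right side is antisymmetric in the
  -- summation indices and sums to zero.
  have hanti : ∀ G : ι → ι → ℝ, ∑ i, ∑ n, η i * η n * (G i n - G n i) = 0 := fun G => by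
    simp only [mul_sub, Finset.sum_sub_distrib]
    rw [sub_eq_zero, Finset.sum_comm]
    exact Finset.sum_congr rfl fun i _ => Finset.sum_congr rfl fun n _ => by ring
  have h2 := hanti fun i n => J.B n i j * J.B i n k + J.F i j n * J.B i k n - J.F i k n * J.B i j n
  have h3 : ∑ n, ∑ i, η n * η i * ((J.F n j k - J.B n j k) * J.B i i n)
      = - ∑ n, η n * (J.d n * J.F n j k) + ∑ n, η n * (J.d n * J.B n j k) := by
    rw [← Finset.sum_neg_distrib, ← Finset.sum_add_distrib]
    refine Finset.sum_congr rfl fun n _ => ?_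
    have e : J.d n = - ∑ i, η i * J.B i i n := by rw [sum_B_self]; ring
    rw [e]
    simp only [neg_mul, Finset.sum_mul, Finset.mul_sum, mul_neg, neg_neg]
    rw [← sub_eq_add_neg, ← Finset.sum_sub_distrib]
    exact Finset.sum_congr rfl fun i _ => by ring
  have h4 : ∑ i, η i * (J.dF i i j k - J.dB i i j k + J.dB j i i k - J.dB k i i j)
      = - ∑ n, η n * (J.d n * J.F n j k) + ∑ n, η n * (J.d n * J.B n j k) := by
    rw [← h3, Finset.sum_comm, ← zero_add (∑ i, ∑ n, _), ← h2, ← Finset.sum_add_distrib]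
    refine Finset.sum_congr rfl fun i _ => ?_
    rw [J.jac3, Finset.mul_sum, ← Finset.sum_add_distrib]
    refine Finset.sum_congr rfl fun n _ => ?_
    rw [hF, hB, J.B_right i n i, J.B_right n i k, J.B_right n i j, ← J.F_cyc n j k,
      ← J.F_cyc n j i, ← J.F_cyc n k i]
    ring
  linarith

variable {A : Type*} [Ring A] [Algebra ℝ A] {g : ι → A}
  (hg : ∀ i j, g i * g j + g j * g i = (if i = j then -2 * η i else 0) • (1 : A))
include hg

/-- Contract the Jacobi identity `jac4` with gᵢgⱼgₖgₗ. Its four derivative terms are related by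
neighbouring transpositions, each costing a sign and a contraction, and combine to 4 `q4 g dF` plus
12 times the divergence of F; the right side is the difference of two sums treated by
`q4_sym_square`. -/
theorem q4_dF : q4 g J.dF = (-3 : ℝ) • q2 g (fun j k => ∑ i, η i * J.dF i i j k)
    + (3 / 4 : ℝ) • (∑ m, η m • (q2 g (J.F m) * q2 g (J.F m))
        - ∑ m, η m • (q2 g (J.B m) * q2 g (J.B m)))
    + (3 / 2 * (normSq3 η J.F - normSq3 η J.B)) • (1 : A) := by
  set φ : ι → ι → ℝ := fun j k => ∑ i, η i * J.dF i i j k with hφ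
  have e1 := q4_swap12 hg J.dF
  have e2 := q4_swap23 hg (fun i j k l => J.dF j i k l)
  have e3 := q4_swap34 hg (fun i j k l => J.dF k i j l)
  have e2' : (fun i l => ∑ j, η j * J.dF j i j l) = - φ := by
    funext i l
    simp only [hφ, Pi.neg_apply, ← Finset.sum_neg_distrib]
    exact Finset.sum_congr rfl fun j _ => by rw [J.dF_left]; ring
  have e3' : (fun i j => ∑ k, η k * J.dF k i j k) = φ := by
    funext i j
    exact Finset.sum_congr rfl fun k _ => by rw [J.dF_right, J.dF_left, neg_neg]
  rw [e2', map_neg] at e2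
  rw [e3'] at e3
  have hjac : (fun i j k l => J.dF i j k l) - (fun i j k l => J.dF j i k l)
      + (fun i j k l => J.dF k i j l) - (fun i j k l => J.dF l i j k)
      = (fun i j k l => ∑ m, η m * (J.F m j k * J.F m i l - J.F m i k * J.F m j l
          + J.F m i j * J.F m k l))
        - (fun i j k l => ∑ m, η m * (J.B m j k * J.B m i l - J.B m i k * J.B m j l
          + J.B m i j * J.B m k l)) := by
    funext i j k l
    simp only [Pi.sub_apply, Pi.add_apply, J.jac4, ← Finset.sum_sub_distrib]
    exact Finset.sum_congr rfl fun m _ => by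
      simp only [J.F_cyc m]; ring
  have h1 := congrArg (q4 g) hjac
  have h2 := q4_sym_square hg η (K := J.F) J.F_right
  have h3 := q4_sym_square hg η (K := J.B) J.B_right
  simp only [map_sub, map_add] at h1
  rw [h2, h3] at h1
  have hN : ∀ T : ι → ι → ι → ℝ, ∑ m, ∑ i, ∑ j, η m * η i * η j * (T m i j * T m i j)
      = normSq3 η T := fun T => rfl
  rw [hN, hN] at h1
  have e0 : (fun i j k l => J.dF i j k l) = J.dF := rfl
  rw [e0] at h1
  set a := q4 g J.dF
  set b := q4 g fun i j k l => J.dF j i k l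
  set c := q4 g fun i j k l => J.dF k i j l
  set d := q4 g fun i j k l => J.dF l i j k
  have hb : b = - a - (2 : ℝ) • q2 g φ := by rw [e1]; abel
  have hc : c = - b + (2 : ℝ) • q2 g φ := by rw [e2, smul_neg]; abel
  have hd : d = - c - (2 : ℝ) • q2 g φ := by rw [e3]; abel
  rw [hd, hc, hb] at h1
  have h4 : (4 : ℝ) • a = (4 : ℝ) • ((-3 : ℝ) • q2 g φ
      + (3 / 4 : ℝ) • (∑ m, η m • (q2 g (J.F m) * q2 g (J.F m))
        - ∑ m, η m • (q2 g (J.B m) * q2 g (J.B m)))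
      + (3 / 2 * (normSq3 η J.F - normSq3 η J.B)) • (1 : A)) := by
    rw [← sub_eq_zero] at h1 ⊢
    rw [← h1]
    module
  exact smul_right_injective A (four_ne_zero : (4 : ℝ) ≠ 0) h4

theorem q3_F_anticomm_q1_d : q3 g J.F * q1 g J.d + q1 g J.d * q3 g J.F
    = (-6 : ℝ) • q2 g (fun j k => ∑ n, η n * (J.d n * J.F n j k)) := by
  have e : (fun j k => ∑ n, η n * (J.d n * J.F n j k)) = ∑ n, (η n * J.d n) • J.F n := by
    funext j k; simp [Finset.sum_apply, mul_assoc]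
  rw [e, map_sum, q1_apply, Finset.mul_sum, Finset.sum_mul, ← Finset.sum_add_distrib,
    Finset.smul_sum]
  refine Finset.sum_congr rfl fun n _ => ?_
  rw [mul_smul_comm, q3_anticomm hg J.F_left J.F_right, smul_mul_assoc, map_smul]
  module

/-- The squares of `q2 g (J.F m)` cancel between `q4_dF` and `q3_sq`, those of `q2 g (J.B m)`
between `q4_dF` and the Laplacian. The remaining two-forms cancel by `contracted_jac3`. The left
side is thus always the scalar of `hS` times 1: for instance 1/24 = (1/12)(3/2) − 12/144. -/
theorem zeroth_order (hS : normSq3 η J.F / 24 - normSq3 η J.B / 8 - (1 / 2) * ∑ i, η i * J.dd i i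
      - (1 / 4) * ∑ i, η i * (J.d i * J.d i) = 0) {P : A}
    (hP : P = (1 / 12 : ℝ) • q3 g J.F + (1 / 2 : ℝ) • q1 g J.d) :
    ∑ l, g l * ((1 / 12 : ℝ) • q3 g (J.dF l) + (1 / 2 : ℝ) • q1 g (J.dd l)) + P * P
      + ∑ j, η j • ((1 / 4 : ℝ) • q2 g (J.dB j j)
          + ((1 / 4 : ℝ) • q2 g (J.B j)) * ((1 / 4 : ℝ) • q2 g (J.B j)))
      + ∑ m, (η m * J.d m) • ((1 / 4 : ℝ) • q2 g (J.B m)) = 0 := by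
  have t1 : ∑ l, g l * ((1 / 12 : ℝ) • q3 g (J.dF l) + (1 / 2 : ℝ) • q1 g (J.dd l))
      = (1 / 12 : ℝ) • q4 g J.dF + (1 / 2 : ℝ) • q2 g J.dd := by
    rw [← sum_mul_q3, ← sum_mul_q1, Finset.smul_sum, Finset.smul_sum, ← Finset.sum_add_distrib]
    exact Finset.sum_congr rfl fun l _ => by rw [mul_add, mul_smul_comm, mul_smul_comm]
  have t2 : P * P = (1 / 144 : ℝ) • (q3 g J.F * q3 g J.F)
      + (1 / 24 : ℝ) • (q3 g J.F * q1 g J.d + q1 g J.d * q3 g J.F)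
      + (1 / 4 : ℝ) • (q1 g J.d * q1 g J.d) := by
    rw [hP]
    simp only [add_mul, mul_add, smul_mul_smul_comm]
    module
  have t3 : ∑ j, η j • ((1 / 4 : ℝ) • q2 g (J.dB j j)
        + ((1 / 4 : ℝ) • q2 g (J.B j)) * ((1 / 4 : ℝ) • q2 g (J.B j)))
      = (1 / 4 : ℝ) • q2 g (fun j k => ∑ i, η i * J.dB i i j k)
        + (1 / 16 : ℝ) • ∑ m, η m • (q2 g (J.B m) * q2 g (J.B m)) := by
    have e : (fun j k => ∑ i, η i * J.dB i i j k) = ∑ i, η i • J.dB i i := by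
      funext j k; simp [Finset.sum_apply]
    rw [e, map_sum, Finset.smul_sum, Finset.smul_sum, ← Finset.sum_add_distrib]
    refine Finset.sum_congr rfl fun j _ => ?_
    rw [map_smul, smul_mul_smul_comm]
    module
  have t4 : ∑ m, (η m * J.d m) • ((1 / 4 : ℝ) • q2 g (J.B m))
      = (1 / 4 : ℝ) • q2 g (fun j k => ∑ n, η n * (J.d n * J.B n j k)) := by
    have e : (fun j k => ∑ n, η n * (J.d n * J.B n j k)) = ∑ n, (η n * J.d n) • J.B n := by
      funext j k; simp [Finset.sum_apply, mul_assoc]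
    rw [e, map_sum, Finset.smul_sum]
    exact Finset.sum_congr rfl fun m _ => by rw [map_smul]; module
  have t5 : (2 : ℝ) • q2 g J.dd = q2 g J.dd - q2 g (fun i j => J.dd j i)
      - (2 * ∑ i, η i * J.dd i i) • (1 : A) := by
    rw [two_smul]; nth_rw 2 [q2_swap hg J.dd]; abel
  have t6 : q1 g J.d * q1 g J.d = - (∑ i, η i * (J.d i * J.d i)) • (1 : A) := by
    rw [q1_mul_q1, q2_symm hg fun i j => mul_comm _ _]
  have t7 : q2 g (fun j k => ∑ i, η i * J.dF i i j k)
      = q2 g (fun j k => ∑ i, η i * J.dB i i j k) + q2 g J.dd - q2 g (fun i j => J.dd j i)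
        - q2 g (fun j k => ∑ n, η n * (J.d n * J.F n j k))
        + q2 g (fun j k => ∑ n, η n * (J.d n * J.B n j k)) := by
    rw [← map_add, ← map_sub, ← map_sub, ← map_add]
    congr 1
    funext j k
    exact J.contracted_jac3 j k
  have t8 : (1 / 2 : ℝ) • q2 g J.dd = (1 / 4 : ℝ) • ((2 : ℝ) • q2 g J.dd) := by module
  rw [t1, t2, t3, t4, t8, t5, t6, J.q4_dF hg, t7, q3_sq hg J.F_left J.F_right,
    J.q3_F_anticomm_q1_d hg]
  have hS' : (normSq3 η J.F / 24 - normSq3 η J.B / 8 - (1 / 2) * ∑ i, η i * J.dd i i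
      - (1 / 4) * ∑ i, η i * (J.d i * J.d i)) • (1 : A) = 0 := by rw [hS, zero_smul]
  rw [← hS']
  module

end FrameJet

end CliffordFrame

/-! ### The Lichnerowicz formula at a point -/

namespace CliffordFrame

section

variable {ι : Type*} [Fintype ι] [DecidableEq ι] {η : ι → ℝ} {A : Type*} [Ring A] [Algebra ℝ A]
  {g : ι → A} (hg : ∀ i j, g i * g j + g j * g i = (if i = j then -2 * η i else 0) • (1 : A))
include hg

theorem q3_swap12 (T : ι → ι → ι → ℝ) : q3 g T = - q3 g (fun i j k => T j i k)
    - (2 : ℝ) • q1 g (fun k => ∑ i, η i * T i i k) := by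
  have e : ∀ T : ι → ι → ι → ℝ, q3 g T = ∑ k, q2 g (fun i j => T i j k) * g k := fun T => by
    simp only [q3_apply, q2_apply, Finset.sum_mul, smul_mul_assoc]
    calc _ = ∑ i, ∑ k, ∑ j, T i j k • (g i * g j * g k) :=
          Finset.sum_congr rfl fun i _ => Finset.sum_comm
      _ = _ := Finset.sum_comm
  rw [e, e (fun i j k => T j i k), q1_apply, Finset.smul_sum, ← Finset.sum_neg_distrib,
    ← Finset.sum_sub_distrib]
  refine Finset.sum_congr rfl fun k _ => ?_
  rw [q2_swap hg, sub_mul, neg_mul, smul_mul_assoc, one_mul, mul_smul]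

/-- The cubic Clifford element of a connection form in terms of its totally antisymmetric part and
its trace. -/
theorem q3_connection {W : ι → ι → ι → ℝ} (hW : ∀ i j k, W i j k = - W i k j) :
    q3 g W = (1 / 3 : ℝ) • q3 g (fun i j k => W i j k + W j k i + W k i j)
      + (2 : ℝ) • q1 g (fun k => ∑ i, η i * W i k i) := by
  have h1 : q3 g (fun i j k => W k i j) = q3 g W - (4 : ℝ) • q1 g (fun k => ∑ i, η i * W i k i) := by
    have e : (fun k => ∑ i, η i * W i k i) = - ∑ i, η i • W i i := by
      funext k
      simp [Finset.sum_apply, hW _ k]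
    have e2 : q3 g (fun i j k => W k i j) = ∑ k, q2 g (W k) * g k := by
      simp only [q3_apply, q2_apply, Finset.sum_mul, smul_mul_assoc]
      calc _ = ∑ i, ∑ k, ∑ j, W k i j • (g i * g j * g k) :=
            Finset.sum_congr rfl fun i _ => Finset.sum_comm
        _ = _ := Finset.sum_comm
    rw [e2, q3_eq_sum, e, map_neg, map_sum, smul_neg, sub_neg_eq_add, Finset.smul_sum,
      ← Finset.sum_add_distrib]
    refine Finset.sum_congr rfl fun k _ => ?_
    rw [q2_mul_gen hg (hW k), map_smul, smul_smul]
  have h2 : q3 g (fun i j k => W j k i) = q3 g W - (2 : ℝ) • q1 g (fun k => ∑ i, η i * W i k i) := by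
    rw [q3_swap12 hg]
    have e : (fun i j k => W i k j) = - W := by
      funext i j k; rw [hW]; rfl
    rw [e, map_neg, neg_neg]
  have h3 : (fun i j k => W i j k + W j k i + W k i j)
      = W + (fun i j k => W j k i) + (fun i j k => W k i j) := rfl
  rw [h3, map_add, map_add, h1, h2]
  module

end

namespace FrameJet

variable {ι : Type*} [Fintype ι] [DecidableEq ι] {η : ι → ℝ} (J : FrameJet η)
  {S : Type*} [AddCommGroup S] [Module ℝ S] {g : ι → Module.End ℝ S}
  (hg : ∀ i j, g i * g j + g j * g i
    = (if i = j then -2 * η i else 0) • (1 : Module.End ℝ S))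

/-- The cyclic sum of B − H/3 is B_ijk + B_jki + B_kij − H_ijk = F_ijk, and H has no trace. So the
correction by a third of the torsion leaves only F and `d` in the Dirac operator. -/
theorem q3_connection_eq {A : Type*} [Ring A] [Algebra ℝ A] {g : ι → A}
    (hg : ∀ i j, g i * g j + g j * g i = (if i = j then -2 * η i else 0) • (1 : A)) :
    (1 / 4 : ℝ) • q3 g (fun i j k => J.B i j k - (1 / 3) * J.H i j k)
      = (1 / 12 : ℝ) • q3 g J.F + (1 / 2 : ℝ) • q1 g J.d := by
  have hH : ∀ i j k, J.H i j k = - J.H i k j := fun i j k => by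
    simp only [H]
    rw [J.B_right i j k, J.B_right j k i, J.B_right k i j, J.F_right i j k]; ring
  rw [q3_connection hg fun i j k => by rw [hH, J.B_right]; ring]
  have e1 : (fun i j k => J.B i j k - (1 / 3) * J.H i j k + (J.B j k i - (1 / 3) * J.H j k i)
      + (J.B k i j - (1 / 3) * J.H k i j)) = J.F := by
    funext i j k
    simp only [H]
    rw [J.F_cyc k i j, ← J.F_cyc i j k]; ring
  have e2 : (fun k => ∑ i, η i * (J.B i k i - (1 / 3) * J.H i k i)) = J.d := by
    funext k
    refine Finset.sum_congr rfl fun i _ => ?_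
    simp only [H]
    have h1 : J.B k i i = 0 := by linarith [J.B_right k i i]
    have h2 : J.F i k i = 0 := by
      rw [J.F_right]; linarith [J.F_left i i k]
    rw [h1, h2, J.B_right i i k]; ring
  rw [e1, e2]
  module

include hg

/-- The Lichnerowicz formula at a point. -/
theorem lichnerowicz (hS : normSq3 η J.F / 24 - normSq3 η J.B / 8
      - (1 / 2) * ∑ i, η i * J.dd i i - (1 / 4) * ∑ i, η i * (J.d i * J.d i) = 0)
    {P : Module.End ℝ S} (hP : P = (1 / 12 : ℝ) • q3 g J.F + (1 / 2 : ℝ) • q1 g J.d)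
    (ε : S) (ε1 : ι → S) (ε2 : ι → ι → S)
    (hε : ∀ i l, ε2 i l - ε2 l i = ∑ m, (η m * (J.F i l m - J.B m i l)) • ε1 m) :
    ∑ i, g i (∑ l, g l (ε2 i l) + (((1 / 12 : ℝ) • q3 g (J.dF i) + (1 / 2 : ℝ) • q1 g (J.dd i)) ε
        + P (ε1 i))) + P (∑ l, g l (ε1 l) + P ε)
      + ∑ j, η j • (ε2 j j + ((1 / 4 : ℝ) • q2 g (J.dB j j)) ε + ((1 / 4 : ℝ) • q2 g (J.B j)) (ε1 j)
          + ((1 / 4 : ℝ) • q2 g (J.B j)) (ε1 j + ((1 / 4 : ℝ) • q2 g (J.B j)) ε))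
      + ∑ m, (η m * J.d m) • (ε1 m + ((1 / 4 : ℝ) • q2 g (J.B m)) ε) = 0 := by
  have z := LinearMap.congr_fun (J.zeroth_order hg hS hP) ε
  -- The symmetric part of the second derivatives contracts to minus the trace, cancelling the
  -- leading term of the Laplacian; the antisymmetric part is a commutator, of first order in ε.
  have h1 : ∑ i, ∑ l, (g i * g l) (ε2 i l)
      = (1 / 2 : ℝ) • ∑ m, η m • (q2 g (J.F m) (ε1 m) - q2 g (J.B m) (ε1 m))
        - ∑ i, η i • ε2 i i := by
    have a1 : ∑ i, ∑ l, (g i * g l) (ε2 i l - ε2 l i)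
        = ∑ m, η m • (q2 g (J.F m) (ε1 m) - q2 g (J.B m) (ε1 m)) := by
      simp only [hε, map_sum, map_smul]
      calc _ = ∑ i, ∑ m, ∑ l, (η m * (J.F i l m - J.B m i l)) • (g i * g l) (ε1 m) :=
            Finset.sum_congr rfl fun i _ => Finset.sum_comm
        _ = ∑ m, ∑ i, ∑ l, (η m * (J.F i l m - J.B m i l)) • (g i * g l) (ε1 m) := Finset.sum_comm
        _ = _ := by
          refine Finset.sum_congr rfl fun m _ => ?_
          simp only [q2_apply, LinearMap.sum_apply, LinearMap.smul_apply, Finset.smul_sum,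
            ← Finset.sum_sub_distrib]
          exact Finset.sum_congr rfl fun i _ => Finset.sum_congr rfl fun l _ => by
            rw [J.F_cyc m i l]; module
    have a2 : ∑ i, ∑ l, (g i * g l) (ε2 l i)
        = - ∑ i, ∑ l, (g i * g l) (ε2 i l) - (2 : ℝ) • ∑ i, η i • ε2 i i := by
      have b : ∀ i l, (g i * g l) (ε2 l i) = - (g l * g i) (ε2 l i)
          + if i = l then (-2 * η i) • ε2 i i else 0 := fun i l => by
        rw [mul_swap hg i l]
        split_ifs with h
        · subst h; simp
        · simp
      simp only [b, Finset.sum_add_distrib, Finset.sum_ite_eq, Finset.mem_univ, if_true,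
        Finset.sum_neg_distrib]
      rw [Finset.sum_comm, Finset.smul_sum, sub_eq_add_neg]
      congr 1
      rw [← Finset.sum_neg_distrib]
      exact Finset.sum_congr rfl fun i _ => by module
    simp only [map_sub, Finset.sum_sub_distrib] at a1
    rw [← a1, a2]
    module
  -- Anticommuting the cubic term past a generator produces the `q2 g (J.F m)` that cancels the
  -- commutator term, and the `d m` that cancels the first-order term of the Laplacian.
  have h2 : ∀ m, g m (P (ε1 m)) + P (g m (ε1 m))
      = - ((1 / 2 : ℝ) • η m • q2 g (J.F m) (ε1 m)) - (η m * J.d m) • ε1 m := fun m => by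
    have a1 := LinearMap.congr_fun (q3_anticomm hg J.F_left J.F_right m) (ε1 m)
    have a2 := LinearMap.congr_fun (q1_anticomm hg J.d m) (ε1 m)
    simp only [LinearMap.add_apply, LinearMap.sub_apply, LinearMap.neg_apply, LinearMap.smul_apply,
      Module.End.mul_apply, Module.End.one_apply] at a1 a2
    rw [← sub_eq_zero] at a1 a2
    rw [hP]
    simp only [LinearMap.add_apply, LinearMap.smul_apply, map_add, map_smul]
    rw [← sub_eq_zero]
    trans (1 / 12 : ℝ) • (0 : S) + (1 / 2 : ℝ) • (0 : S)
    · nth_rw 1 [← a1]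
      rw [← a2]
      module
    · simp
  have h3 := Finset.sum_congr (rfl : Finset.univ = Finset.univ) fun m (_ : m ∈ Finset.univ) => h2 m
  simp only [LinearMap.add_apply, LinearMap.sum_apply, LinearMap.smul_apply, LinearMap.zero_apply,
    Module.End.mul_apply, map_add, map_smul, map_sum, smul_add, Finset.smul_sum,
    Finset.sum_add_distrib, Finset.sum_sub_distrib, smul_sub, Finset.sum_neg_distrib]
    at z h1 h3 ⊢
  rw [h1]
  rw [← sub_eq_zero] at h3
  have h4 : ∑ x, η x • (1 / 4 : ℝ) • q2 g (J.B x) (ε1 x)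
      = (1 / 4 : ℝ) • ∑ x, η x • q2 g (J.B x) (ε1 x) := by
    rw [Finset.smul_sum]; exact Finset.sum_congr rfl fun x _ => by module
  have h5 : ∑ x, (1 / 2 : ℝ) • η x • q2 g (J.B x) (ε1 x)
      = (1 / 2 : ℝ) • ∑ x, η x • q2 g (J.B x) (ε1 x) := by rw [Finset.smul_sum]
  rw [h4, h5]
  trans (0 : S) + 0
  · nth_rw 1 [← z]
    rw [← h3]
    module
  · simp

end FrameJet

end CliffordFrame

/-! ### The jet of a frame, and locality of the connection -/

namespace CourantAlgebroid.GeneralizedMetric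

section SpinFrame

variable {M : Type*} [TopologicalSpace M] [ChartedSpace (EuclideanSpace ℝ (Fin 6)) M] [IsManifold (𝓡 6) ∞ M]
  {F : Type*} [NormedAddCommGroup F] [NormedSpace ℝ F]
  {E : M → Type*} [TopologicalSpace (TotalSpace F E)]
  [∀ x, AddCommGroup (E x)] [∀ x, Module ℝ (E x)] [∀ x, TopologicalSpace (E x)] [FiberBundle F E]
  [VectorBundle ℝ F E] [T2Space M] [ContMDiffVectorBundle ∞ F E (𝓡 6)]
  {C : CourantAlgebroid 6 F E} {V : C.GeneralizedMetric}

theorem _root_.CourantAlgebroid.der_neg_fun {S : Type*} [NormedAddCommGroup S] [NormedSpace ℝ S]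
    (a : C.Sec) (φ : M → S) : C.der a (-φ) = - C.der a φ := by
  funext x
  simp only [der, mvfderiv, mfderiv_neg]
  rfl

theorem _root_.CourantAlgebroid.der_eq_neg {U : Set M} (hU : IsOpen U) {x : M} (hx : x ∈ U)
    (a : C.Sec) {φ ψ : M → ℝ} (h : ∀ y ∈ U, φ y = - ψ y) : C.der a φ x = - C.der a ψ x := by
  have h1 : φ =ᶠ[nhds x] -ψ := by
    filter_upwards [hU.mem_nhds hx] with y hy using h y hy
  rw [C.der_congr a h1, C.der_neg_fun]; rfl

namespace PlusFrame

variable {U : Set M} (P : V.PlusFrame U) {x : M} (hx : x ∈ U)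
include hx

/-- The structure functions of a frame and their derivatives at a point. -/
def jet : CliffordFrame.FrameJet lorentzSign where
  F i j k := P.F3 i j k x
  B i j k := P.B3 i j k x
  dF m i j k := C.der (P.e m) (P.F3 i j k) x
  dB m i j k := C.der (P.e m) (P.B3 i j k) x
  F_left := F3_swap_left hx
  F_right := F3_swap_right hx
  B_right := B3_swap hx
  dF_left m i j k := C.der_eq_neg P.isOpen hx _ fun _ hy => F3_swap_left hy i j k
  dF_right m i j k := C.der_eq_neg P.isOpen hx _ fun _ hy => F3_swap_right hy i j k
  dB_right m i j k := C.der_eq_neg P.isOpen hx _ fun _ hy => B3_swap hy i j k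
  jac4 := jacobi_eeee hx
  jac3 m i j k := by
    have hN : ∀ k m n, P.N3 k m n x = P.B3 m n k x + P.B3 n k m x - P.F3 k m n x := fun k m n => by
      rw [N3_eq hx, H3_eq hx]; ring
    have h := jacobi_feee (P := P) hx m i j k
    simp only [hN] at h
    exact h

theorem jet_H (i j k : Fin 6) : (P.jet hx).H i j k = P.H3 i j k x := (H3_eq hx i j k).symm

theorem jet_scalar (hric : V.IsRicciFlat)
    (hH : CliffordFrame.tr3 lorentzSign (fun i j k => P.H3 i j k x * P.H3 i j k x) = 0) :
    CliffordFrame.normSq3 lorentzSign (P.jet hx).F / 24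
      - CliffordFrame.normSq3 lorentzSign (P.jet hx).B / 8
      - (1 / 2) * ∑ i, lorentzSign i * (P.jet hx).dd i i
      - (1 / 4) * ∑ i, lorentzSign i * ((P.jet hx).d i * (P.jet hx).d i) = 0 := by
  refine (P.jet hx).scalar_identity (by simpa only [jet_H] using hH) ?_
  have h := ricci_trace (P := P) hx hric
  have hN : ∀ k m n, P.N3 k m n x = P.B3 m n k x + P.B3 n k m x - P.F3 k m n x := fun k m n => by
    rw [N3_eq hx, H3_eq hx]; ring
  simp only [hN] at h
  simp only [jet_H]
  exact h

/-- The commutator of two derivatives along a frame. -/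
theorem der_der_sub {S : Type*} [NormedAddCommGroup S] [NormedSpace ℝ S] [FiniteDimensional ℝ S]
    {ε : M → S} (hε : ContMDiff (𝓡 6) 𝓘(ℝ, S) ∞ ε) (i l : Fin 6) :
    C.der (P.e i) (C.der (P.e l) ε) x - C.der (P.e l) (C.der (P.e i) ε) x
      = ∑ m, (lorentzSign m * ((P.jet hx).F i l m - (P.jet hx).B m i l)) • C.der (P.e m) ε x := by
  rw [← C.der_br _ _ hε, der_expand (P := P) hx]
  simp only [pair_br_ee_f]
  rfl

end PlusFrame

namespace Regular

variable (h : V.Regular)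

theorem lc_congr_left {a a' b : C.Sec} {x : M} (ha : a x = a' x) : h.lc a b x = h.lc a' b x := by
  refine sec_ext fun c => ?_
  rw [h.pair_lc, h.pair_lc, pair, pair, ha]

/-- Metric compatibility expresses ⟨D_a b, c⟩ through the derivative of ⟨b,c⟩ and the value of `b`,
which depend only on the germ of `b`. -/
theorem lc_congr_right {a b b' : C.Sec} {x : M} (hb : ∀ᶠ y in nhds x, b y = b' y) :
    h.lc a b x = h.lc a b' x := by
  refine sec_ext fun c => ?_
  have h1 := h.der_pair_lc a b c x
  have h2 := h.der_pair_lc a b' c x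
  have h3 : C.pair b c =ᶠ[nhds x] C.pair b' c := by
    filter_upwards [hb] with y hy
    rw [pair, pair, hy]
  rw [C.der_congr a h3] at h1
  have h4 : C.pair b (h.lc a c) x = C.pair b' (h.lc a c) x := by rw [pair, pair, hb.self_of_nhds]
  linarith

end Regular

end SpinFrame

end CourantAlgebroid.GeneralizedMetric

/-! ### Differentiation of families of endomorphisms acting on spinors -/

namespace CourantAlgebroid

section Operators

variable {d : ℕ} {M : Type*} [TopologicalSpace M] [ChartedSpace (EuclideanSpace ℝ (Fin d)) M] [IsManifold (𝓡 d) ∞ M]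
  {F : Type*} [NormedAddCommGroup F] [NormedSpace ℝ F]
  {E : M → Type*} [TopologicalSpace (TotalSpace F E)]
  [∀ x, AddCommGroup (E x)] [∀ x, Module ℝ (E x)] [∀ x, TopologicalSpace (E x)] [FiberBundle F E]
  [VectorBundle ℝ F E]
  {C : CourantAlgebroid d F E} {S : Type*} [NormedAddCommGroup S] [NormedSpace ℝ S]

theorem der_sum_fun {κ : Type*} (s : Finset κ) (a : C.Sec) {φ : κ → M → S}
    (hφ : ∀ k, ContMDiff (𝓡 d) 𝓘(ℝ, S) ∞ (φ k)) :
    C.der a (fun y => ∑ k ∈ s, φ k y) = fun x => ∑ k ∈ s, C.der a (φ k) x := by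
  classical
  induction s using Finset.induction_on with
  | empty => simp only [Finset.sum_empty, C.der_const]; rfl
  | insert i s hi ih =>
    simp only [Finset.sum_insert hi]
    rw [C.der_add_fun a (hφ i) (contMDiff_finsetSum fun k _ => hφ k), ih]

theorem der_const_mul (r : ℝ) (a : C.Sec) {φ : M → ℝ} (hφ : ContMDiff (𝓡 d) 𝓘(ℝ, ℝ) ∞ φ) :
    C.der a (fun y => r * φ y) = fun x => r * C.der a φ x := by
  have h := C.der_smul_fun a (contMDiff_const (c := r)) hφ
  simp only [C.der_const] at h
  simpa using h

variable [FiniteDimensional ℝ S]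

/-- `Λ'` is the derivative along `a` of the family `Λ` of endomorphisms. -/
def IsDerOp (C : CourantAlgebroid d F E) (a : C.Sec) (Λ Λ' : M → Module.End ℝ S) : Prop :=
  ∀ ε : M → S, ContMDiff (𝓡 d) 𝓘(ℝ, S) ∞ ε → ContMDiff (𝓡 d) 𝓘(ℝ, S) ∞ (fun y => Λ y (ε y)) ∧
    ∀ x, C.der a (fun y => Λ y (ε y)) x = Λ' x (ε x) + Λ x (C.der a ε x)

namespace IsDerOp

variable {a : C.Sec}

theorem smul_op {φ : M → ℝ} (hφ : ContMDiff (𝓡 d) 𝓘(ℝ, ℝ) ∞ φ) (L : Module.End ℝ S) :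
    C.IsDerOp a (fun y => φ y • L) (fun y => C.der a φ y • L) := by
  intro ε hε
  set L' : S →L[ℝ] S := LinearMap.toContinuousLinearMap L with hL
  have h1 : ContMDiff (𝓡 d) 𝓘(ℝ, S) ∞ (fun y => L' (ε y)) := L'.contMDiff.comp hε
  refine ⟨hφ.smul h1, fun x => ?_⟩
  have h2 := congrFun (C.der_smul_fun a hφ h1) x
  rw [C.der_clm a L' hε x] at h2
  exact h2.trans (add_comm _ _)

theorem const (L : Module.End ℝ S) : C.IsDerOp a (fun _ => L) (fun _ => 0) := by
  have h := smul_op (C := C) (a := a) (contMDiff_const (c := (1 : ℝ))) L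
  simpa [C.der_const] using h

theorem add {Λ₁ Λ₁' Λ₂ Λ₂' : M → Module.End ℝ S} (h₁ : C.IsDerOp a Λ₁ Λ₁')
    (h₂ : C.IsDerOp a Λ₂ Λ₂') :
    C.IsDerOp a (fun y => Λ₁ y + Λ₂ y) (fun y => Λ₁' y + Λ₂' y) := by
  intro ε hε
  obtain ⟨s₁, d₁⟩ := h₁ ε hε
  obtain ⟨s₂, d₂⟩ := h₂ ε hε
  refine ⟨s₁.add s₂, fun x => ?_⟩
  have h := congrFun (C.der_add_fun a s₁ s₂) x
  simp only [d₁, d₂] at h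
  refine h.trans ?_
  simp only [LinearMap.add_apply]
  abel

theorem sum {κ : Type*} (s : Finset κ) {Λ Λ' : κ → M → Module.End ℝ S}
    (h : ∀ k, C.IsDerOp a (Λ k) (Λ' k)) :
    C.IsDerOp a (fun y => ∑ k ∈ s, Λ k y) (fun y => ∑ k ∈ s, Λ' k y) := by
  classical
  induction s using Finset.induction_on with
  | empty => simpa using const (C := C) (a := a) (0 : Module.End ℝ S)
  | insert i s hi ih =>
    simp only [Finset.sum_insert hi]
    exact (h i).add ih

theorem const_smul (r : ℝ) {Λ Λ' : M → Module.End ℝ S} (h : C.IsDerOp a Λ Λ') :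
    C.IsDerOp a (fun y => r • Λ y) (fun y => r • Λ' y) := by
  intro ε hε
  obtain ⟨hs, hd⟩ := h ε hε
  have hr : ContMDiff (𝓡 d) 𝓘(ℝ, ℝ) ∞ (fun _ : M => r) := contMDiff_const
  refine ⟨hr.smul hs, fun x => ?_⟩
  have h := congrFun (C.der_smul_fun a hr hs) x
  simp only [hd, C.der_const] at h
  refine h.trans ?_
  simp

variable {ι : Type*} [Fintype ι] (g : ι → Module.End ℝ S)

theorem q1 {T : ι → M → ℝ} (hT : ∀ i, ContMDiff (𝓡 d) 𝓘(ℝ, ℝ) ∞ (T i)) :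
    C.IsDerOp a (fun y => CliffordFrame.q1 g (fun i => T i y))
      (fun y => CliffordFrame.q1 g (fun i => C.der a (T i) y)) :=
  sum _ fun i => smul_op (hT i) _

theorem q2 {T : ι → ι → M → ℝ} (hT : ∀ i j, ContMDiff (𝓡 d) 𝓘(ℝ, ℝ) ∞ (T i j)) :
    C.IsDerOp a (fun y => CliffordFrame.q2 g (fun i j => T i j y))
      (fun y => CliffordFrame.q2 g (fun i j => C.der a (T i j) y)) :=
  sum _ fun i => sum _ fun j => smul_op (hT i j) _

theorem q3 {T : ι → ι → ι → M → ℝ} (hT : ∀ i j k, ContMDiff (𝓡 d) 𝓘(ℝ, ℝ) ∞ (T i j k)) :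
    C.IsDerOp a (fun y => CliffordFrame.q3 g (fun i j k => T i j k y))
      (fun y => CliffordFrame.q3 g (fun i j k => C.der a (T i j k) y)) :=
  sum _ fun i => sum _ fun j => sum _ fun k => smul_op (hT i j k) _

end IsDerOp

end Operators

end CourantAlgebroid

/-! ### The spin connection and the Dirac operator in a frame -/

namespace CourantAlgebroid.GeneralizedMetric.PlusFrame

section Spinors

variable {M : Type*} [TopologicalSpace M] [ChartedSpace (EuclideanSpace ℝ (Fin 6)) M] [IsManifold (𝓡 6) ∞ M]
  {F : Type*} [NormedAddCommGroup F] [NormedSpace ℝ F]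
  {E : M → Type*} [TopologicalSpace (TotalSpace F E)]
  [∀ x, AddCommGroup (E x)] [∀ x, Module ℝ (E x)] [∀ x, TopologicalSpace (E x)] [FiberBundle F E]
  [VectorBundle ℝ F E] [T2Space M] [ContMDiffVectorBundle ∞ F E (𝓡 6)]
  {C : CourantAlgebroid 6 F E} {V : C.GeneralizedMetric} {U : Set M} (P : V.PlusFrame U)
  {S : Type*} [NormedAddCommGroup S] [NormedSpace ℝ S] [FiniteDimensional ℝ S]
  (γ : Fin 6 → Module.End ℝ S) {x : M} {ε : M → S}

/-- The endomorphisms through which the dual basis `eⁱ` acts on spinors. -/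
def gen (γ : Fin 6 → Module.End ℝ S) (i : Fin 6) : Module.End ℝ S := lorentzSign i • γ i

omit [FiniteDimensional ℝ S] in
theorem gen_anticomm {γ : Fin 6 → Module.End ℝ S}
    (hγ : ∀ i j, γ i * γ j + γ j * γ i = if i = j then (-2 * lorentzSign i) • 1 else 0) (i j) :
    gen γ i * gen γ j + gen γ j * gen γ i
      = (if i = j then -2 * lorentzSign i else 0) • (1 : Module.End ℝ S) := by
  simp only [gen, smul_mul_smul_comm]
  rw [mul_comm (lorentzSign j), ← smul_add, hγ]
  split_ifs with h
  · subst h; rw [lorentzSign_mul_self, one_smul]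
  · simp

/-- The spin connection in the direction of `fₖ`. -/
def spinD (k : Fin 6) (ψ : M → S) : M → S := fun y =>
  C.der (P.e k) ψ y + ((1 / 4 : ℝ) • CliffordFrame.q2 (gen γ) (fun i j => P.B3 k i j y)) (ψ y)

/-- The cubic part of the Dirac operator. -/
def cubic (y : M) : Module.End ℝ S :=
  (1 / 12 : ℝ) • CliffordFrame.q3 (gen γ) (fun i j k => P.F3 i j k y)
    + (1 / 2 : ℝ) • CliffordFrame.q1 (gen γ) (fun j => ∑ i, lorentzSign i * P.B3 i j i y)

omit [FiniteDimensional ℝ S] in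
variable {P} in
theorem spinDeriv_eq {e : Fin 6 → C.Sec} (he : ∀ i, ∀ y ∈ U, e i y = P.e i y) (hx : x ∈ U)
    (a : C.Sec) (ψ : M → S) :
    V.spinDeriv (fun i => e i) γ a ψ x = C.der a ψ x + ((1 / 4 : ℝ) •
      CliffordFrame.q2 (gen γ) (fun i j => C.pair (P.regular.lc a (P.e i)) (P.e j) x)) (ψ x) := by
  have h1 : ∀ i j, C.pairing x (V.leviCivita a (e i) x) (e j x)
      = C.pair (P.regular.lc a (P.e i)) (P.e j) x := fun i j => by
    rw [← P.regular.coe_lc, P.regular.lc_congr_right (b' := P.e i), he j x hx, pair]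
    filter_upwards [P.isOpen.mem_nhds hx] with y hy using he i y hy
  rw [spinDeriv, der, LinearMap.smul_apply, CliffordFrame.q2_apply]
  simp only [h1, LinearMap.sum_apply, LinearMap.smul_apply, gen, smul_mul_smul_comm,
    Module.End.mul_apply, smul_smul]
  congr 3
  funext i
  congr 1
  funext j
  congr 1
  ring

-- The spin derivative is tensorial in its direction, so it may be expanded along `f`, where its
-- coefficients are the B_kij.
omit [FiniteDimensional ℝ S] in
variable {P} in
theorem spinDeriv_minus {e : Fin 6 → C.Sec} (he : ∀ i, ∀ y ∈ U, e i y = P.e i y) (hx : x ∈ U)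
    {a : C.Sec} (ha : a x ∈ V.minus x) (ψ : M → S) :
    V.spinDeriv (fun i => e i) γ a ψ x
      = ∑ k, (-(lorentzSign k * C.pair a (P.f k) x)) • P.spinD γ k ψ x := by
  have hm := minus_expand (P := P) hx ha
  rw [← Finset.sum_neg_distrib] at hm
  simp only [← neg_smul] at hm
  have h1 : C.der a ψ x = ∑ k, (-(lorentzSign k * C.pair a (P.f k) x)) • C.der (P.e k) ψ x := by
    rw [der, hm]
    simp only [map_sum, map_smul, P.anchor_f]
    rfl
  have h2 : (fun i j => C.pair (P.regular.lc a (P.e i)) (P.e j) x)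
      = ∑ k, (-(lorentzSign k * C.pair a (P.f k) x)) • (fun i j => P.B3 k i j x) := by
    funext i j
    rw [P.regular.pair_lc, pair, hm]
    simp only [map_sum, map_smul, LinearMap.sum_apply, LinearMap.smul_apply, Finset.sum_apply,
      Pi.smul_apply, smul_eq_mul]
    refine Finset.sum_congr rfl fun k _ => ?_
    rw [← pair_lc_f, P.regular.pair_lc]
    rfl
  rw [spinDeriv_eq γ he hx, h1, h2, map_sum]
  simp only [map_smul, LinearMap.smul_apply, LinearMap.sum_apply, Finset.smul_sum, spinD, smul_add,
    Finset.sum_add_distrib]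
  congr 1
  exact Finset.sum_congr rfl fun k _ => smul_comm _ _ _

-- The generators multiplied into the connection terms assemble ¼ `q3` of B − H/3, which
-- `q3_connection_eq` identifies with the cubic term.
omit [FiniteDimensional ℝ S] in
variable {P} in
theorem dirac_eq
    (hγ : ∀ i j, γ i * γ j + γ j * γ i = if i = j then (-2 * lorentzSign i) • 1 else 0)
    {e : Fin 6 → C.Sec} (he : ∀ i, ∀ y ∈ U, e i y = P.e i y) (hx : x ∈ U) (ψ : M → S) :
    V.dirac (fun i => e i) γ ψ x
      = ∑ i, gen γ i (C.der (P.e i) ψ x) + P.cubic γ x (ψ x) := by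
  have h0 : ∀ i, C.der (e i) ψ x = C.der (P.e i) ψ x := fun i => by rw [der, he i x hx, der]
  have h1 : ∀ i j k, C.pair (P.regular.lc (e i) (P.e j)) (P.e k) x
      = (P.jet hx).B i j k - (1 / 3) * (P.jet hx).H i j k := fun i j k => by
    have := congrFun (pair_lc_e (P := P) i j k) x
    rw [pair, P.regular.lc_congr_left (he i x hx), jet_H]
    exact this
  have h2 : P.cubic γ x = (1 / 4 : ℝ) • CliffordFrame.q3 (gen γ)
      (fun i j k => (P.jet hx).B i j k - (1 / 3) * (P.jet hx).H i j k) :=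
    ((P.jet hx).q3_connection_eq (gen_anticomm hγ)).symm
  have h3 : ∀ i (s : S), lorentzSign i • γ i s = gen γ i s := fun _ _ => rfl
  rw [dirac, h2, CliffordFrame.q3_eq_sum]
  rw [Finset.smul_sum, LinearMap.sum_apply, ← Finset.sum_add_distrib]
  refine Finset.sum_congr rfl fun i _ => ?_
  rw [h3, spinDeriv_eq γ he hx, h0, map_add]
  simp only [h1, LinearMap.smul_apply, map_smul, Module.End.mul_apply]

variable {P γ}

theorem F3_smooth (i j k : Fin 6) : ContMDiff (𝓡 6) 𝓘(ℝ, ℝ) ∞ (P.F3 i j k) := C.pair_smooth _ _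

theorem B3_smooth (i j k : Fin 6) : ContMDiff (𝓡 6) 𝓘(ℝ, ℝ) ∞ (P.B3 i j k) := C.pair_smooth _ _

theorem isDerOp_cubic (a : C.Sec) : C.IsDerOp a (P.cubic γ) (fun y =>
    (1 / 12 : ℝ) • CliffordFrame.q3 (gen γ) (fun i j k => C.der a (P.F3 i j k) y)
    + (1 / 2 : ℝ) • CliffordFrame.q1 (gen γ)
      (fun j => ∑ i, lorentzSign i * C.der a (P.B3 i j i) y)) := by
  have hs : ∀ j i, ContMDiff (𝓡 6) 𝓘(ℝ, ℝ) ∞ (fun y => lorentzSign i * P.B3 i j i y) :=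
    fun j i => contMDiff_const.mul (B3_smooth i j i)
  have h1 := IsDerOp.q1 (C := C) (a := a) (gen γ) (T := fun j y => ∑ i, lorentzSign i * P.B3 i j i y)
    fun j => contMDiff_finsetSum fun i _ => hs j i
  simp only [der_sum_fun _ _ (hs _), der_const_mul _ _ (B3_smooth _ _ _)] at h1
  exact ((IsDerOp.q3 (gen γ) F3_smooth).const_smul _).add (h1.const_smul _)

theorem dirac_dirac_eq
    (hγ : ∀ i j, γ i * γ j + γ j * γ i = if i = j then (-2 * lorentzSign i) • 1 else 0)
    {e : Fin 6 → C.Sec} (he : ∀ i, ∀ y ∈ U, e i y = P.e i y) (hx : x ∈ U)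
    (hε : ContMDiff (𝓡 6) 𝓘(ℝ, S) ∞ ε) :
    V.dirac (fun i => e i) γ (V.dirac (fun i => e i) γ ε) x
      = ∑ i, gen γ i (∑ l, gen γ l (C.der (P.e i) (C.der (P.e l) ε) x)
        + (((1 / 12 : ℝ) • CliffordFrame.q3 (gen γ) ((P.jet hx).dF i)
            + (1 / 2 : ℝ) • CliffordFrame.q1 (gen γ) ((P.jet hx).dd i)) (ε x)
          + P.cubic γ x (C.der (P.e i) ε x)))
        + P.cubic γ x (∑ l, gen γ l (C.der (P.e l) ε x) + P.cubic γ x (ε x)) := by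
  have h1 : V.dirac (fun i => e i) γ ε =ᶠ[nhds x]
      fun y => ∑ i, gen γ i (C.der (P.e i) ε y) + P.cubic γ y (ε y) := by
    filter_upwards [P.isOpen.mem_nhds hx] with y hy using dirac_eq γ hγ he hy ε
  have h2 : ∀ i, C.der (P.e i) (V.dirac (fun i => e i) γ ε) x
      = ∑ l, gen γ l (C.der (P.e i) (C.der (P.e l) ε) x)
        + (((1 / 12 : ℝ) • CliffordFrame.q3 (gen γ) ((P.jet hx).dF i)
            + (1 / 2 : ℝ) • CliffordFrame.q1 (gen γ) ((P.jet hx).dd i)) (ε x)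
          + P.cubic γ x (C.der (P.e i) ε x)) := by
    intro i
    have hc : ∀ l, _ := fun l =>
      IsDerOp.const (C := C) (a := P.e i) (gen γ l) _ (C.der_smooth (P.e l) hε)
    have hq := isDerOp_cubic (P := P) (γ := γ) (P.e i) ε hε
    rw [C.der_congr _ h1]
    have h3 := congrFun (C.der_add_fun (P.e i)
      (contMDiff_finsetSum (t := Finset.univ) fun l _ => (hc l).1) hq.1) x
    refine h3.trans ?_
    rw [der_sum_fun _ _ fun l => (hc l).1, hq.2]
    simp only [(hc _).2, LinearMap.zero_apply, zero_add]
    rfl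
  rw [dirac_eq γ hγ he hx, h1.self_of_nhds]
  simp only [h2]

theorem spinD_smooth (k : Fin 6) (hε : ContMDiff (𝓡 6) 𝓘(ℝ, S) ∞ ε) :
    ContMDiff (𝓡 6) 𝓘(ℝ, S) ∞ (P.spinD γ k ε) :=
  (C.der_smooth _ hε).add
    (((IsDerOp.q2 (C := C) (a := P.e k) (gen γ) (B3_smooth (P := P) k)).const_smul (1 / 4) ε hε).1)

theorem spinD_spinD (hx : x ∈ U) (k : Fin 6) (hε : ContMDiff (𝓡 6) 𝓘(ℝ, S) ∞ ε) :
    P.spinD γ k (P.spinD γ k ε) x = C.der (P.e k) (C.der (P.e k) ε) x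
      + ((1 / 4 : ℝ) • CliffordFrame.q2 (gen γ) ((P.jet hx).dB k k)) (ε x)
      + ((1 / 4 : ℝ) • CliffordFrame.q2 (gen γ) ((P.jet hx).B k)) (C.der (P.e k) ε x)
      + ((1 / 4 : ℝ) • CliffordFrame.q2 (gen γ) ((P.jet hx).B k)) (C.der (P.e k) ε x
        + ((1 / 4 : ℝ) • CliffordFrame.q2 (gen γ) ((P.jet hx).B k)) (ε x)) := by
  have h := ((IsDerOp.q2 (C := C) (a := P.e k) (gen γ)
    (B3_smooth (P := P) k)).const_smul (1 / 4) ε hε)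
  have h3 := congrFun (C.der_add_fun (P.e k) (C.der_smooth (P.e k) hε) h.1) x
  rw [spinD]
  have h4 : C.der (P.e k) (P.spinD γ k ε) x = _ := h3
  rw [h4, h.2, ← add_assoc]
  rfl

end Spinors

end CourantAlgebroid.GeneralizedMetric.PlusFrame

/-! ### Frame independence of the rough Laplacian -/

namespace CourantAlgebroid.GeneralizedMetric.PlusFrame

section Laplacian

variable {M : Type*} [TopologicalSpace M] [ChartedSpace (EuclideanSpace ℝ (Fin 6)) M] [IsManifold (𝓡 6) ∞ M]
  {F : Type*} [NormedAddCommGroup F] [NormedSpace ℝ F]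
  {E : M → Type*} [TopologicalSpace (TotalSpace F E)]
  [∀ x, AddCommGroup (E x)] [∀ x, Module ℝ (E x)] [∀ x, TopologicalSpace (E x)] [FiberBundle F E]
  [VectorBundle ℝ F E] [T2Space M] [ContMDiffVectorBundle ∞ F E (𝓡 6)]
  {C : CourantAlgebroid 6 F E} {V : C.GeneralizedMetric} {U : Set M} {P : V.PlusFrame U}
  {S : Type*} [NormedAddCommGroup S] [NormedSpace ℝ S] [FiniteDimensional ℝ S]
  {γ : Fin 6 → Module.End ℝ S} {x : M} {ε : M → S}

/-- If the rows of a square matrix are orthonormal, so are its columns. -/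
theorem _root_.sum_mul_of_orthonormal {η : Fin 6 → ℝ} (hη : ∀ i, η i * η i = 1)
    {O : Fin 6 → Fin 6 → ℝ}
    (h : ∀ i j, ∑ k, η k * (O i k * O j k) = if i = j then η i else 0) (k l : Fin 6) :
    ∑ j, η j * (O j k * O j l) = if k = l then η k else 0 := by
  have h1 : (Matrix.of fun i k => η i * (O i k * η k)) * (Matrix.of fun k j => O j k) = 1 := by
    ext i j
    rw [Matrix.mul_apply, Matrix.one_apply]
    have := congrArg (η i * ·) (h i j)
    simp only [Finset.mul_sum, mul_ite, mul_zero, hη] at this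
    rw [← this]
    exact Finset.sum_congr rfl fun k _ => by simp only [Matrix.of_apply]; ring
  have h2 := congrArg (fun A : Matrix (Fin 6) (Fin 6) ℝ => A k l) (mul_eq_one_comm.1 h1)
  rw [Matrix.mul_apply, Matrix.one_apply] at h2
  have h3 := congrArg (· * η l) h2
  simp only [Matrix.of_apply, Finset.sum_mul, ite_mul, one_mul, zero_mul] at h3
  rw [show (if k = l then η k else 0) = if k = l then η l else 0 by split_ifs with h <;> simp [h],
    ← h3]
  exact Finset.sum_congr rfl fun j _ => by linear_combination - η j * O j k * O j l * hη l

/-- Bookkeeping for a change of frame: `O` is the transition matrix, `D` its derivatives and `c` the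
connection coefficients of the given frame. -/
theorem _root_.sum_smul_sum_rearrange {S ι : Type*} [AddCommGroup S] [Module ℝ S] [Fintype ι]
    (η : ι → ℝ) (O : ι → ι → ℝ) (D : ι → ι → ι → ℝ) (c : ι → ι → ℝ) (A : ι → ι → S) (B : ι → S) :
    ∑ j, η j • (∑ k, O j k • ∑ l, (O j l • A k l + D j k l • B l) - ∑ l, (-c j l) • B l)
      = ∑ k, ∑ l, (∑ j, η j * (O j k * O j l)) • A k l
        + ∑ l, (∑ j, η j * (∑ k, O j k * D j k l + c j l)) • B l := by
  have h : ∀ j, η j • (∑ k, O j k • ∑ l, (O j l • A k l + D j k l • B l) - ∑ l, (-c j l) • B l)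
      = ∑ k, ∑ l, (η j * (O j k * O j l)) • A k l
        + ∑ l, (η j * (∑ k, O j k * D j k l + c j l)) • B l := fun j => by
    have h1 : ∑ l, (∑ k, O j k * D j k l) • B l = ∑ k, ∑ l, (O j k * D j k l) • B l := by
      simp only [Finset.sum_smul]
      exact Finset.sum_comm
    simp only [mul_smul (η j), ← Finset.smul_sum, ← smul_add]
    congr 1
    simp only [add_smul, Finset.sum_add_distrib, h1, neg_smul, Finset.sum_neg_distrib,
      sub_neg_eq_add, smul_add, Finset.smul_sum, smul_smul, add_assoc]
  rw [Finset.sum_congr rfl fun j _ => h j]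
  simp only [Finset.sum_add_distrib, Finset.sum_smul]
  congr 1
  · rw [Finset.sum_comm]
    exact Finset.sum_congr rfl fun k _ => Finset.sum_comm
  · exact Finset.sum_comm

theorem pair_minus_expand (hx : x ∈ U) {a : C.Sec} (ha : a x ∈ V.minus x) (b : C.Sec) :
    C.pair a b x = ∑ k, -(lorentzSign k * C.pair a (P.f k) x) * C.pair (P.f k) b x := by
  have hm := minus_expand (P := P) hx ha
  rw [← Finset.sum_neg_distrib] at hm
  simp only [← neg_smul] at hm
  conv_lhs => rw [pair, hm]
  simp only [map_sum, map_smul, LinearMap.sum_apply, LinearMap.smul_apply, smul_eq_mul]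
  rfl

theorem spinD_congr {k : Fin 6} {φ ψ : M → S} (h : φ =ᶠ[nhds x] ψ) :
    P.spinD γ k φ x = P.spinD γ k ψ x := by
  rw [spinD, spinD, C.der_congr _ h, h.self_of_nhds]

theorem spinD_sum {k : Fin 6} {c : Fin 6 → M → ℝ} {ψ : Fin 6 → M → S}
    (hc : ∀ l, ContMDiff (𝓡 6) 𝓘(ℝ, ℝ) ∞ (c l)) (hψ : ∀ l, ContMDiff (𝓡 6) 𝓘(ℝ, S) ∞ (ψ l)) :
    P.spinD γ k (fun y => ∑ l, c l y • ψ l y) x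
      = ∑ l, (c l x • P.spinD γ k (ψ l) x + C.der (P.e k) (c l) x • ψ l x) := by
  have hs : ∀ l, ContMDiff (𝓡 6) 𝓘(ℝ, S) ∞ (fun y => c l y • ψ l y) := fun l => (hc l).smul (hψ l)
  rw [spinD, der_sum_fun _ _ hs]
  simp only [C.der_smul_fun _ (hc _) (hψ _), map_sum, map_smul, spinD, smul_add,
    Finset.sum_add_distrib]
  abel

variable {fs : Fin 6 → C.Sec}
  (hf : ∀ y ∈ U, V.IsOrthonormalMinus y fun j => fs j y)
include hf

theorem sum_lorentzSign_coeff (hx : x ∈ U) (k l : Fin 6) :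
    ∑ j, lorentzSign j * (-(lorentzSign k * C.pair (fs j) (P.f k) x)
        * -(lorentzSign l * C.pair (fs j) (P.f l) x)) = if k = l then lorentzSign k else 0 := by
  refine sum_mul_of_orthonormal (O := fun j k => -(lorentzSign k * C.pair (fs j) (P.f k) x))
    lorentzSign_mul_self (fun i j => ?_) k l
  have h1 := pair_minus_expand (P := P) hx ((hf x hx).1 i) (fs j)
  rw [pair, (hf x hx).2 i j] at h1
  rw [show (if i = j then lorentzSign i else 0) = -(if i = j then -lorentzSign i else 0) by
    split_ifs <;> simp, h1, ← Finset.sum_neg_distrib]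
  refine Finset.sum_congr rfl fun k _ => ?_
  rw [C.pair_comm (P.f k)]
  linear_combination lorentzSign k * C.pair (fs i) (P.f k) x * C.pair (fs j) (P.f k) x *
    lorentzSign_mul_self k

/-- The given frame of V₋ is an orthonormal combination of `f`. Derivatives of the transition matrix
combine with the term of D_{fⱼ}fⱼ into a trace of connection coefficients that no longer depends on
the given frame and equals `d`. -/
theorem neg_roughLaplacian_eq {e : Fin 6 → C.Sec} (he : ∀ i, ∀ y ∈ U, e i y = P.e i y) (hx : x ∈ U)
    (hε : ContMDiff (𝓡 6) 𝓘(ℝ, S) ∞ ε) :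
    - V.roughLaplacian (fun i => e i) (fun i => fs i) γ ε x
      = ∑ k, lorentzSign k • P.spinD γ k (P.spinD γ k ε) x
        + ∑ m, (lorentzSign m * (P.jet hx).d m) • P.spinD γ m ε x := by
  -- The given sections lie in V₋ only over U; their projections lie in V₋ everywhere and agree with
  -- them on U.
  set fm : Fin 6 → C.Sec := fun j => V.Pm (fs j) with hfm
  have hfs : ∀ j, ∀ y ∈ U, fs j y = fm j y := fun j y hy =>
    (Pm_apply_of_mem_minus ((hf y hy).1 j)).symm
  have hmx : ∀ j, fs j x ∈ V.minus x := (hf x hx).1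
  set O : Fin 6 → Fin 6 → M → ℝ := fun j k y => -(lorentzSign k * C.pair (fs j) (P.f k) y) with hO
  have hOs : ∀ j k, ContMDiff (𝓡 6) 𝓘(ℝ, ℝ) ∞ (O j k) := fun j k =>
    (contMDiff_const.mul (C.pair_smooth _ _)).neg
  have hOO : ∀ k l, ∑ j, lorentzSign j * (O j k x * O j l x) = if k = l then lorentzSign k else 0 :=
    sum_lorentzSign_coeff hf hx
  have hlc : ∀ j, P.regular.lc (fs j) (fs j) x = P.regular.lc (fm j) (fm j) x := fun j => by
    rw [P.regular.lc_congr_left (hfs j x hx), P.regular.lc_congr_right (b' := fm j)]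
    filter_upwards [P.isOpen.mem_nhds hx] with y hy using hfs j y hy
  have h1 : ∀ j, V.spinDeriv (fun i => e i) γ (fs j) (V.spinDeriv (fun i => e i) γ (fs j) ε) x
      = ∑ k, O j k x • ∑ l, (O j l x • P.spinD γ k (P.spinD γ l ε) x
          + C.der (P.e k) (O j l) x • P.spinD γ l ε x) := fun j => by
    rw [spinDeriv_minus γ he hx (hmx j)]
    refine Finset.sum_congr rfl fun k _ => ?_
    rw [← spinD_sum (hOs j) fun l => spinD_smooth l hε]
    congr 1
    refine spinD_congr ?_
    filter_upwards [P.isOpen.mem_nhds hx] with y hy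
      using spinDeriv_minus γ he hy ((hf y hy).1 j) ε
  have h2 : ∀ j, V.spinDeriv (fun i => e i) γ (V.leviCivita (fs j) (fs j)) ε x
      = ∑ l, (-(lorentzSign l * C.pair (P.regular.lc (fm j) (fm j)) (P.f l) x))
          • P.spinD γ l ε x := fun j => by
    rw [← P.regular.coe_lc, spinDeriv_minus γ he hx]
    · simp only [pair, hlc]
    · rw [hlc]
      exact P.regular.isMinus_lc _ (isMinus_Pm _) x
  -- Since `O j l` is a pairing with `P.f l`, metric compatibility trades its derivative for
  -- connection coefficients, and the term of D_{fⱼ}fⱼ cancels.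
  have h3 : ∀ j l, ∑ k, O j k x * C.der (P.e k) (O j l) x
        + lorentzSign l * C.pair (P.regular.lc (fm j) (fm j)) (P.f l) x
      = -lorentzSign l * ∑ n, ∑ k, O j n x * O j k x * C.pair (P.regular.lc (P.f k) (P.f l)) (P.f n) x := by
    intro j l
    have hm := minus_expand (P := P) hx (hmx j)
    rw [← Finset.sum_neg_distrib] at hm
    simp only [← neg_smul] at hm
    have a1 : ∑ k, O j k x * C.der (P.e k) (O j l) x = C.der (fm j) (O j l) x := by
      rw [der, ← hfs j x hx, hm]
      simp only [map_sum, map_smul, P.anchor_f]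
      rfl
    have a2 : C.der (fm j) (O j l) x = - lorentzSign l * C.der (fm j) (C.pair (fm j) (P.f l)) x := by
      rw [← congrFun (der_const_mul _ _ (C.pair_smooth _ _)) x]
      refine C.der_congr _ ?_
      filter_upwards [P.isOpen.mem_nhds hx] with y hy
      simp only [hO, pair, hfs j y hy]
      ring
    have a3 := P.regular.der_pair_lc (fm j) (fm j) (P.f l) x
    have hmx' : fm j x ∈ V.minus x := isMinus_Pm (fs j) x
    have hOm : ∀ n, -(lorentzSign n * C.pair (fm j) (P.f n) x) = O j n x := fun n => by
      simp only [hO, pair, hfs j x hx]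
    have a4 : C.pair (fm j) (P.regular.lc (fm j) (P.f l)) x
        = ∑ n, ∑ k, O j n x * O j k x * C.pair (P.regular.lc (P.f k) (P.f l)) (P.f n) x := by
      rw [pair_minus_expand (P := P) hx hmx']
      simp only [hOm]
      refine Finset.sum_congr rfl fun n _ => ?_
      rw [C.pair_comm, P.regular.pair_lc, pair_minus_expand (P := P) hx hmx', Finset.mul_sum]
      simp only [hOm, P.regular.pair_lc, mul_assoc]
    rw [a1, a2, a3, a4]
    ring
  -- Summation over `j` uses orthonormality of `O` and leaves −ηₗ Σ ηₖ B_kkl = ηₗ dₗ.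
  have h4 : ∀ l, ∑ j, lorentzSign j * (∑ k, O j k x * C.der (P.e k) (O j l) x
        + lorentzSign l * C.pair (P.regular.lc (fm j) (fm j)) (P.f l) x)
      = lorentzSign l * (P.jet hx).d l := by
    intro l
    simp only [h3]
    have a1 : ∀ k n, ∑ j, lorentzSign j * (O j n x * O j k x *
        C.pair (P.regular.lc (P.f k) (P.f l)) (P.f n) x)
        = if n = k then lorentzSign k * C.pair (P.regular.lc (P.f k) (P.f l)) (P.f k) x else 0 := by
      intro k n
      have := congrArg (· * C.pair (P.regular.lc (P.f k) (P.f l)) (P.f n) x) (hOO n k)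
      simp only [Finset.sum_mul, ite_mul, zero_mul] at this
      trans (if n = k then lorentzSign n * C.pair (P.regular.lc (P.f k) (P.f l)) (P.f n) x else 0)
      · rw [← this]
        exact Finset.sum_congr rfl fun j _ => by ring
      · split_ifs with h
        · rw [h]
        · rfl
    have a2 : ∀ k, C.pair (P.regular.lc (P.f k) (P.f l)) (P.f k) x = (P.jet hx).B k k l := by
      intro k
      have b1 := P.regular.der_pair_lc (P.f k) (P.f k) (P.f l) x
      rw [der_pair_f hx, pair_lc_f_f hx, C.pair_comm (P.f k)] at b1
      have b2 : (P.jet hx).B k k l = P.B3 k k l x := rfl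
      linarith
    calc _ = -lorentzSign l * ∑ n, ∑ k, ∑ j, lorentzSign j * (O j n x * O j k x *
          C.pair (P.regular.lc (P.f k) (P.f l)) (P.f n) x) := by
          simp only [Finset.mul_sum]
          rw [Finset.sum_comm]
          refine Finset.sum_congr rfl fun n _ => ?_
          rw [Finset.sum_comm]
          exact Finset.sum_congr rfl fun k _ => Finset.sum_congr rfl fun j _ => by ring
      _ = -lorentzSign l * ∑ k, lorentzSign k * (P.jet hx).B k k l := by
          simp only [a1, Finset.sum_ite_eq, Finset.mem_univ, if_true, a2]
      _ = _ := by rw [(P.jet hx).sum_B_self]; ring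
  rw [roughLaplacian, neg_neg]
  simp only [h1, h2]
  calc _ = ∑ k, ∑ l, (∑ j, lorentzSign j * (O j k x * O j l x)) • P.spinD γ k (P.spinD γ l ε) x
      + ∑ l, (∑ j, lorentzSign j * (∑ k, O j k x * C.der (P.e k) (O j l) x
        + lorentzSign l * C.pair (P.regular.lc (fm j) (fm j)) (P.f l) x)) • P.spinD γ l ε x :=
        sum_smul_sum_rearrange _ (fun j k => O j k x) (fun j k l => C.der (P.e k) (O j l) x) _ _ _
    _ = _ := by
        simp only [hOO, h4, ite_smul, zero_smul, Finset.sum_ite_eq, Finset.mem_univ, if_true]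

end Laplacian

end CourantAlgebroid.GeneralizedMetric.PlusFrame

/-! ### The Lichnerowicz formula on the manifold -/

namespace CourantAlgebroid.GeneralizedMetric.PlusFrame

section Lichnerowicz

variable {M : Type*} [TopologicalSpace M] [ChartedSpace (EuclideanSpace ℝ (Fin 6)) M] [IsManifold (𝓡 6) ∞ M]
  {F : Type*} [NormedAddCommGroup F] [NormedSpace ℝ F]
  {E : M → Type*} [TopologicalSpace (TotalSpace F E)]
  [∀ x, AddCommGroup (E x)] [∀ x, Module ℝ (E x)] [∀ x, TopologicalSpace (E x)] [FiberBundle F E]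
  [VectorBundle ℝ F E] [T2Space M] [ContMDiffVectorBundle ∞ F E (𝓡 6)]
  {C : CourantAlgebroid 6 F E} {V : C.GeneralizedMetric} {U : Set M} (P : V.PlusFrame U)
  {S : Type*} [NormedAddCommGroup S] [NormedSpace ℝ S] [FiniteDimensional ℝ S]
  {γ : Fin 6 → Module.End ℝ S} {x : M} {ε : M → S}

/-- The square of the Dirac operator of a Ricci-flat generalized metric whose three-form is null. -/
theorem dirac_dirac_eq_roughLaplacian
    (hγ : ∀ i j, γ i * γ j + γ j * γ i = if i = j then (-2 * lorentzSign i) • 1 else 0)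
    {e fs : Fin 6 → C.Sec} (he : ∀ i, ∀ y ∈ U, e i y = P.e i y)
    (hf : ∀ y ∈ U, V.IsOrthonormalMinus y fun j => fs j y) (hric : V.IsRicciFlat) (hx : x ∈ U)
    (hH : CliffordFrame.tr3 lorentzSign (fun i j k => P.H3 i j k x * P.H3 i j k x) = 0)
    (hε : ContMDiff (𝓡 6) 𝓘(ℝ, S) ∞ ε) :
    V.dirac (fun i => e i) γ (V.dirac (fun i => e i) γ ε) x
      = V.roughLaplacian (fun i => e i) (fun i => fs i) γ ε x := by
  have h1 := (P.jet hx).lichnerowicz (gen_anticomm hγ) (P.jet_scalar hx hric hH)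
    (P := P.cubic γ x) rfl (ε x) (fun i => C.der (P.e i) ε x)
    (fun i l => C.der (P.e i) (C.der (P.e l) ε) x) (P.der_der_sub hx hε)
  have h2 := neg_roughLaplacian_eq (γ := γ) hf he hx hε
  rw [← sub_eq_zero, sub_eq_add_neg, dirac_dirac_eq hγ he hx hε, h2, ← h1, ← add_assoc]
  simp only [spinD_spinD hx _ hε]
  rfl

end Lichnerowicz

end CourantAlgebroid.GeneralizedMetric.PlusFrame

/-! ### The curvature three-form is the torsion of the Gualtieri–Bismut connection -/

namespace CourantAlgebroid.GeneralizedMetric.Regular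

section CurvatureForm

variable {d : ℕ} {M : Type*} [TopologicalSpace M] [ChartedSpace (EuclideanSpace ℝ (Fin d)) M] [IsManifold (𝓡 d) ∞ M]
  {F : Type*} [NormedAddCommGroup F] [NormedSpace ℝ F]
  {E : M → Type*} [TopologicalSpace (TotalSpace F E)]
  [∀ x, AddCommGroup (E x)] [∀ x, Module ℝ (E x)] [∀ x, TopologicalSpace (E x)] [FiberBundle F E]
  [VectorBundle ℝ F E] [T2Space M] [ContMDiffVectorBundle ∞ F E (𝓡 d)]
  {C : CourantAlgebroid d F E} {V : C.GeneralizedMetric} (h : V.Regular) {x : M}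

/-- For `a` in V₊ one has π^*g(πa) = a − `sw` a, as pairing with an arbitrary section shows; half of
it is subtracted from `a`. -/
theorem splitting_anchor {a : C.Sec} (ha : V.IsPlus a) (x : M) :
    V.splitting x (C.anchor x (a x)) = ((1 / 2 : ℝ) • (a + h.sw a) : C.Sec) x := by
  have key : C.coanchor x (V.metric x (C.anchor x (a x))) = (a - h.sw a) x := by
    rw [← sub_eq_zero]
    apply C.pairing_nondegenerate
    intro v
    obtain ⟨c, rfl⟩ := C.exists_sec x v
    have h1 : V.liftPlus x (C.anchor x (c x)) = (V.Pp c + h.sw (V.Pm c)) x := by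
      have e : C.anchor x (c x) = C.anchor x ((V.Pp c + h.sw (V.Pm c)) x) := by
        conv_lhs => rw [← Pp_add_Pm (V := V) c]
        simp only [ContMDiffSection.coe_add, Pi.add_apply, map_add, anchor_sw]
      rw [e, h.liftPlus_anchor]
      exact add_mem (isPlus_Pp c x) (h.isPlus_sw (isMinus_Pm c) x)
    have h2 : C.pairing x (C.coanchor x (V.metric x (C.anchor x (a x)))) (c x)
        = C.pair a (V.Pp c + h.sw (V.Pm c)) x := by
      rw [C.pairing_coanchor, metric, LinearMap.compl₁₂_apply, h.liftPlus_anchor (ha x), h1]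
      rfl
    have h3 : C.pair (a - h.sw a) c x = C.pair a (V.Pp c + h.sw (V.Pm c)) x := by
      rw [pair_sub_left, pair_add_right, h.pair_sw, ← h.Pp_sw, ← pair_Pp, ← pair_Pp, ha.Pp_eq]
      simp
    rw [map_sub, LinearMap.sub_apply, h2, ← h3]
    exact sub_self _
  have h0 : V.splitting x (C.anchor x (a x)) = V.liftPlus x (C.anchor x (a x))
      - (1 / 2 : ℝ) • C.coanchor x (V.metric x (C.anchor x (a x))) := rfl
  rw [h0, key, h.liftPlus_anchor (ha x)]
  simp only [ContMDiffSection.coe_sub, ContMDiffSection.coe_add, ContMDiffSection.coe_smul,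
    Pi.sub_apply, Pi.add_apply, Pi.smul_apply]
  module

theorem pair_tor_plus {a b c : C.Sec} (ha : V.IsPlus a) (hb : V.IsPlus b) (hc : V.IsPlus c) :
    C.pair (h.tor a b) c x = (1 / 4) * C.pair (C.br (a + h.sw a) (b + h.sw b)) (c + h.sw c) x := by
  have hbis : ∀ {a b c : C.Sec}, V.IsPlus a → V.IsPlus b → V.IsPlus c →
      C.pair (h.bis a b) c = C.pair (C.br (h.sw a) b) c := fun {a b c} ha hb hc => by
    simp [bis, ha.Pp_eq, ha.Pm_eq, hb.Pp_eq, hb.Pm_eq, pair_Pp, hc.Pp_eq]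
  have hN : ∀ {a b c : C.Sec}, V.IsPlus a → V.IsPlus b → V.IsPlus c →
      C.pair (C.br c (h.sw a)) (h.sw b) x = C.pair (C.br (h.sw a) b) c x
        - C.pair (C.br (h.sw b) a) c x - C.pair (C.br a b) c x := fun {a b c} ha hb hc => by
    have h1 : C.pair (C.br (a - h.sw a) (b - h.sw b)) c x = 0 := by
      rw [br_sub_sw]; simp [pair]
    simp only [map_sub, LinearMap.sub_apply, pair_sub_left] at h1
    have h2 : C.pair (C.br a (h.sw b)) c = - C.pair (C.br (h.sw b) a) c :=
      pair_br_anti (pair_plus_minus ha (h.isMinus_sw hb)) _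
    have h3 : C.pair (C.br (h.sw a) (h.sw b)) c = C.pair (C.br c (h.sw a)) (h.sw b) := by
      rw [pair_br_left (pair_plus_minus hc (h.isMinus_sw ha))
        (pair_plus_minus hc (h.isMinus_sw hb)), pair_comm]
    rw [h2, h3] at h1
    simp only [Pi.sub_apply, Pi.neg_apply] at h1
    linarith
  -- Subtracting the vanishing bracket of a − `sw` a and b − `sw` b leaves twice the mixed brackets.
  have hsum : C.br (a + h.sw a) (b + h.sw b) = (2 : ℝ) • (C.br a (h.sw b) + C.br (h.sw a) b) := by
    have h1 := h.br_sub_sw a b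
    simp only [map_sub, map_add, LinearMap.sub_apply, LinearMap.add_apply] at h1 ⊢
    rw [two_smul, ← sub_eq_zero]
    rw [← h1]
    abel
  have e1 : C.pair (C.br a (h.sw b)) c = - C.pair (C.br (h.sw b) a) c :=
    pair_br_anti (pair_plus_minus ha (h.isMinus_sw hb)) _
  have e2 : C.pair (C.br (h.sw a) b) (h.sw c) = - C.pair (C.br b (h.sw a)) (h.sw c) :=
    pair_br_anti (pair_minus_plus (h.isMinus_sw ha) hb) _
  rw [hsum, pair_tor, hbis ha hb hc, hbis hb ha hc, hbis hc ha hb, hbis hc hb ha, C.pair_cb,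
    pair_smul_left, pair_add_left, pair_add_right, pair_add_right, e1, e2]
  simp only [Pi.smul_apply, Pi.add_apply, Pi.neg_apply, smul_eq_mul]
  rw [hN hb hc ha, hN ha hc hb]
  have d1 := C.der_pair (h.sw a) b c x
  have d2 := C.der_pair (h.sw b) a c x
  have d3 := C.der_pair a b c x
  have d4 := C.der_pair b a c x
  have d5 := C.pair_br_symm a b c x
  rw [h.der_sw, C.pair_comm b (C.br _ _)] at d1
  rw [h.der_sw, C.pair_comm a (C.br _ _)] at d2
  rw [C.pair_comm b (C.br a c)] at d3
  rw [C.pair_comm a (C.br b c)] at d4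
  linarith

theorem splitting_curvature {a b c : C.Sec} (ha : V.IsPlus a) (hb : V.IsPlus b) (hc : V.IsPlus c) :
    2 * C.pairing x (C.courantBracket (fun y => V.splitting y (C.anchor y (a y)))
      (fun y => V.splitting y (C.anchor y (b y))) x) (V.splitting x (C.anchor x (c x)))
      = C.pair (h.tor a b) c x := by
  set u : C.Sec → C.Sec := fun a => (1 / 2 : ℝ) • (a + h.sw a) with hu
  have e : ∀ {a : C.Sec}, V.IsPlus a → (fun y => V.splitting y (C.anchor y (a y))) = u a :=
    fun ha => funext fun y => h.splitting_anchor ha y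
  -- The splitting is isotropic, so the Courant and Dorfman brackets agree on its image.
  have h0 : C.pair (u a) (u b) = 0 := by
    simp only [hu, pair_smul_left, pair_smul_right, pair_add_left, pair_add_right]
    rw [h.pair_sw_sw_plus ha hb, pair_plus_minus ha (h.isMinus_sw hb),
      pair_minus_plus (h.isMinus_sw ha) hb]
    simp
  have h1 : 2 * C.pair (C.cb (u a) (u b)) (u c) x = C.pair (h.tor a b) c x := by
    rw [C.pair_cb, h0, h.pair_tor_plus ha hb hc]
    have hz : C.der (u c) (0 : M → ℝ) x = 0 := congrFun (C.der_const (u c) (0 : ℝ)) x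
    rw [hz]
    simp only [hu, map_smul, LinearMap.smul_apply, pair_smul_left, pair_smul_right, Pi.smul_apply,
      smul_eq_mul]
    ring
  rw [e ha, e hb, h.splitting_anchor hc]
  exact h1

/-- Dependence on the third argument is visibly pointwise; cyclic symmetry extends this to the other
two. -/
theorem pair_tor_congr {a a' b b' c c' : C.Sec} (ha : a x = a' x) (hb : b x = b' x)
    (hc : c x = c' x) : C.pair (h.tor a b) c x = C.pair (h.tor a' b') c' x := by
  have hr : ∀ {a b c c' : C.Sec}, c x = c' x →
      C.pair (h.tor a b) c x = C.pair (h.tor a b) c' x := fun hc => by rw [pair, pair, hc]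
  rw [hr hc, pair_tor_cycle, hr ha, pair_tor_cycle, hr hb, pair_tor_cycle]

theorem tor_add_left (a a' b : C.Sec) : h.tor (a + a') b = h.tor a b + h.tor a' b := by
  simp only [tor, bisForm, bis, cb, map_add, LinearMap.add_apply]
  module

theorem tor_smul_left (r : ℝ) (a b : C.Sec) : h.tor (r • a) b = r • h.tor a b := by
  simp only [tor, bisForm, bis, cb, map_smul, map_add, LinearMap.smul_apply]
  module

/-- The torsion of the Gualtieri–Bismut connection as a three-form on the tangent space. -/
theorem exists_torsion_form (x : M) : ∃ T : TangentSpace (𝓡 d) x [⋀^Fin 3]→ₗ[ℝ] ℝ,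
    ∀ {a b c : C.Sec}, V.IsPlus a → V.IsPlus b → V.IsPlus c →
      T ![C.anchor x (a x), C.anchor x (b x), C.anchor x (c x)] = C.pair (h.tor a b) c x := by
  choose A hA hAx using fun v => h.exists_plus x v
  have hval : ∀ {a : C.Sec}, V.IsPlus a → A (C.anchor x (a x)) x = a x := fun {a} ha => by
    have h1 := h.liftPlus_anchor (hA (C.anchor x (a x)) x)
    rwa [hAx, h.liftPlus_anchor (ha x), eq_comm] at h1
  set t : TangentSpace (𝓡 d) x → TangentSpace (𝓡 d) x → TangentSpace (𝓡 d) x → ℝ :=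
    fun u v w => C.pair (h.tor (A u) (A v)) (A w) x with ht
  have hcyc : ∀ u v w, t u v w = t v w u := fun u v w => h.pair_tor_cycle _ _ _ _
  have hsw : ∀ u v w, t u v w = - t v u w := fun u v w => by
    simp only [ht]; rw [tor_swap, pair_neg_left]; rfl
  have hadd : ∀ u u' v w, t (u + u') v w = t u v w + t u' v w := fun u u' v w => by
    have e : A (u + u') x = (A u + A u') x := by
      have := hval (a := A u + A u') fun y => add_mem (hA u y) (hA u' y)
      rwa [ContMDiffSection.coe_add, Pi.add_apply, map_add, hAx, hAx] at this
    simp only [ht]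
    rw [h.pair_tor_congr e rfl rfl, tor_add_left, pair_add_left]; rfl
  have hsmul : ∀ (r : ℝ) u v w, t (r • u) v w = r * t u v w := fun r u v w => by
    have e : A (r • u) x = (r • A u) x := by
      have := hval (a := r • A u) fun y => Submodule.smul_mem _ r (hA u y)
      rwa [ContMDiffSection.coe_smul, Pi.smul_apply, map_smul, hAx] at this
    simp only [ht]
    rw [h.pair_tor_congr e rfl rfl, tor_smul_left, pair_smul_left]; rfl
  have hself : ∀ u v, t u u v = 0 := fun u v => by linarith [hsw u u v]
  -- Linearity is known in the first slot; cyclic rotation carries it to the others.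
  refine ⟨{ toFun := fun m => t (m 0) (m 1) (m 2)
            map_update_add' := ?_
            map_update_smul' := ?_
            map_eq_zero_of_eq' := ?_ }, fun ha hb hc =>
      h.pair_tor_congr (hval ha) (hval hb) (hval hc)⟩
  · intro inst m i u v
    cases Subsingleton.elim inst (instDecidableEqFin 3)
    fin_cases i
    · simpa [Function.update] using hadd _ _ _ _
    · simpa [Function.update, hcyc (m 0)] using hadd _ _ _ _
    · simpa [Function.update, ← hcyc _ (m 0)] using hadd _ _ _ _
  · intro inst m i r u
    cases Subsingleton.elim inst (instDecidableEqFin 3)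
    fin_cases i
    · simpa [Function.update] using hsmul _ _ _ _
    · simpa [Function.update, hcyc (m 0)] using hsmul _ _ _ _
    · simpa [Function.update, ← hcyc _ (m 0)] using hsmul _ _ _ _
  · intro m i j hm hij
    fin_cases i <;> fin_cases j <;> simp at hij hm ⊢
    · rw [hm, hself]
    · rw [hm, hcyc, hcyc, hself]
    · rw [hm, hself]
    · rw [hm, hcyc, hself]
    · rw [hm, hcyc, hcyc, hself]
    · rw [hm, hcyc, hself]

/-- The torsion form satisfies the condition defining `curvatureForm`, since every smooth vector
field is the anchor of a section of V₊; so the chosen form obeys it as well. -/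
theorem curvatureForm_apply {a b c : C.Sec} (ha : V.IsPlus a) (hb : V.IsPlus b) (hc : V.IsPlus c) :
    V.curvatureForm x ![C.anchor x (a x), C.anchor x (b x), C.anchor x (c x)]
      = C.pair (h.tor a b) c x := by
  have hex : ∃ η : TangentSpace (𝓡 d) x [⋀^Fin 3]→ₗ[ℝ] ℝ,
      ∀ X Y Z : ∀ y : M, TangentSpace (𝓡 d) y, IsSmoothVF X → IsSmoothVF Y → IsSmoothVF Z →
        η ![X x, Y x, Z x] = 2 * C.pairing x
          (C.courantBracket (fun y => V.splitting y (X y)) (fun y => V.splitting y (Y y)) x)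
          (V.splitting x (Z x)) := by
    obtain ⟨T, hT⟩ := h.exists_torsion_form x
    refine ⟨T, fun X Y Z hX hY hZ => ?_⟩
    have hl : ∀ (X : ∀ y : M, TangentSpace (𝓡 d) y), IsSmoothVF X →
        ∃ a : C.Sec, V.IsPlus a ∧ X = fun y => C.anchor y (a y) := fun X hX =>
      ⟨C.mkSec _ (h.liftPlus_smooth X hX), fun y => h.liftPlus_mem y _,
        funext fun y => (h.anchor_liftPlus y _).symm⟩
    obtain ⟨a, ha, rfl⟩ := hl X hX
    obtain ⟨b, hb, rfl⟩ := hl Y hY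
    obtain ⟨c, hc, rfl⟩ := hl Z hZ
    rw [hT ha hb hc, h.splitting_curvature ha hb hc]
  rw [← h.splitting_curvature ha hb hc]
  exact Classical.epsilon_spec hex _ _ _ (C.anchor_smooth a a.smooth) (C.anchor_smooth b b.smooth)
    (C.anchor_smooth c c.smooth)

end CurvatureForm

end CourantAlgebroid.GeneralizedMetric.Regular

/-! ### The Clifford action of an orthonormal basis on forms -/

section Forms

variable {ι W : Type*} [Fintype ι] [DecidableEq ι] [AddCommGroup W] [Module ℝ W]
  (η : ι → ℝ) (b : Basis ι ℝ W)

/-- The Clifford action of an orthonormal basis vector on forms. -/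
def formClifford (i : ι) : Module.End ℝ (ExteriorAlgebra ℝ (Dual ℝ W)) :=
  CliffordAlgebra.contractLeft (Dual.eval ℝ W (b i))
    + η i • LinearMap.mulLeft ℝ (ExteriorAlgebra.ι ℝ (b.coord i))

theorem formClifford_apply (i : ι) (α : ExteriorAlgebra ℝ (Dual ℝ W)) :
    formClifford η b i α = CliffordAlgebra.contractLeft (Dual.eval ℝ W (b i)) α
      + η i • (ExteriorAlgebra.ι ℝ (b.coord i) * α) := rfl

theorem contractLeft_coord_mul (i j : ι) (α : ExteriorAlgebra ℝ (Dual ℝ W)) :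
    CliffordAlgebra.contractLeft (Dual.eval ℝ W (b i)) (ExteriorAlgebra.ι ℝ (b.coord j) * α)
      = (if i = j then (1 : ℝ) else 0) • α
        - ExteriorAlgebra.ι ℝ (b.coord j) * CliffordAlgebra.contractLeft (Dual.eval ℝ W (b i)) α := by
  have h := CliffordAlgebra.contractLeft_ι_mul (Q := (0 : QuadraticForm ℝ (Dual ℝ W)))
    (Dual.eval ℝ W (b i)) (b.coord j) α
  rw [h, Dual.eval_apply, Basis.coord_apply, Basis.repr_self, Finsupp.single_apply]

theorem formClifford_anticomm {i j : ι} (hij : i ≠ j) (α : ExteriorAlgebra ℝ (Dual ℝ W)) :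
    formClifford η b i (formClifford η b j α) = - formClifford η b j (formClifford η b i α) := by
  have h1 := CliffordAlgebra.contractLeft_comm (Q := (0 : QuadraticForm ℝ (Dual ℝ W)))
    (d := Dual.eval ℝ W (b i)) (d' := Dual.eval ℝ W (b j)) α
  have h2 : ExteriorAlgebra.ι ℝ (b.coord i) * ExteriorAlgebra.ι ℝ (b.coord j)
      = - (ExteriorAlgebra.ι ℝ (b.coord j) * ExteriorAlgebra.ι ℝ (b.coord i)) :=
    eq_neg_of_add_eq_zero_left (ExteriorAlgebra.ι_add_mul_swap _ _)
  simp only [formClifford_apply, map_add, map_smul, contractLeft_coord_mul,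
    if_neg hij, if_neg hij.symm, zero_smul, zero_sub]
  rw [h1, ← mul_assoc, ← mul_assoc, h2, neg_mul]
  module

theorem formClifford_sq (i : ι) (α : ExteriorAlgebra ℝ (Dual ℝ W)) :
    formClifford η b i (formClifford η b i α) = η i • α := by
  have h1 := CliffordAlgebra.contractLeft_contractLeft (Q := (0 : QuadraticForm ℝ (Dual ℝ W)))
    (d := Dual.eval ℝ W (b i)) α
  simp only [formClifford_apply, map_add, map_smul, contractLeft_coord_mul, if_true, one_smul]
  rw [h1, ← mul_assoc, ExteriorAlgebra.ι_sq_zero, zero_mul]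
  module

/-- The iterated Clifford action. -/
def cliffordWord (l : List ι) (α : ExteriorAlgebra ℝ (Dual ℝ W)) : ExteriorAlgebra ℝ (Dual ℝ W) :=
  l.foldr (fun i => formClifford η b i) α

@[simp] theorem cliffordWord_nil (α : ExteriorAlgebra ℝ (Dual ℝ W)) : cliffordWord η b [] α = α := rfl

@[simp] theorem cliffordWord_cons (i : ι) (l : List ι) (α : ExteriorAlgebra ℝ (Dual ℝ W)) :
    cliffordWord η b (i :: l) α = formClifford η b i (cliffordWord η b l α) := rfl

/-- Distinct generators anticommute. The sign is recorded only through s² = 1, enough for comparing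
squares of components. -/
theorem cliffordWord_perm {l l' : List ι} (h : l.Perm l') (hl : l.Nodup) :
    ∃ s : ℝ, s * s = 1 ∧ ∀ α, cliffordWord η b l α = s • cliffordWord η b l' α := by
  induction h with
  | nil => exact ⟨1, one_mul 1, fun α => (one_smul _ _).symm⟩
  | cons i _ ih =>
    obtain ⟨s, hs, h⟩ := ih hl.of_cons
    exact ⟨s, hs, fun α => by rw [cliffordWord_cons, h, map_smul, cliffordWord_cons]⟩
  | swap i j l =>
    refine ⟨-1, by norm_num, fun α => ?_⟩
    have hij : j ≠ i := fun h => by simp [h] at hl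
    simp only [cliffordWord_cons, formClifford_anticomm η b hij, neg_smul, one_smul]
  | trans h₁ _ ih₁ ih₂ =>
    obtain ⟨s, hs, h⟩ := ih₁ hl
    obtain ⟨t, ht, h'⟩ := ih₂ (h₁.nodup hl)
    exact ⟨s * t, by linear_combination t * t * hs + ht, fun α => by rw [h, h', mul_smul]⟩

theorem algebraMapInv_ι_mul (ξ : Dual ℝ W) (α : ExteriorAlgebra ℝ (Dual ℝ W)) :
    ExteriorAlgebra.algebraMapInv (ExteriorAlgebra.ι ℝ ξ * α) = (0 : ℝ) := by
  rw [map_mul, ExteriorAlgebra.algebraMapInv, ExteriorAlgebra.lift_ι_apply]; simp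

/-- The coefficient functional of a three-form. -/
def tripleContract (i j k : ι) : ExteriorAlgebra ℝ (Dual ℝ W) →ₗ[ℝ] ℝ :=
  ExteriorAlgebra.algebraMapInv.toLinearMap
    ∘ₗ CliffordAlgebra.contractLeft (Dual.eval ℝ W (b i))
    ∘ₗ CliffordAlgebra.contractLeft (Dual.eval ℝ W (b j))
    ∘ₗ CliffordAlgebra.contractLeft (Dual.eval ℝ W (b k))

theorem tripleContract_apply (i j k : ι) (α : ExteriorAlgebra ℝ (Dual ℝ W)) :
    tripleContract b i j k α = ExteriorAlgebra.algebraMapInv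
      (CliffordAlgebra.contractLeft (Dual.eval ℝ W (b i))
        (CliffordAlgebra.contractLeft (Dual.eval ℝ W (b j))
          (CliffordAlgebra.contractLeft (Dual.eval ℝ W (b k)) α))) := rfl

/-- For distinct indices contractions anticommute with the wedge factors, so every term containing a
wedge factor can start with one and has no scalar part; only the triple contraction survives. -/
theorem algebraMapInv_cliffordWord {i j k : ι} (hij : i ≠ j) (hik : i ≠ k) (hjk : j ≠ k)
    (α : ExteriorAlgebra ℝ (Dual ℝ W)) :
    ExteriorAlgebra.algebraMapInv (cliffordWord η b [i, j, k] α) = tripleContract b i j k α := by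
  simp only [cliffordWord_cons, cliffordWord_nil, formClifford_apply, map_add, map_smul,
    contractLeft_coord_mul, if_neg hij, if_neg hik, if_neg hjk, zero_smul, zero_sub, map_neg,
    mul_neg, algebraMapInv_ι_mul, tripleContract_apply]
  simp

end Forms

/-! ### Eigenforms of the volume element are null -/

section ThreeForms

variable {W : Type*} [AddCommGroup W] [Module ℝ W] (b : Basis (Fin 6) ℝ W)
  (T : W [⋀^Fin 3]→ₗ[ℝ] ℝ)

theorem threeForm_swap_left (u v w : W) : T ![u, v, w] = - T ![v, u, w] := by
  rw [← T.map_swap ![v, u, w] (i := 0) (j := 1) (by decide)]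
  congr 1
  funext i
  fin_cases i <;> rfl

theorem threeForm_swap_right (u v w : W) : T ![u, v, w] = - T ![u, w, v] := by
  rw [← T.map_swap ![u, w, v] (i := 1) (j := 2) (by decide)]
  congr 1
  funext i
  fin_cases i <;> rfl

theorem tripleContract_formSpinor (i j k : Fin 6) :
    tripleContract b i j k (formSpinor b T) = T ![b k, b j, b i] := by
  set δ : Fin 6 → Fin 6 → ℝ := fun a c => if a = c then 1 else 0 with hδ
  have h0 : ∀ a c : Fin 6, CliffordAlgebra.contractLeft (Dual.eval ℝ W (b a))
      (ExteriorAlgebra.ι ℝ (b.coord c)) = δ a c • 1 := fun a c => by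
    have := contractLeft_coord_mul b a c 1
    have e := CliffordAlgebra.contractLeft_one (Q := (0 : QuadraticForm ℝ (Dual ℝ W)))
      (d := Dual.eval ℝ W (b a))
    rw [mul_one, e, mul_zero, sub_zero] at this
    exact this
  have h0' : ∀ (a c : Fin 6) (α : ExteriorAlgebra ℝ (Dual ℝ W)),
      CliffordAlgebra.contractLeft (Dual.eval ℝ W (b a)) (ExteriorAlgebra.ι ℝ (b.coord c) * α)
        = δ a c • α - ExteriorAlgebra.ι ℝ (b.coord c) *
          CliffordAlgebra.contractLeft (Dual.eval ℝ W (b a)) α := contractLeft_coord_mul b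
  have h1 : ∀ p q r, tripleContract b i j k (ExteriorAlgebra.ι ℝ (b.coord p)
      * ExteriorAlgebra.ι ℝ (b.coord q) * ExteriorAlgebra.ι ℝ (b.coord r))
      = δ k p * (δ j q * δ i r) - δ k p * (δ j r * δ i q) - δ k q * (δ j p * δ i r)
        + δ k q * (δ j r * δ i p) + δ k r * (δ j p * δ i q) - δ k r * (δ j q * δ i p) := by
    intro p q r
    have s1 : CliffordAlgebra.contractLeft (Dual.eval ℝ W (b k)) (ExteriorAlgebra.ι ℝ (b.coord p)
        * (ExteriorAlgebra.ι ℝ (b.coord q) * ExteriorAlgebra.ι ℝ (b.coord r)))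
        = δ k p • (ExteriorAlgebra.ι ℝ (b.coord q) * ExteriorAlgebra.ι ℝ (b.coord r))
          - δ k q • (ExteriorAlgebra.ι ℝ (b.coord p) * ExteriorAlgebra.ι ℝ (b.coord r))
          + δ k r • (ExteriorAlgebra.ι ℝ (b.coord p) * ExteriorAlgebra.ι ℝ (b.coord q)) := by
      rw [h0', h0', h0, mul_sub, mul_smul_comm, mul_smul_comm, mul_smul_comm, mul_one]
      abel
    have s2 : ∀ u v, ExteriorAlgebra.algebraMapInv
        (CliffordAlgebra.contractLeft (Dual.eval ℝ W (b i))
          (CliffordAlgebra.contractLeft (Dual.eval ℝ W (b j))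
            (ExteriorAlgebra.ι ℝ (b.coord u) * ExteriorAlgebra.ι ℝ (b.coord v))))
        = δ j u * δ i v - δ j v * δ i u := fun u v => by
      rw [h0', h0, mul_smul_comm, mul_one, map_sub, map_smul, map_smul, h0, h0, map_sub, map_smul,
        map_smul, map_smul, map_smul, map_one]
      simp only [smul_eq_mul, mul_one]
    rw [tripleContract_apply, mul_assoc, s1, map_add, map_sub, map_add, map_sub, map_add, map_sub]
    simp only [map_smul, s2, smul_eq_mul]
    ring
  rw [formSpinor]
  simp only [map_sum, map_smul, h1, smul_eq_mul]
  simp only [hδ, mul_add, mul_sub, mul_ite, mul_one, mul_zero, Finset.sum_add_distrib,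
    Finset.sum_sub_distrib, Finset.sum_ite_eq, Finset.sum_ite_irrel, Finset.sum_const_zero,
    Finset.mem_univ, if_true]
  -- The six Kronecker terms agree up to the sign of a permutation and absorb the factor 1/6 of
  -- `formSpinor`.
  have e1 := threeForm_swap_right T (b k) (b i) (b j)
  have e2 := threeForm_swap_left T (b j) (b k) (b i)
  have e3 := threeForm_swap_right T (b j) (b i) (b k)
  have e4 := threeForm_swap_left T (b i) (b k) (b j)
  have e5 := threeForm_swap_right T (b i) (b j) (b k)
  linarith

/-- A three-form which is an eigenform of the Clifford action of the volume element has equal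
squared components on complementary triples. -/
theorem sq_eq_sq_of_volume_eigen
    (h : cliffordWord lorentzSign b [5, 4, 3, 2, 1, 0] (formSpinor b T) = - formSpinor b T)
    {i j k l m n : Fin 6} (hp : ([k, j, i, l, m, n] : List (Fin 6)).Perm [5, 4, 3, 2, 1, 0]) :
    T ![b i, b j, b k] * T ![b i, b j, b k] = T ![b l, b m, b n] * T ![b l, b m, b n] := by
  have hn : ([k, j, i, l, m, n] : List (Fin 6)).Nodup := hp.nodup_iff.2 (by decide)
  obtain ⟨s, hs, hw⟩ := cliffordWord_perm lorentzSign b hp hn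
  have h1 := hw (formSpinor b T)
  rw [h] at h1
  -- The word i, j, k cancels the initial letters k, j, i up to signs. The scalar parts of both
  -- sides are then components of `T` on the two complementary triples.
  have h2 := congrArg (cliffordWord lorentzSign b [i, j, k]) h1
  simp only [cliffordWord_cons, cliffordWord_nil, formClifford_sq, map_smul, map_neg] at h2
  have h3 := congrArg ExteriorAlgebra.algebraMapInv h2
  have hij : i ≠ j := by rintro rfl; simp at hn
  have hik : i ≠ k := by rintro rfl; simp at hn
  have hjk : j ≠ k := by rintro rfl; simp at hn
  have hlm : l ≠ m := by rintro rfl; simp at hn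
  have hln : l ≠ n := by rintro rfl; simp at hn
  have hmn : m ≠ n := by rintro rfl; simp at hn
  have e1 := algebraMapInv_cliffordWord lorentzSign b hij hik hjk (formSpinor b T)
  have e2 := algebraMapInv_cliffordWord lorentzSign b hlm hln hmn (formSpinor b T)
  simp only [cliffordWord_cons, cliffordWord_nil, tripleContract_formSpinor] at e1 e2
  simp only [map_smul, map_neg, e1, e2, smul_eq_mul] at h3
  rw [threeForm_swap_left T (b k), threeForm_swap_right T (b j), threeForm_swap_left T (b j),
    threeForm_swap_left T (b n), threeForm_swap_right T (b m), threeForm_swap_left T (b m)] at h3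
  have h4 := congrArg (fun r => r * r) h3
  have hk := lorentzSign_mul_self k
  have hj := lorentzSign_mul_self j
  have hi := lorentzSign_mul_self i
  set t := T ![b i, b j, b k]
  set u := T ![b l, b m, b n]
  have h5 : (lorentzSign i * lorentzSign i) * (lorentzSign j * lorentzSign j) *
      (lorentzSign k * lorentzSign k) * (u * u) = (s * s) * (t * t) := by
    linear_combination h4
  rw [hi, hj, hk, hs] at h5
  linarith

theorem cliffordWord_eq_neg_of_volume_fixed
    {c : Fin 6 → ExteriorAlgebra ℝ (Dual ℝ W) → ExteriorAlgebra ℝ (Dual ℝ W)}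
    (hc : ∀ i α, c i α = formClifford lorentzSign b i α) {α : ExteriorAlgebra ℝ (Dual ℝ W)}
    (h : -c 5 (c 4 (c 3 (c 2 (c 1 (c 0 α))))) = α) :
    cliffordWord lorentzSign b [5, 4, 3, 2, 1, 0] α = - α := by
  rw [← neg_eq_iff_eq_neg]
  simp only [hc] at h
  simpa only [cliffordWord_cons, cliffordWord_nil] using h

/-- Repeated indices contribute nothing. A triple containing 0 has weight +1 and its complement
weight −1, so the ten complementary pairs cancel one by one. -/
theorem tr3_sq_eq_zero {m : Fin 6 → Fin 6 → Fin 6 → ℝ} (hl : ∀ i j k, m i j k = m j i k)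
    (hr : ∀ i j k, m i j k = m i k j) (h0 : ∀ i j, m i i j = 0)
    (hc : ∀ i j k l p n : Fin 6, ([k, j, i, l, p, n] : List (Fin 6)).Perm [5, 4, 3, 2, 1, 0] →
      m i j k = m l p n) : CliffordFrame.tr3 lorentzSign m = 0 := by
  have h1 : ∀ i j, m i j i = 0 := fun i j => by rw [hr, h0]
  have h2 : ∀ i j, m i j j = 0 := fun i j => by rw [hl, h1]
  have c1 := hc 0 1 2 3 4 5 (by decide)
  have c2 := hc 0 1 3 2 4 5 (by decide)
  have c3 := hc 0 1 4 2 3 5 (by decide)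
  have c4 := hc 0 1 5 2 3 4 (by decide)
  have c5 := hc 0 2 3 1 4 5 (by decide)
  have c6 := hc 0 2 4 1 3 5 (by decide)
  have c7 := hc 0 2 5 1 3 4 (by decide)
  have c8 := hc 0 3 4 1 2 5 (by decide)
  have c9 := hc 0 3 5 1 2 4 (by decide)
  have c10 := hc 0 4 5 1 2 3 (by decide)
  have s0 : lorentzSign 0 = 1 := rfl
  have s1 : ∀ i : Fin 6, i ≠ 0 → lorentzSign i = -1 := fun i hi => if_neg hi
  simp only [CliffordFrame.tr3, Fin.sum_univ_six, s0, s1 1 (by decide), s1 2 (by decide),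
    s1 3 (by decide), s1 4 (by decide), s1 5 (by decide), h0, h1, h2]
  simp only [hl, hr] at c1 c2 c3 c4 c5 c6 c7 c8 c9 c10 ⊢
  linarith

end ThreeForms

/-! ### Self-duality makes the torsion null -/

namespace CourantAlgebroid.GeneralizedMetric

section SelfDual

variable {M : Type*} [TopologicalSpace M] [ChartedSpace (EuclideanSpace ℝ (Fin 6)) M] [IsManifold (𝓡 6) ∞ M]
  {F : Type*} [NormedAddCommGroup F] [NormedSpace ℝ F]
  {E : M → Type*} [TopologicalSpace (TotalSpace F E)]
  [∀ x, AddCommGroup (E x)] [∀ x, Module ℝ (E x)] [∀ x, TopologicalSpace (E x)] [FiberBundle F E]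
  [VectorBundle ℝ F E] [T2Space M] [ContMDiffVectorBundle ∞ F E (𝓡 6)]
  {C : CourantAlgebroid 6 F E} {V : C.GeneralizedMetric} {U : Set M}

namespace PlusFrame

variable (P : V.PlusFrame U) {x : M} (hx : x ∈ U) {b : Basis (Fin 6) ℝ (TangentSpace (𝓡 6) x)}
  (hb : ∀ i, b i = C.anchor x (P.e i x))
include hx hb

/-- The covector part of eᵢ is 2⟨eᵢ, s(·)⟩. As s(πeⱼ) = ½(eⱼ + fⱼ) and fⱼ is orthogonal to V₊, it
equals ηᵢ times the dual basis covector. -/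
theorem cliffordAct_eq (i : Fin 6) (α : ExteriorAlgebra ℝ (Dual ℝ (TangentSpace (𝓡 6) x))) :
    V.cliffordAct x (P.e i x) α = formClifford lorentzSign b i α := by
  have h1 : (2 : ℝ) • (C.pairing x (P.e i x) ∘ₗ V.splitting x) = lorentzSign i • b.coord i := by
    refine b.ext fun j => ?_
    have h2 : C.pairing x (P.e i x) (V.splitting x (b j)) = (1 / 2) * C.pair (P.e i) (P.e j) x := by
      rw [hb, P.regular.splitting_anchor (P.isPlus j)]
      have h3 := congrFun (C.pair_smul_right (1 / 2) (P.e i) (P.e j + P.regular.sw (P.e j))) x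
      rw [pair_add_right, pair_plus_minus (P.isPlus i) (P.regular.isMinus_sw (P.isPlus j)),
        add_zero] at h3
      exact h3
    rw [LinearMap.smul_apply, LinearMap.comp_apply, h2, P.pair_e x hx, LinearMap.smul_apply,
      Basis.coord_apply, Basis.repr_self, Finsupp.single_apply]
    by_cases h : i = j
    · subst h; simp
    · simp [h, Ne.symm h]
  rw [cliffordAct, h1, formClifford_apply, hb, map_smul, smul_mul_assoc]

theorem tr3_H3_eq_zero {o : ManifoldOrientation 6 M} (hsd : V.IsSelfDual o)
    (ho : b.orientation = o.at_ x) :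
    CliffordFrame.tr3 lorentzSign (fun i j k => P.H3 i j k x * P.H3 i j k x) = 0 := by
  have h1 := hsd x (fun i => P.e i x) b
    ⟨fun i => P.isPlus i x, fun i j => P.pair_e x hx i j⟩ hb ho
  have h2 := cliffordWord_eq_neg_of_volume_fixed b (c := fun i => V.cliffordAct x (P.e i x))
    (fun i α => cliffordAct_eq P hx hb i α) h1
  have h3 : ∀ i j k, V.curvatureForm x ![b i, b j, b k] = P.H3 i j k x := fun i j k => by
    rw [hb, hb, hb]
    exact P.regular.curvatureForm_apply (P.isPlus i) (P.isPlus j) (P.isPlus k)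
  refine tr3_sq_eq_zero (fun i j k => ?_) (fun i j k => ?_) (fun i j => ?_)
    fun i j k l p n hp => ?_
  · rw [H3_swap_left]; ring
  · rw [H3_swap_right]; ring
  · rw [H3_left_self]; simp
  · simpa only [h3] using sq_eq_sq_of_volume_eigen b _ h2 hp

end PlusFrame

theorem HasSignature.finrank_eq {p q : ℕ} (hsig : V.HasSignature p q) (x : M) :
    finrank ℝ (V.plus x) = p + q := by
  obtain ⟨b, -⟩ := hsig x
  rw [finrank_eq_card_basis b]; simp

/-- The orthonormal frame over `U` given by the projection of sections which are orthonormal in `V₊`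
over `U`. -/
theorem Regular.exists_plusFrame (h : V.Regular) (hdim : ∀ x, finrank ℝ (V.plus x) = 6)
    (hU : IsOpen U) {e : Fin 6 → C.Sec} (he : ∀ x ∈ U, V.IsOrthonormalPlus x fun i => e i x) :
    ∃ P : V.PlusFrame U, ∀ i, ∀ x ∈ U, e i x = P.e i x := by
  have h1 : ∀ i, ∀ x ∈ U, V.Pp (e i) x = e i x := fun i x hx =>
    Pp_apply_of_mem_plus ((he x hx).1 i)
  exact ⟨⟨fun i => V.Pp (e i), hU, h, fun i => isPlus_Pp _, fun x hx i j => by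
    rw [pair, h1 i x hx, h1 j x hx, (he x hx).2 i j], hdim⟩, fun i x hx => (h1 i x hx).symm⟩

end SelfDual

end CourantAlgebroid.GeneralizedMetric

end

/-! ### The main theorem -/

theorem mainTheorem2
    {M : Type*} [TopologicalSpace M] [T2Space M] [SecondCountableTopology M]
    [ChartedSpace (EuclideanSpace ℝ (Fin 6)) M] [IsManifold (𝓡 6) ∞ M]
    (o : ManifoldOrientation 6 M)
    {F : Type*} [NormedAddCommGroup F] [NormedSpace ℝ F] [FiniteDimensional ℝ F]
    {E : M → Type*} [TopologicalSpace (TotalSpace F E)]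
    [∀ x, AddCommGroup (E x)] [∀ x, Module ℝ (E x)] [∀ x, TopologicalSpace (E x)]
    [FiberBundle F E] [VectorBundle ℝ F E] [ContMDiffVectorBundle ∞ F E (𝓡 6)]
    (C : CourantAlgebroid 6 F E) (hC : C.IsExact)
    (V : C.GeneralizedMetric) (hsig : V.HasSignature 1 5) (hadm : V.IsAdmissible)
    (hsd : V.IsSelfDual o) (hric : V.IsRicciFlat) :
    V.SatisfiesVacuumEinstein o := by
  have hdim : ∀ x, finrank ℝ (V.plus x) = 6 := hsig.finrank_eq
  have hfin : ∀ x, FiniteDimensional ℝ (V.plus x) := fun x =>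
    .of_finrank_pos (by rw [hdim]; norm_num)
  have hreg : V.Regular := .of_admissible hC hadm hdim hfin
  refine ⟨hric, contMDiff_const, ?_⟩
  intro S _ _ _ γ hγ U e f hU hes hfs he hf hb ε hε _ x hx
  -- The given frame lies in V₊ only over `U`; it is replaced by sections of V₊ over all of `M`
  -- which agree with it there, so the local expressions are unchanged on `U`.
  obtain ⟨P, hP⟩ := hreg.exists_plusFrame hdim hU (e := fun i => C.mkSec (e i) (hes i)) he
  obtain ⟨b, hbe, ho⟩ := hb x hx
  have hbP : ∀ i, b i = C.anchor x (P.e i x) := fun i => by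
    rw [hbe, ← hP i x hx]; rfl
  have hH := P.tr3_H3_eq_zero hx hbP hsd ho
  have key := P.dirac_dirac_eq_roughLaplacian hγ (fs := fun i => C.mkSec (f i) (hfs i)) hP hf hric
    hx hH hε
  rw [zero_smul, add_zero]
  exact key
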